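/- **Setting.** Let $\hat T\subset\mathbb R^3$ be a fixed (nondegenerate, closed) tetrahedron, let $\triangle(\hat T)$ be the set of its subsimplices and $\triangle_d(\hat T)$ the set of those of dimension $d$. Write $\mathbb V=\mathbb R^3$, $\mathbb M=\mathbb R^{3\times3}$, $A:B=\operatorname{tr}(AB^{\top})$, $S_1W=W^{\top}-\operatorname{tr}(W)I$. Gradient, curl and divergence act on the rows of matrix fields. $\mathcal P_m$ denotes polynomials of degree at most $m$ (with $\mathcal P_m=\{0\}$ for $m<0$), $\mathcal P_m(\cdot\,;\mathbb V)$ and $\mathcal P_m(\cdot\,;\mathbb M)$ the fields with components in $\mathcal P_m$, and $\boldsymbol n$ a unit normal of a face $F$. Put $\mathcal P_m^-\Lambda^2=\mathcal P_{m-1}(\hat T;\mathbb V)+\boldsymbol x\,\mathcal P_{m-1}(\hat T)$ and $\mathcal P_m^-\Lambda^1=\mathcal P_{m-1}(\hat T;\mathbb V)+\boldsymbol x\times\mathcal P_{m-1}(\hat T;\mathbb V)$. On a face $F$ let $\mathcal P_m^-\Lambda^1(F)$ be the tangential fields $\boldsymbol q+s\,\boldsymbol y^{\perp}$, where $\boldsymbol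 q$ is a tangential field with components in $\mathcal P_{m-1}(F)$, $s\in\mathcal P_{m-1}(F)$, and $\boldsymbol y^{\perp}$ is the in-plane position vector rotated by a right angle. An *order function* is a map $\tilde\rho:\triangle(\hat T)\to\mathbb Z_{\ge0}$ with $\tilde\rho(e)\le\tilde\rho(f)$ whenever $e\subset f$. Define $$\mathcal P_{\tilde\rho}^-\Lambda^2(\hat T)=\{\omega\in\mathcal P^-_{\tilde\rho(\hat T)}\Lambda^2:\ \omega\cdot\boldsymbol n|_F\in\mathcal P_{\tilde\rho(F)-1}(F)\ \ \forall F\in\triangle_2(\hat T)\},$$ $$\mathcal P_{\tilde\rho}^-\Lambda^1(\hat T)=\{\omega\in\mathcal P^-_{\tilde\rho(\hat T)}\Lambda^1:\ (\omega-(\omega\cdot\boldsymbol n)\boldsymbol n)|_F\in\mathcal P^-_{\tilde\rho(F)}\Lambda^1(F)\ \ \forall F\in\triangle_2(\hat T),\ \ \omega\cdot\boldsymbol t|_e\in\mathcal P_{\tilde\rho(e)-1}(e)\ \ \forall e\in\triangle_1(\hat T)\},$$ with $\boldsymbol t$ a tangent vector of the edge $e$. Let $\mathcal P_{\tilde\rho}^-\Lambda^j(\hat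 T;\mathbb V)$ be the matrix fields whose rows lie in $\mathcal P_{\tilde\rho}^-\Lambda^j(\hat T)$, $j=1,2$. Fix an integer $r\ge0$. Let $\mathring{\mathcal P}_{r+1}\Lambda^1(\hat T;\mathbb V)$ be the fields in $\mathcal P_{r+1}(\hat T;\mathbb M)$ whose rows have vanishing tangential part on every face, let $f_1,\dots,f_k$ be a basis of $\operatorname{curl}\mathring{\mathcal P}_{r+1}\Lambda^1(\hat T;\mathbb V)$, and let $g_1,\dots,g_k\in\mathcal P_{r-1}(\hat T;\mathbb M)$ be linearly independent with $\operatorname{span}\{g_1,\dots,g_k\}\oplus\nabla\mathcal P_r(\hat T;\mathbb V)=\mathcal P_{r-1}(\hat T;\mathbb M)$. Put $h_i(\boldsymbol x,t)=(1-t)f_i(\boldsymbol x)+t\,g_i(\boldsymbol x)$ for $1\le i\le k$. Let $\tilde r$ be an order function with $\tilde r(\hat T)=r$ and let $t\in[0,1]$. All derivatives and boundary values of $H^1$ fields below are weak derivatives and traces. * For $U\in H^1(\hat T;\mathbb M)$, the value $P=\Pi^{2,-}_{\tilde r,\hat T,t}U\in\mathcal P^-_{\tilde r+1}\Lambda^2(\hat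 T;\mathbb V)$ is to satisfy, for all $\eta\in\mathcal P_r(\hat T;\mathbb V)$ with componentwise mean value zero, all $1\le i\le k$, all faces $F$ and all $\mu\in\mathcal P_{\tilde r(F)}(F;\mathbb V)$, $$\int_{\hat T}\operatorname{div}(P-U)\cdot\eta=0,\qquad \int_{\hat T}(P-U):h_i(\cdot,t)=0,\qquad \int_F[(P-U)\boldsymbol n]\cdot\mu\,ds=0 .$$ * For $W\in H^1(\hat T;\mathbb M)$, the value $P=\Pi^{1,-}_{\tilde r,\hat T,t}W\in\mathcal P^-_{\tilde r+2}\Lambda^1(\hat T;\mathbb V)$ is to satisfy, for the same $\eta$, $i$, $F$, $\mu$, all tangent vectors $\boldsymbol t$ of $F$, and all edges $e$ with tangent vector $\boldsymbol t_e$, $$\int_{\hat T}\operatorname{div}S_1(P-W)\cdot\eta=0,\quad \int_{\hat T}S_1(P-W):h_i(\cdot,t)=0,\quad \int_F[(P-W)\boldsymbol t]\cdot\mu\,ds=0,\quad P\boldsymbol t_e|_e=0 .$$ **Lemma.** 1. For every order function $\tilde r$ with $\tilde r(\hat T)=r$ and for all but finitely many $t\in[0,1]$, the first system has exactly one solution $P$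 for every $U\in H^1(\hat T;\mathbb M)$, and $\Pi^{2,-}_{\tilde r,\hat T,t}$ is a linear projection of $H^1(\hat T;\mathbb M)$ onto $\mathcal P^-_{\tilde r+1}\Lambda^2(\hat T;\mathbb V)$. 2. For every order function $\tilde r$ with $\tilde r(\hat T)=r$ and for all but finitely many $t\in[0,1]$, the second system has exactly one solution $P$ for every $W\in H^1(\hat T;\mathbb M)$, and $\Pi^{1,-}_{\tilde r,\hat T,t}$ is a linear projection (an idempotent linear map) of $H^1(\hat T;\mathbb M)$ into $\mathcal P^-_{\tilde r+2}\Lambda^1(\hat T;\mathbb V)$. 3. There is a $t_r\in[0,1]$, depending (for given $\hat T$, $f_i$, $g_i$) only on $r=\tilde r(\hat T)$, such that for every order function $\tilde r$ with $\tilde r(\hat T)=r$ both $\Pi^{2,-}_{\tilde r,\hat T,t_r}$ and $\Pi^{1,-}_{\tilde r,\hat T,t_r}$ are well-defined linear projections as in 1 and 2. -/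

import Mathlib

open MeasureTheory Filter Topology
open scoped ContDiff Matrix ENNReal

noncomputable section

namespace MixedElasticity

/-! ### Polynomials, vector and matrix fields on three-dimensional space

Points are elements of `Fin 3 → ℝ`, whose `volume` is Lebesgue measure. Euclidean lengths are always
written through the dot product. A tetrahedron has nonempty interior, so polynomial functions on it
are the same thing as polynomials. -/

/-- Points and vectors of three-dimensional space. -/
abbrev Pt : Type := Fin 3 → ℝ

/-- Real `3 × 3` matrices. -/
abbrev Mat : Type := Matrix (Fin 3) (Fin 3) ℝ

/-- Scalar polynomials in three variables. -/
abbrev Poly : Type := MvPolynomial (Fin 3) ℝ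

/-- Polynomial vector fields. -/
abbrev VecPoly : Type := Fin 3 → Poly

/-- Polynomial matrix fields. -/
abbrev MatPoly : Type := Matrix (Fin 3) (Fin 3) Poly

/-- The value of a polynomial vector field at a point. -/
def evalVec (w : VecPoly) (x : Pt) : Pt := fun i => MvPolynomial.eval x (w i)

/-- The value of a polynomial matrix field at a point. -/
def evalMat (P : MatPoly) (x : Pt) : Mat := fun i j => MvPolynomial.eval x (P i j)

/-- Polynomials of total degree at most `m`; the zero space when `m` is negative. -/
def polyDeg (m : ℤ) : Submodule ℝ Poly :=
  MvPolynomial.restrictSupport ℝ {d : Fin 3 →₀ ℕ | (d.degree : ℤ) ≤ m}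

/-- Vector fields with components of degree at most `m`. -/
def vecDeg (m : ℤ) : Submodule ℝ VecPoly := Submodule.pi Set.univ fun _ => polyDeg m

/-- Matrix fields with entries of degree at most `m`. -/
def matDeg (m : ℤ) : Submodule ℝ MatPoly := Submodule.pi Set.univ fun _ => vecDeg m

/-- The row-wise gradient of a polynomial vector field. -/
def grad : VecPoly →ₗ[ℝ] MatPoly where
  toFun w := Matrix.of fun i j => MvPolynomial.pderiv j (w i)
  map_add' a b := by
    ext1 i j
    simp
  map_smul' c a := by
    ext1 i j
    simp

/-- The row-wise curl of a polynomial matrix field. -/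
def curl : MatPoly →ₗ[ℝ] MatPoly where
  toFun W := Matrix.of fun i =>
    ![MvPolynomial.pderiv 1 (W i 2) - MvPolynomial.pderiv 2 (W i 1),
      MvPolynomial.pderiv 2 (W i 0) - MvPolynomial.pderiv 0 (W i 2),
      MvPolynomial.pderiv 0 (W i 1) - MvPolynomial.pderiv 1 (W i 0)]
  map_add' A B := by
    ext1 i j
    fin_cases j <;> simp <;> ring
  map_smul' c A := by
    ext1 i j
    fin_cases j <;> simp [smul_sub]

/-- The algebraic operator `W ↦ Wᵀ - tr(W) I`. -/
def S1 (W : Mat) : Mat := W.transpose - W.trace • (1 : Mat)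

/-- The Frobenius product `A : B = tr(A Bᵀ)`. -/
def frob (A B : Mat) : ℝ := (A * B.transpose).trace

/-! ### The tetrahedron and its subsimplices

A tetrahedron is given by its vertices `v : Fin 4 → Pt`, which will be affinely independent. Its
subsimplices correspond to the nonempty subsets of `Fin 4`. Face `i` is opposite to vertex `i`. -/

/-- The closed tetrahedron. -/
def tet (v : Fin 4 → Pt) : Set Pt := convexHull ℝ (Set.range v)

/-- The vertices of face `i`. -/
def faceVertex (v : Fin 4 → Pt) (i : Fin 4) (a : Fin 3) : Pt := v (i.succAbove a)

/-- The closed face opposite to vertex `i`. -/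
def face (v : Fin 4 → Pt) (i : Fin 4) : Set Pt := convexHull ℝ (Set.range (faceVertex v i))

/-- The normal `(b - a) × (c - a)` of the face with vertices `a, b, c`; its Euclidean length is
twice the area of the face. -/
def faceCross (v : Fin 4 → Pt) (i : Fin 4) : Pt :=
  crossProduct (faceVertex v i 1 - faceVertex v i 0) (faceVertex v i 2 - faceVertex v i 0)

/-- A unit normal of face `i`. -/
def unitNormal (v : Fin 4 → Pt) (i : Fin 4) : Pt :=
  (Real.sqrt (faceCross v i ⬝ᵥ faceCross v i))⁻¹ • faceCross v i

/-- The surface measure of face `i`, through the affine parametrization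
`(s, t) ↦ a + s (b - a) + t (c - a)` over the triangle `s, t ≥ 0`, `s + t ≤ 1`. -/
def faceMeasure (v : Fin 4 → Pt) (i : Fin 4) : Measure Pt :=
  ENNReal.ofReal (Real.sqrt (faceCross v i ⬝ᵥ faceCross v i)) •
    Measure.map
      (fun s : ℝ × ℝ => faceVertex v i 0 + s.1 • (faceVertex v i 1 - faceVertex v i 0)
        + s.2 • (faceVertex v i 2 - faceVertex v i 0))
      ((volume : Measure (ℝ × ℝ)).restrict {s | 0 ≤ s.1 ∧ 0 ≤ s.2 ∧ s.1 + s.2 ≤ 1})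

/-- The component `w - (w · n) n` of `w` orthogonal to the unit vector `n`. -/
def tangPart (n w : Pt) : Pt := w - (w ⬝ᵥ n) • n

/-- An order function: a natural number for every subsimplex, not larger on a subsimplex of a
subsimplex. The value at the empty set plays no role. -/
def IsOrder (ρ : Finset (Fin 4) → ℕ) : Prop :=
  ∀ s t : Finset (Fin 4), s.Nonempty → s ⊆ t → ρ s ≤ ρ t

/-- The order of face `i`. -/
def faceOrder (ρ : Finset (Fin 4) → ℕ) (i : Fin 4) : ℕ := ρ (Finset.univ.erase i)

/-- The order of the edge joining vertices `i` and `j`. -/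
def edgeOrder (ρ : Finset (Fin 4) → ℕ) (i j : Fin 4) : ℕ := ρ {i, j}

/-- The order of the tetrahedron itself. -/
def cellOrder (ρ : Finset (Fin 4) → ℕ) : ℕ := ρ Finset.univ

/-! ### Finite element spaces -/

/-- `P_m⁻Λ²`: the fields `q + x s` with `q`, `s` of degree at most `m - 1`. -/
def Pminus2 (m : ℤ) : Set VecPoly :=
  {w | ∃ q ∈ vecDeg (m - 1), ∃ s ∈ polyDeg (m - 1), w = q + fun i => MvPolynomial.X i * s}

/-- `P_m⁻Λ¹`: the fields `q + x × s` with `q`, `s` of degree at most `m - 1`. -/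
def Pminus1 (m : ℤ) : Set VecPoly :=
  {w | ∃ q ∈ vecDeg (m - 1), ∃ s ∈ vecDeg (m - 1),
    w = q + crossProduct (fun i => (MvPolynomial.X i : Poly)) s}

/-- `u` agrees on the set `A` (a face or an edge) with a polynomial of degree at most `m`. -/
def IsPolyOn (A : Set Pt) (m : ℤ) (u : Pt → ℝ) : Prop :=
  ∃ p ∈ polyDeg m, ∀ x ∈ A, u x = MvPolynomial.eval x p

/-- `P_m⁻Λ¹` of face `i`, as a space of tangential fields on the face: `q + s y^⊥` with `q` a
tangential field and `s` a scalar of degree at most `m - 1`, and with `y^⊥ = n × (x - a)` the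
in-plane position vector rotated by a right angle. -/
def IsFacePminus1 (v : Fin 4 → Pt) (i : Fin 4) (m : ℤ) (u : Pt → Pt) : Prop :=
  ∃ q ∈ vecDeg (m - 1), ∃ s ∈ polyDeg (m - 1),
    (∀ x ∈ face v i, evalVec q x ⬝ᵥ unitNormal v i = 0) ∧
    ∀ x ∈ face v i, u x = evalVec q x +
      MvPolynomial.eval x s • crossProduct (unitNormal v i) (x - faceVertex v i 0)

/-- The variable order space `P_ρ⁻Λ²(T)`. -/
def Pminus2Var (v : Fin 4 → Pt) (ρ : Finset (Fin 4) → ℕ) : Set VecPoly :=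
  {w | w ∈ Pminus2 (cellOrder ρ) ∧
    ∀ i, IsPolyOn (face v i) ((faceOrder ρ i : ℤ) - 1) fun x => evalVec w x ⬝ᵥ unitNormal v i}

/-- The variable order space `P_ρ⁻Λ¹(T)`. -/
def Pminus1Var (v : Fin 4 → Pt) (ρ : Finset (Fin 4) → ℕ) : Set VecPoly :=
  {w | w ∈ Pminus1 (cellOrder ρ) ∧
    (∀ i, IsFacePminus1 v i (faceOrder ρ i) fun x => tangPart (unitNormal v i) (evalVec w x)) ∧
    ∀ i j, i ≠ j → IsPolyOn (segment ℝ (v i) (v j)) ((edgeOrder ρ i j : ℤ) - 1)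
      fun x => evalVec w x ⬝ᵥ (v j - v i)}

/-- `P_ρ⁻Λ²(T; V)`: matrix fields with rows in `P_ρ⁻Λ²(T)`. -/
def Pminus2VarMat (v : Fin 4 → Pt) (ρ : Finset (Fin 4) → ℕ) : Set MatPoly :=
  {P | ∀ i, P i ∈ Pminus2Var v ρ}

/-- `P_ρ⁻Λ¹(T; V)`: matrix fields with rows in `P_ρ⁻Λ¹(T)`. -/
def Pminus1VarMat (v : Fin 4 → Pt) (ρ : Finset (Fin 4) → ℕ) : Set MatPoly :=
  {P | ∀ i, P i ∈ Pminus1Var v ρ}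

/-- Matrix fields with rows of degree at most `m` and with vanishing tangential part on every
face. -/
def bubble1 (v : Fin 4 → Pt) (m : ℤ) : Submodule ℝ MatPoly where
  carrier := {W | W ∈ matDeg m ∧
    ∀ k, ∀ i, ∀ x ∈ face v i, tangPart (unitNormal v i) (evalVec (W k) x) = 0}
  zero_mem' := by
    refine ⟨Submodule.zero_mem _, fun k i x _ => ?_⟩
    funext j
    simp [tangPart, evalVec, dotProduct]
  add_mem' := by
    rintro A B ⟨hA, hA'⟩ ⟨hB, hB'⟩
    refine ⟨Submodule.add_mem _ hA hB, fun k i x hx => ?_⟩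
    have h1 := hA' k i x hx
    have h2 := hB' k i x hx
    have h3 : evalVec ((A + B) k) x = evalVec (A k) x + evalVec (B k) x := by
      funext j
      simp [evalVec]
    have h4 : ∀ n a b : Pt, tangPart n (a + b) = tangPart n a + tangPart n b := by
      intro n a b
      simp only [tangPart, add_dotProduct, add_smul]
      abel
    rw [h3, h4, h1, h2, add_zero]
  smul_mem' := by
    rintro c A ⟨hA, hA'⟩
    refine ⟨Submodule.smul_mem _ c hA, fun k i x hx => ?_⟩
    have h1 := hA' k i x hx
    have h3 : evalVec ((c • A) k) x = c • evalVec (A k) x := by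
      funext j
      simp [evalVec, MvPolynomial.smul_eval]
    have h4 : ∀ n a : Pt, tangPart n (c • a) = c • tangPart n a := by
      intro n a
      simp only [tangPart, smul_dotProduct, smul_sub, smul_smul, smul_eq_mul]
    rw [h3, h4, h1, smul_zero]

/-- The row-wise curls of the fields of degree at most `r + 1` with vanishing tangential traces. -/
def curlBubble (v : Fin 4 → Pt) (r : ℕ) : Submodule ℝ MatPoly :=
  (bubble1 v ((r : ℤ) + 1)).map curl

/-- The row-wise gradients of the vector fields of degree at most `r`. -/
def gradSpace (r : ℕ) : Submodule ℝ MatPoly := (vecDeg (r : ℤ)).map grad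

/-! ### The Sobolev space `H¹`, weak divergence and traces -/

/-- `g` is the weak derivative of `u` in direction `x_j` in the interior of the tetrahedron, and is
square-integrable. -/
def IsWeakPartial (v : Fin 4 → Pt) (j : Fin 3) (u g : Pt → ℝ) : Prop :=
  MemLp g 2 (volume.restrict (tet v)) ∧
  ∀ φ : Pt → ℝ, ContDiff ℝ ∞ φ → HasCompactSupport φ → tsupport φ ⊆ interior (tet v) →
    ∫ x in tet v, u x * fderiv ℝ φ x (Pi.single j 1) = - ∫ x in tet v, g x * φ x

/-- `u` belongs to `H¹(T)`. -/
def MemH1 (v : Fin 4 → Pt) (u : Pt → ℝ) : Prop :=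
  MemLp u 2 (volume.restrict (tet v)) ∧ ∀ j, ∃ g, IsWeakPartial v j u g

/-- `γ` is the trace of `u ∈ H¹(T)` on face `i`: the limit in `L²` of the face of the restrictions
of smooth functions that converge to `u` in `H¹(T)`. -/
def IsFaceTrace (v : Fin 4 → Pt) (i : Fin 4) (u γ : Pt → ℝ) : Prop :=
  MemLp γ 2 (faceMeasure v i) ∧
  ∃ (φ : ℕ → Pt → ℝ) (g : Fin 3 → Pt → ℝ),
    (∀ n, ContDiff ℝ ∞ (φ n)) ∧ (∀ j, IsWeakPartial v j u (g j)) ∧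
    Tendsto (fun n => eLpNorm (fun x => φ n x - u x) 2 (volume.restrict (tet v))) atTop (𝓝 0) ∧
    (∀ j, Tendsto (fun n => eLpNorm (fun x => fderiv ℝ (φ n) x (Pi.single j 1) - g j x) 2
      (volume.restrict (tet v))) atTop (𝓝 0)) ∧
    Tendsto (fun n => eLpNorm (fun x => φ n x - γ x) 2 (faceMeasure v i)) atTop (𝓝 0)

/-- `D` is the row-wise weak divergence of the matrix field `U`, and is square-integrable. -/
def IsWeakDiv (v : Fin 4 → Pt) (U : Pt → Mat) (D : Pt → Pt) : Prop :=
  ∀ i, MemLp (fun x => D x i) 2 (volume.restrict (tet v)) ∧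
    ∀ φ : Pt → ℝ, ContDiff ℝ ∞ φ → HasCompactSupport φ → tsupport φ ⊆ interior (tet v) →
      ∫ x in tet v, ∑ j, U x i j * fderiv ℝ φ x (Pi.single j 1) = - ∫ x in tet v, D x i * φ x

/-- `H¹(T; M)`: the matrix fields with entries in `H¹(T)`. -/
def H1Mat (v : Fin 4 → Pt) : Submodule ℝ (Pt → Mat) where
  carrier := {U | ∀ i j, MemH1 v fun x => U x i j}
  zero_mem' := by
    intro i j
    refine ⟨MemLp.zero, fun k => ⟨fun _ => 0, MemLp.zero, fun φ _ _ _ => ?_⟩⟩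
    simp
  add_mem' := by
    intro A B hA hB i j
    have key : ∀ (u ψ : Pt → ℝ), MemLp u 2 (volume.restrict (tet v)) → Continuous ψ →
        HasCompactSupport ψ → Integrable (fun x => u x * ψ x) (volume.restrict (tet v)) :=
      fun u ψ hu h1 h2 =>
        hu.integrable_mul (q := 2) (h1.memLp_of_hasCompactSupport h2)
    refine ⟨(hA i j).1.add (hB i j).1, fun k => ?_⟩
    obtain ⟨a, ha, ha'⟩ := (hA i j).2 k
    obtain ⟨b, hb, hb'⟩ := (hB i j).2 k
    refine ⟨fun x => a x + b x, ha.add hb, fun φ h1 h2 h3 => ?_⟩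
    have c1 : Continuous fun x => fderiv ℝ φ x (Pi.single k 1) :=
      (h1.continuous_fderiv (by simp)).clm_apply continuous_const
    have c2 : HasCompactSupport fun x => fderiv ℝ φ x (Pi.single k 1) := h2.fderiv_apply ℝ _
    simp only [Pi.add_apply, Matrix.add_apply, add_mul]
    rw [integral_add (key _ _ (hA i j).1 c1 c2) (key _ _ (hB i j).1 c1 c2),
      integral_add (key _ _ ha h1.continuous h2) (key _ _ hb h1.continuous h2),
      ha' φ h1 h2 h3, hb' φ h1 h2 h3, neg_add]
  smul_mem' := by
    intro c A hA i j
    refine ⟨(hA i j).1.const_mul c, fun k => ?_⟩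
    obtain ⟨g, hg, hg'⟩ := (hA i j).2 k
    refine ⟨fun x => c * g x, hg.const_mul c, fun φ h1 h2 h3 => ?_⟩
    have := hg' φ h1 h2 h3
    simp only [Pi.smul_apply, Matrix.smul_apply, smul_eq_mul, mul_assoc,
      integral_const_mul, this, mul_neg]

/-! ### The two operators -/

/-- The test fields `η`: components of degree at most `r` and of mean value zero. -/
def meanZero (v : Fin 4 → Pt) (r : ℕ) : Set VecPoly :=
  {η | η ∈ vecDeg (r : ℤ) ∧ ∀ i, ∫ x in tet v, MvPolynomial.eval x (η i) = 0}

/-- The interpolated test fields `h_i(·, t) = (1 - t) f_i + t g_i`. -/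
def interp {k : ℕ} (f g : Fin k → MatPoly) (t : ℝ) (i : Fin k) : MatPoly :=
  (1 - t) • f i + t • g i

/-- `P` satisfies the conditions that define the value at `U` of the operator into
`P_{ρ+1}⁻Λ²(T; V)` with test fields `h`. -/
def IsPi2 (v : Fin 4 → Pt) (ρ : Finset (Fin 4) → ℕ) {k : ℕ} (h : Fin k → MatPoly)
    (U : Pt → Mat) (P : MatPoly) : Prop :=
  P ∈ Pminus2VarMat v (fun s => ρ s + 1) ∧
  (∃ D, IsWeakDiv v (fun x => evalMat P x - U x) D ∧
    ∀ η ∈ meanZero v (cellOrder ρ), ∫ x in tet v, D x ⬝ᵥ evalVec η x = 0) ∧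
  (∀ l, ∫ x in tet v, frob (evalMat P x - U x) (evalMat (h l) x) = 0) ∧
  ∀ i, ∃ γ : Pt → Mat,
    (∀ a b, IsFaceTrace v i (fun x => (evalMat P x - U x) a b) fun x => γ x a b) ∧
    ∀ μ ∈ vecDeg (faceOrder ρ i : ℤ),
      ∫ x, (γ x *ᵥ unitNormal v i) ⬝ᵥ evalVec μ x ∂faceMeasure v i = 0

/-- `P` satisfies the conditions that define the value at `W` of the operator into
`P_{ρ+2}⁻Λ¹(T; V)` with test fields `h`. -/
def IsPi1 (v : Fin 4 → Pt) (ρ : Finset (Fin 4) → ℕ) {k : ℕ} (h : Fin k → MatPoly)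
    (W : Pt → Mat) (P : MatPoly) : Prop :=
  P ∈ Pminus1VarMat v (fun s => ρ s + 2) ∧
  (∃ D, IsWeakDiv v (fun x => S1 (evalMat P x - W x)) D ∧
    ∀ η ∈ meanZero v (cellOrder ρ), ∫ x in tet v, D x ⬝ᵥ evalVec η x = 0) ∧
  (∀ l, ∫ x in tet v, frob (S1 (evalMat P x - W x)) (evalMat (h l) x) = 0) ∧
  (∀ i, ∃ γ : Pt → Mat,
    (∀ a b, IsFaceTrace v i (fun x => (evalMat P x - W x) a b) fun x => γ x a b) ∧
    ∀ τ : Pt, τ ⬝ᵥ unitNormal v i = 0 → ∀ μ ∈ vecDeg (faceOrder ρ i : ℤ),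
      ∫ x, (γ x *ᵥ τ) ⬝ᵥ evalVec μ x ∂faceMeasure v i = 0) ∧
  ∀ i j, i ≠ j → ∀ x ∈ segment ℝ (v i) (v j), evalMat P x *ᵥ (v j - v i) = 0

/-- The conditions `R U P` determine `P` uniquely for every `U ∈ H¹(T; M)`, and the resulting
operator is `proj`, linear on `H¹(T; M)` and idempotent. -/
def IsProjectionFor (v : Fin 4 → Pt) (R : (Pt → Mat) → MatPoly → Prop)
    (proj : H1Mat v →ₗ[ℝ] MatPoly) : Prop :=
  (∀ (U : H1Mat v) (P : MatPoly), R U P ↔ P = proj U) ∧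
  ∀ U : H1Mat v, ∃ hU : evalMat (proj U) ∈ H1Mat v, proj ⟨evalMat (proj U), hU⟩ = proj U

/-- The operator into `P_{ρ+1}⁻Λ²(T; V)` is a well-defined linear projection onto this space. -/
def Pi2WellDefined (v : Fin 4 → Pt) (ρ : Finset (Fin 4) → ℕ) {k : ℕ} (h : Fin k → MatPoly) :
    Prop :=
  ∃ proj : H1Mat v →ₗ[ℝ] MatPoly, IsProjectionFor v (IsPi2 v ρ h) proj ∧
    Set.range proj = Pminus2VarMat v fun s => ρ s + 1

/-- The operator into `P_{ρ+2}⁻Λ¹(T; V)` is a well-defined linear projection. -/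
def Pi1WellDefined (v : Fin 4 → Pt) (ρ : Finset (Fin 4) → ℕ) {k : ℕ} (h : Fin k → MatPoly) :
    Prop :=
  ∃ proj : H1Mat v →ₗ[ℝ] MatPoly, IsProjectionFor v (IsPi1 v ρ h) proj

end MixedElasticity

end

/-! ### Degrees, zeros and derivatives of polynomials -/

noncomputable section

namespace MixedElasticity

open MvPolynomial (C X eval pderiv)

/-! ### Polynomials of bounded degree -/

/-! The conditions on the faces and those in the interior decouple. An explicit field of the
variable order space matches the face moments; what is left is a bubble, a field whose normal traces
(for the operator with values in `Λ²`) or tangential traces (for `Λ¹`) vanish on all faces, and the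
interior conditions have to fix it. The bubbles of `P⁻_{r+1}Λ²` are exactly the fields `rtBubble q`,
those of `P⁻_{r+2}Λ¹` exactly the fields `ndBubble q`, with `q` an arbitrary vector field of degree
at most `r - 1` (`exists_rtBubble`, `exists_ndBubble`). The interior problem therefore depends on
the order function only through `r`.

On a field without normal trace, integration by parts turns the moments of the divergence against
`η` into moments of the field against `grad η`. At `t = 1` the homogeneous interior conditions hence
say that `J q` is orthogonal to the span of the `g i` plus all gradients, which is the whole of
`P_{r-1}(M)`. An explicit test field of degree at most `r - 1`, linear in `q`, has a pointwise
nonnegative product with the bubble, and this product vanishes on the tetrahedron only for `q = 0`;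
so `q = 0`. For `Λ¹` the relevant field is `S1` of the bubble: `S1` is symmetric and invertible, and
it maps fields without tangential trace to fields without normal trace. A dimension count makes the
injective moment map bijective (`bubbleMoments_bijective`). The map is affine in `t`, so its
singular parameters come from the eigenvalues of one endomorphism and are finite in number
(`finite_not_bijective`), and `t = 1` serves for all order functions with the same `r`.

On a face of order `m`, the normal component in the `Λ²` space is a polynomial of degree at most `m`
and is controlled by its own moments. In the `Λ¹` space a tangential trace without edge components
is that of a face bubble with two coefficients `p`, `q` of degree at most `m` (`exists_faceBubble`);
testing its edge components with `p` and `q` gives a symmetric positive semidefinite form that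
vanishes only if the trace does (`faceBubble_form`).

The analytic input is that traces of `H¹` functions exist and are unique. It follows from the
density of smooth functions up to the boundary, obtained by mollification combined with a
contraction towards an interior point (`exists_smooth_approx`), and from a trace inequality
(`exists_lintegral_face_le`). -/

theorem mem_polyDeg {m : ℤ} {p : Poly} :
    p ∈ polyDeg m ↔ ∀ d ∈ p.support, (d.degree : ℤ) ≤ m :=
  MvPolynomial.mem_restrictSupport_iff _

theorem mem_polyDeg_iff {m : ℤ} {p : Poly} :
    p ∈ polyDeg m ↔ p = 0 ∨ (p.totalDegree : ℤ) ≤ m := by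
  rw [mem_polyDeg]
  constructor
  · intro h
    by_cases hp : p = 0
    · exact Or.inl hp
    · right
      obtain ⟨d, hd, hd'⟩ := Finset.exists_mem_eq_sup p.support
        (MvPolynomial.support_nonempty.2 hp) (fun s => s.sum fun _ e => e)
      have := h d hd
      rw [MvPolynomial.totalDegree, hd']
      exact this
  · rintro (rfl | h) d hd
    · simp at hd
    · have h2 : d.degree ≤ p.totalDegree := MvPolynomial.le_totalDegree hd
      omega

theorem polyDeg_mono {m n : ℤ} (h : m ≤ n) : polyDeg m ≤ polyDeg n := by
  intro p hp
  rw [mem_polyDeg] at *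
  exact fun d hd => (hp d hd).trans h

theorem mul_mem_polyDeg {a b c : ℤ} {p q : Poly} (hp : p ∈ polyDeg a) (hq : q ∈ polyDeg b)
    (h : a + b ≤ c) : p * q ∈ polyDeg c := by
  rw [mem_polyDeg_iff] at *
  rcases hp with rfl | hp
  · simp
  rcases hq with rfl | hq
  · simp
  right
  have := MvPolynomial.totalDegree_mul p q
  omega

theorem C_mem_polyDeg {m : ℤ} (hm : 0 ≤ m) (c : ℝ) : (C c : Poly) ∈ polyDeg m := by
  rw [mem_polyDeg_iff]
  right
  simpa using hm

theorem C_mul_mem_polyDeg {m : ℤ} {p : Poly} (c : ℝ) (hp : p ∈ polyDeg m) :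
    C c * p ∈ polyDeg m :=
  mul_mem_polyDeg (C_mem_polyDeg le_rfl c) hp (by simp)

theorem X_mem_polyDeg (i : Fin 3) : (X i : Poly) ∈ polyDeg 1 := by
  rw [mem_polyDeg_iff]
  right
  simp

theorem pow_mem_polyDeg {a : ℤ} {p : Poly} (hp : p ∈ polyDeg a) (n : ℕ) :
    p ^ n ∈ polyDeg (n * a) := by
  induction n with
  | zero => simpa using C_mem_polyDeg le_rfl 1
  | succ n ih =>
    rw [pow_succ]
    exact mul_mem_polyDeg ih hp (by push_cast; linarith)

/-- The total degree is additive because polynomials over a field form a domain. All degree bounds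
for quotients by barycentric coordinates come from here. -/
theorem mem_polyDeg_of_mul {L A : Poly} {m n : ℤ} (hL : L ≠ 0) (hn : n ≤ L.totalDegree)
    (h : L * A ∈ polyDeg m) : A ∈ polyDeg (m - n) := by
  rw [mem_polyDeg_iff] at *
  by_cases hA : A = 0
  · exact Or.inl hA
  rcases h with h | h
  · exact Or.inl ((mul_eq_zero.1 h).resolve_left hL)
  · right
    rw [MvPolynomial.totalDegree_mul_of_isDomain hL hA] at h
    push_cast at h
    omega

theorem aeval_mem_polyDeg {m : ℤ} {p : Poly} {g : Fin 3 → Poly} (hg : ∀ i, g i ∈ polyDeg 1)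
    (hp : p ∈ polyDeg m) : MvPolynomial.aeval g p ∈ polyDeg m := by
  rw [mem_polyDeg] at hp
  rw [p.as_sum, map_sum]
  refine Submodule.sum_mem _ fun d hd => ?_
  rw [MvPolynomial.aeval_monomial, Finsupp.prod_fintype _ _ (by simp)]
  refine C_mul_mem_polyDeg _ ?_
  have h1 := hp d hd
  rw [Finsupp.degree_eq_sum, Fin.sum_univ_three] at h1
  rw [Fin.prod_univ_three]
  push_cast at h1
  refine mul_mem_polyDeg (mul_mem_polyDeg (pow_mem_polyDeg (hg 0) _) (pow_mem_polyDeg (hg 1) _)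
    le_rfl) (pow_mem_polyDeg (hg 2) _) ?_
  linarith

instance (m : ℤ) : FiniteDimensional ℝ (polyDeg m) := by
  have h : polyDeg m ≤ MvPolynomial.restrictTotalDegree (Fin 3) ℝ m.toNat := by
    intro p hp
    rw [MvPolynomial.mem_restrictTotalDegree]
    rcases mem_polyDeg_iff.1 hp with rfl | h
    · simp
    · omega
  exact Submodule.finiteDimensional_of_le h

theorem mem_vecDeg {m : ℤ} {w : VecPoly} : w ∈ vecDeg m ↔ ∀ i, w i ∈ polyDeg m := by
  simp [vecDeg, Submodule.mem_pi]

theorem mem_matDeg {m : ℤ} {P : MatPoly} : P ∈ matDeg m ↔ ∀ i j, P i j ∈ polyDeg m :=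
  ⟨fun h i => mem_vecDeg.1 (h i trivial), fun h i _ => mem_vecDeg.2 (h i)⟩

instance (m : ℤ) : FiniteDimensional ℝ (vecDeg m) := by
  let F : vecDeg m →ₗ[ℝ] (Fin 3 → polyDeg m) :=
    { toFun := fun w i => ⟨w.1 i, mem_vecDeg.1 w.2 i⟩
      map_add' := fun a b => rfl
      map_smul' := fun c a => rfl }
  refine FiniteDimensional.of_injective F fun a b h => ?_
  ext1
  funext i
  exact congrArg Subtype.val (congrFun h i)

instance (m : ℤ) : FiniteDimensional ℝ (matDeg m) := by
  let F : matDeg m →ₗ[ℝ] (Fin 3 → vecDeg m) :=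
    { toFun := fun w i => ⟨w.1 i, mem_vecDeg.2 fun j => mem_matDeg.1 w.2 i j⟩
      map_add' := fun a b => rfl
      map_smul' := fun c a => rfl }
  refine FiniteDimensional.of_injective F fun a b h => ?_
  ext1
  funext i
  exact congrArg Subtype.val (congrFun h i)

/-! ### Vanishing of polynomials -/

/-- A polynomial that vanishes on a short segment starting at `c` towards `x` vanishes at `x`. -/
theorem eval_eq_zero_of_segment (p : Poly) (c x : Pt) {δ : ℝ} (hδ : 0 < δ)
    (h : ∀ τ ∈ Set.Ioo 0 δ, eval (c + τ • (x - c)) p = 0) : eval x p = 0 := by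
  -- The restriction of `p` to the line through `c` and `x` is a polynomial in one variable with
  -- infinitely many zeros; its value at `1` is the value of `p` at `x`.
  let φ : Polynomial ℝ := MvPolynomial.aeval
    (fun i => Polynomial.C (c i) + Polynomial.C (x i - c i) * Polynomial.X) p
  have key : ∀ τ : ℝ, φ.eval τ = eval (c + τ • (x - c)) p := by
    intro τ
    have h1 : ((Polynomial.aeval τ).comp (MvPolynomial.aeval (R := ℝ) (fun i =>
        (Polynomial.C (c i) + Polynomial.C (x i - c i) * Polynomial.X : Polynomial ℝ))))
        = MvPolynomial.aeval (c + τ • (x - c)) := by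
      ext i
      simp [mul_comm]
    have h2 := congrArg (fun f : Poly →ₐ[ℝ] ℝ => f p) h1
    simp only [AlgHom.comp_apply] at h2
    rw [Polynomial.coe_aeval_eq_eval] at h2
    rw [h2, MvPolynomial.aeval_eq_eval]
  have hz : φ = 0 := by
    refine Polynomial.eq_zero_of_infinite_isRoot _ ((Set.Ioo_infinite hδ).mono fun τ hτ => ?_)
    exact (key τ).trans (h τ hτ)
  have h1 := key 1
  rw [hz] at h1
  simpa using h1.symm

theorem continuous_eval (p : Poly) : Continuous fun x : Pt => eval x p :=
  MvPolynomial.continuous_eval p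

theorem hasFDerivAt_eval (p : Poly) (x : Pt) :
    HasFDerivAt (fun x : Pt => eval x p)
      (∑ i, eval x (pderiv i p) • (ContinuousLinearMap.proj (R := ℝ) (φ := fun _ : Fin 3 => ℝ) i))
      x := by
  induction p using MvPolynomial.induction_on with
  | C a => simpa using hasFDerivAt_const a x
  | add p q hp hq =>
    simp only [map_add, add_smul, Finset.sum_add_distrib]
    exact hp.add hq
  | mul_X p j hp =>
    have hX : HasFDerivAt (fun x : Pt => x j)
        (ContinuousLinearMap.proj (R := ℝ) (φ := fun _ : Fin 3 => ℝ) j) x :=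
      hasFDerivAt_apply j x
    have h := hp.mul hX
    simp only [map_mul, MvPolynomial.eval_X]
    refine h.congr_fderiv ?_
    ext1 y
    simp [add_mul, Finset.sum_add_distrib, Finset.mul_sum, MvPolynomial.pderiv_X,
      Pi.single_apply, mul_assoc, apply_ite (eval x)]

theorem contDiff_eval (p : Poly) : ContDiff ℝ ∞ fun x : Pt => eval x p := by
  induction p using MvPolynomial.induction_on with
  | C a => simpa using contDiff_const
  | add p q hp hq => simpa using hp.add hq
  | mul_X p j hp => simpa using hp.mul (contDiff_apply ℝ ℝ j)

theorem fderiv_eval (p : Poly) (x : Pt) (j : Fin 3) :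
    fderiv ℝ (fun x : Pt => eval x p) x (Pi.single j 1) = eval x (pderiv j p) := by
  rw [(hasFDerivAt_eval p x).fderiv]
  simp [Pi.single_apply]

end MixedElasticity

end

/-! ### Geometry of the tetrahedron in barycentric coordinates -/

noncomputable section

namespace MixedElasticity

open MvPolynomial (C X eval pderiv)

/-! ### Barycentric coordinates -/

/-- The vertices of the tetrahedron as an affine basis. -/
def simplexBasis {v : Fin 4 → Pt} (hv : AffineIndependent ℝ v) : AffineBasis (Fin 4) ℝ Pt :=
  ⟨v, hv, by rw [hv.affineSpan_eq_top_iff_card_eq_finrank_add_one]; simp⟩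

/-- The gradient of the `i`-th barycentric coordinate. -/
def dlam {v : Fin 4 → Pt} (hv : AffineIndependent ℝ v) (i : Fin 4) : Pt :=
  fun a => ((simplexBasis hv).coord i).linear (Pi.single a 1)

/-- The `i`-th barycentric coordinate as a polynomial. -/
def lam {v : Fin 4 → Pt} (hv : AffineIndependent ℝ v) (i : Fin 4) : Poly :=
  C ((simplexBasis hv).coord i 0) + ∑ a, C (dlam hv i a) * X a

variable {v : Fin 4 → Pt} (hv : AffineIndependent ℝ v)

theorem linear_coord_apply (i : Fin 4) (x : Pt) :
    ((simplexBasis hv).coord i).linear x = dlam hv i ⬝ᵥ x := by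
  conv_lhs => rw [pi_eq_sum_univ' x]
  simp [dlam, dotProduct, mul_comm]

theorem eval_lam (i : Fin 4) (x : Pt) : eval x (lam hv i) = (simplexBasis hv).coord i x := by
  have h := ((simplexBasis hv).coord i).map_vadd 0 x
  simp only [vadd_eq_add, add_zero] at h
  rw [h, linear_coord_apply]
  simp [lam, dotProduct, add_comm]

theorem eval_lam_vertex (i j : Fin 4) : eval (v j) (lam hv i) = if i = j then 1 else 0 := by
  rw [eval_lam]
  exact (simplexBasis hv).coord_apply i j

theorem sum_eval_lam (x : Pt) : ∑ i, eval x (lam hv i) = 1 := by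
  simp only [eval_lam]
  exact (simplexBasis hv).sum_coord_apply_eq_one x

theorem sum_lam : ∑ i, lam hv i = 1 := by
  refine MvPolynomial.funext fun x => ?_
  simpa using sum_eval_lam hv x

theorem sum_eval_lam_smul (x : Pt) : ∑ i, eval x (lam hv i) • v i = x := by
  simp only [eval_lam]
  exact (simplexBasis hv).linear_combination_coord_eq_self x

theorem pderiv_lam (i : Fin 4) (a : Fin 3) : pderiv a (lam hv i) = C (dlam hv i a) := by
  simp [lam, MvPolynomial.pderiv_X, Derivation.leibniz, Pi.single_apply]

theorem eval_lam_add (i : Fin 4) (x y : Pt) :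
    eval (x + y) (lam hv i) = eval x (lam hv i) + dlam hv i ⬝ᵥ y := by
  simp [lam, dotProduct, mul_add, Finset.sum_add_distrib, add_assoc]

theorem eval_lam_sub (i : Fin 4) (x y : Pt) :
    eval x (lam hv i) - eval y (lam hv i) = dlam hv i ⬝ᵥ (x - y) := by
  have := eval_lam_add hv i y (x - y)
  rw [add_sub_cancel] at this
  rw [this]; ring

theorem eval_lam_line (i : Fin 4) (c x : Pt) (τ : ℝ) : eval (c + τ • (x - c)) (lam hv i) =
    (1 - τ) * eval c (lam hv i) + τ * eval x (lam hv i) := by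
  rw [eval_lam_add, dotProduct_smul, ← eval_lam_sub, smul_eq_mul]
  ring

theorem dlam_dot_edge (i j k : Fin 4) :
    dlam hv i ⬝ᵥ (v j - v k) = (if i = j then 1 else 0) - (if i = k then 1 else 0) := by
  rw [← eval_lam_sub, eval_lam_vertex, eval_lam_vertex]

theorem sum_dlam_dot (w : Pt) : ∑ i, dlam hv i ⬝ᵥ w = 0 := by
  have h := sum_eval_lam hv w
  have h0 := sum_eval_lam hv 0
  have : ∀ i, eval w (lam hv i) = eval 0 (lam hv i) + dlam hv i ⬝ᵥ w := fun i => by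
    simpa using eval_lam_add hv i 0 w
  simp only [this, Finset.sum_add_distrib, h0] at h
  linarith

theorem sum_dlam : ∑ i, dlam hv i = 0 := by
  funext a
  have := sum_dlam_dot hv (Pi.single a 1)
  simpa using this

theorem sum_dlam_dot_smul (w : Pt) : ∑ i, (dlam hv i ⬝ᵥ w) • v i = w := by
  have h := sum_eval_lam_smul hv w
  have h0 := sum_eval_lam_smul hv 0
  have : ∀ i, eval w (lam hv i) = eval 0 (lam hv i) + dlam hv i ⬝ᵥ w := fun i => by
    simpa using eval_lam_add hv i 0 w
  simpa only [this, add_smul, Finset.sum_add_distrib, h0, zero_add] using h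

/-- The transpose of `sum_dlam_dot_smul`: in both cases the sum of the products `v i ⊗ ∇λ_i` is the
identity. -/
theorem sum_dot_smul_dlam (w : Pt) : ∑ i, (w ⬝ᵥ v i) • dlam hv i = w := by
  funext a
  have h := congrArg (fun u => w ⬝ᵥ u) (sum_dlam_dot_smul hv (Pi.single a 1))
  simp only [dotProduct_single_one, dotProduct_sum, dotProduct_smul, smul_eq_mul] at h
  simp only [Finset.sum_apply, Pi.smul_apply, smul_eq_mul]
  rw [← h]
  exact Finset.sum_congr rfl fun i _ => mul_comm _ _

theorem lam_mem_polyDeg (i : Fin 4) : lam hv i ∈ polyDeg 1 :=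
  Submodule.add_mem _ (C_mem_polyDeg zero_le_one _)
    (Submodule.sum_mem _ fun a _ => C_mul_mem_polyDeg _ (X_mem_polyDeg a))

theorem lam_ne_zero (i : Fin 4) : lam hv i ≠ 0 := by
  intro h
  have := eval_lam_vertex hv i i
  simp [h] at this

theorem one_le_totalDegree_lam (i : Fin 4) : 1 ≤ (lam hv i).totalDegree := by
  by_contra! h
  have h0 : (lam hv i).totalDegree = 0 := by omega
  rw [MvPolynomial.totalDegree_eq_zero_iff_eq_C] at h0
  have h1 := eval_lam_vertex hv i i
  have h2 := eval_lam_vertex hv i (i + 1)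
  have h3 : i ≠ i + 1 := by
    have : ∀ i : Fin 4, i ≠ i + 1 := by decide
    exact this i
  rw [h0] at h1 h2
  simp [h3] at h1 h2
  rw [h1] at h2
  norm_num at h2

theorem mem_polyDeg_of_lam_mul {i : Fin 4} {A : Poly} {m n : ℤ} (h : lam hv i * A ∈ polyDeg m)
    (hn : m - 1 ≤ n) : A ∈ polyDeg n :=
  polyDeg_mono hn (mem_polyDeg_of_mul (lam_ne_zero hv i)
    (by exact_mod_cast one_le_totalDegree_lam hv i) h)

theorem mem_tet {x : Pt} : x ∈ tet v ↔ ∀ i, 0 ≤ eval x (lam hv i) := by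
  have h := (simplexBasis hv).convexHull_eq_nonneg_coord
  have h2 : tet v = {x | ∀ i, 0 ≤ (simplexBasis hv).coord i x} := h
  rw [h2]
  simp only [eval_lam]
  rfl

theorem mem_interior_tet {x : Pt} : x ∈ interior (tet v) ↔ ∀ i, 0 < eval x (lam hv i) := by
  have h := (simplexBasis hv).interior_convexHull
  have h2 : interior (tet v) = {x | ∀ i, 0 < (simplexBasis hv).coord i x} := h
  rw [h2]
  simp only [eval_lam]
  rfl

theorem mem_face {i : Fin 4} {x : Pt} : x ∈ face v i ↔ x ∈ tet v ∧ eval x (lam hv i) = 0 := by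
  constructor
  · intro hx
    refine ⟨convexHull_mono (Set.range_comp_subset_range i.succAbove v) hx, ?_⟩
    have hconv : Convex ℝ {x : Pt | eval x (lam hv i) = 0} := by
      simp only [eval_lam]
      exact (convex_singleton (0 : ℝ)).affine_preimage ((simplexBasis hv).coord i)
    refine convexHull_min ?_ hconv hx
    rintro _ ⟨a, rfl⟩
    simp [faceVertex, eval_lam_vertex, (Fin.succAbove_ne i a).symm]
  · rintro ⟨hx, h0⟩
    have h1 := sum_eval_lam_smul hv x
    have h2 := sum_eval_lam hv x
    rw [Fin.sum_univ_succAbove _ i, h0] at h1 h2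
    rw [zero_smul, zero_add] at h1
    rw [zero_add] at h2
    rw [← h1]
    exact (convex_convexHull ℝ _).sum_mem (fun a _ => (mem_tet hv).1 hx _) h2
      fun a _ => subset_convexHull ℝ _ ⟨a, rfl⟩

theorem face_subset_tet (i : Fin 4) : face v i ⊆ tet v :=
  convexHull_mono (Set.range_comp_subset_range i.succAbove v)

theorem mem_segment_vertex {i j : Fin 4} (hij : i ≠ j) {x : Pt} :
    x ∈ segment ℝ (v i) (v j) ↔ x ∈ tet v ∧ ∀ k, k ≠ i → k ≠ j → eval x (lam hv k) = 0 := by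
  constructor
  · intro hx
    refine ⟨(convex_convexHull ℝ _).segment_subset
      (subset_convexHull ℝ _ (Set.mem_range_self i))
      (subset_convexHull ℝ _ (Set.mem_range_self j)) hx, fun k hki hkj => ?_⟩
    rw [segment_eq_image'] at hx
    obtain ⟨τ, _, rfl⟩ := hx
    rw [eval_lam_line, eval_lam_vertex, eval_lam_vertex]
    simp [hki, hkj]
  · rintro ⟨hx, h0⟩
    have h1 := sum_eval_lam_smul hv x
    have h2 := sum_eval_lam hv x
    refine ⟨eval x (lam hv i), eval x (lam hv j), (mem_tet hv).1 hx _, (mem_tet hv).1 hx _, ?_, ?_⟩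
    · rw [← h2, Finset.sum_eq_add i j hij (fun k _ hk => h0 k hk.1 hk.2) (by simp) (by simp)]
    · have h3 := Finset.sum_eq_add (s := Finset.univ) (f := fun k => eval x (lam hv k) • v k) i j
        hij (fun k _ hk => by rw [h0 k hk.1 hk.2, zero_smul]) (by simp) (by simp)
      rw [← h3, h1]

theorem isCompact_tet : IsCompact (tet v) := (Set.finite_range v).isCompact_convexHull ℝ

theorem convex_tet : Convex ℝ (tet v) := convex_convexHull ℝ _

theorem isCompact_face (i : Fin 4) : IsCompact (face v i) :=
  (Set.finite_range (faceVertex v i)).isCompact_convexHull ℝ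

/-! ### Normals and tangents of the faces -/

/-- In the expansion `N = ∑ (N · v_j) ∇λ_j` the same constant may be subtracted from all
coefficients, because the gradients add up to zero. Subtracting `κ` leaves only the term of vertex
`i`. -/
theorem eq_smul_dlam {i : Fin 4} {N : Pt} {κ : ℝ}
    (h : ∀ a, N ⬝ᵥ faceVertex v i a = κ) : N = (N ⬝ᵥ v i - κ) • dlam hv i := by
  have h1 := sum_dot_smul_dlam hv N
  have h2 := sum_dlam hv
  rw [Fin.sum_univ_succAbove _ i] at h1 h2
  have h3 : ∑ a, (N ⬝ᵥ v (i.succAbove a)) • dlam hv (i.succAbove a)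
      = κ • ∑ a, dlam hv (i.succAbove a) := by
    rw [Finset.smul_sum]
    exact Finset.sum_congr rfl fun a _ => by rw [← h a]; rfl
  rw [h3, eq_neg_of_add_eq_zero_right h2] at h1
  conv_lhs => rw [← h1]
  rw [sub_smul, smul_neg, sub_eq_add_neg]

theorem dlam_succAbove_dot_faceEdge (i : Fin 4) (a b c : Fin 3) :
    dlam hv (i.succAbove a) ⬝ᵥ (faceVertex v i b - faceVertex v i c)
      = (if a = b then 1 else 0) - (if a = c then 1 else 0) := by
  rw [faceVertex, faceVertex, dlam_dot_edge]
  simp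

theorem dlam_ne_zero (i : Fin 4) : dlam hv i ≠ 0 := by
  intro h
  have := dlam_dot_edge hv i i (i.succAbove 0)
  simp [h, (Fin.succAbove_ne i _).symm] at this

/-- A vector orthogonal to the two edge directions of a face is a multiple of the gradient. -/
theorem eq_smul_dlam_of_dot {i : Fin 4} {N : Pt}
    (h1 : N ⬝ᵥ (faceVertex v i 1 - faceVertex v i 0) = 0)
    (h2 : N ⬝ᵥ (faceVertex v i 2 - faceVertex v i 0) = 0) : ∃ c : ℝ, N = c • dlam hv i := by
  refine ⟨_, eq_smul_dlam hv (κ := N ⬝ᵥ faceVertex v i 0) fun a => ?_⟩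
  rw [dotProduct_sub] at h1 h2
  fin_cases a
  · rfl
  · simpa using sub_eq_zero.1 h1
  · simpa using sub_eq_zero.1 h2

include hv in
theorem faceCross_ne_zero (i : Fin 4) : faceCross v i ≠ 0 := by
  rw [faceCross, crossProduct_ne_zero_iff_linearIndependent, LinearIndependent.pair_iff]
  intro s t h
  have h1 := congrArg (fun u => dlam hv (i.succAbove 1) ⬝ᵥ u) h
  have h2 := congrArg (fun u => dlam hv (i.succAbove 2) ⬝ᵥ u) h
  simp only [dotProduct_add, dotProduct_smul, dlam_succAbove_dot_faceEdge] at h1 h2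
  constructor
  · simpa using h1
  · simpa using h2

include hv in
theorem faceCross_dot_self_pos (i : Fin 4) : 0 < faceCross v i ⬝ᵥ faceCross v i := by
  have h := faceCross_ne_zero hv i
  have h0 : 0 ≤ faceCross v i ⬝ᵥ faceCross v i :=
    Finset.sum_nonneg fun a _ => mul_self_nonneg _
  exact lt_of_le_of_ne h0 fun h1 => h (dotProduct_self_eq_zero.1 h1.symm)

include hv in
theorem unitNormal_dot_self (i : Fin 4) : unitNormal v i ⬝ᵥ unitNormal v i = 1 := by
  have h := faceCross_dot_self_pos hv i
  rw [unitNormal, smul_dotProduct, dotProduct_smul, smul_smul, ← mul_inv, smul_eq_mul,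
    Real.mul_self_sqrt h.le, inv_mul_cancel₀ h.ne']

theorem unitNormal_dot_faceEdge (i : Fin 4) (a b : Fin 3) :
    unitNormal v i ⬝ᵥ (faceVertex v i a - faceVertex v i b) = 0 := by
  have h1 : faceCross v i ⬝ᵥ (faceVertex v i 1 - faceVertex v i 0) = 0 := by
    rw [faceCross, dotProduct_comm, dot_self_cross]
  have h2 : faceCross v i ⬝ᵥ (faceVertex v i 2 - faceVertex v i 0) = 0 := by
    rw [faceCross, dotProduct_comm, dot_cross_self]
  have h3 : ∀ a, faceCross v i ⬝ᵥ faceVertex v i a = faceCross v i ⬝ᵥ faceVertex v i 0 := by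
    intro a
    rw [dotProduct_sub] at h1 h2
    fin_cases a
    · rfl
    · simpa using sub_eq_zero.1 h1
    · simpa using sub_eq_zero.1 h2
  rw [unitNormal, smul_dotProduct, dotProduct_sub, h3 a, h3 b, sub_self, smul_zero]

theorem exists_unitNormal_eq (i : Fin 4) : ∃ c : ℝ, c ≠ 0 ∧ unitNormal v i = c • dlam hv i := by
  obtain ⟨c, hc⟩ := eq_smul_dlam_of_dot hv (unitNormal_dot_faceEdge (v := v) i 1 0)
    (unitNormal_dot_faceEdge i 2 0)
  refine ⟨c, ?_, hc⟩
  rintro rfl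
  have := unitNormal_dot_self hv i
  rw [hc] at this
  simp at this

theorem dot_unitNormal_eq_zero (i : Fin 4) (w : Pt) :
    w ⬝ᵥ unitNormal v i = 0 ↔ dlam hv i ⬝ᵥ w = 0 := by
  obtain ⟨c, hc, h⟩ := exists_unitNormal_eq hv i
  rw [h, dotProduct_smul, smul_eq_mul, mul_eq_zero, dotProduct_comm]
  simp [hc]

include hv in
/-- A vector is determined by its products with two edges of a face and with the normal. -/
theorem ext_face {i : Fin 4} {u w : Pt}
    (h1 : u ⬝ᵥ (faceVertex v i 1 - faceVertex v i 0) = w ⬝ᵥ (faceVertex v i 1 - faceVertex v i 0))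
    (h2 : u ⬝ᵥ (faceVertex v i 2 - faceVertex v i 0) = w ⬝ᵥ (faceVertex v i 2 - faceVertex v i 0))
    (h3 : u ⬝ᵥ unitNormal v i = w ⬝ᵥ unitNormal v i) : u = w := by
  rw [← sub_eq_zero, ← sub_dotProduct] at h1 h2 h3
  obtain ⟨c, hc⟩ := eq_smul_dlam_of_dot hv h1 h2
  have h4 := (dot_unitNormal_eq_zero hv i _).1 h3
  rw [hc, dotProduct_smul, smul_eq_mul, mul_eq_zero, dotProduct_self_eq_zero] at h4
  rw [← sub_eq_zero, hc, h4.resolve_right (dlam_ne_zero hv i), zero_smul]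

theorem tangPart_dot_faceEdge (i : Fin 4) (w : Pt) (a b : Fin 3) :
    tangPart (unitNormal v i) w ⬝ᵥ (faceVertex v i a - faceVertex v i b)
      = w ⬝ᵥ (faceVertex v i a - faceVertex v i b) := by
  rw [tangPart, sub_dotProduct, smul_dotProduct, unitNormal_dot_faceEdge, smul_zero, sub_zero]

include hv in
theorem tangPart_dot_unitNormal (i : Fin 4) (w : Pt) :
    tangPart (unitNormal v i) w ⬝ᵥ unitNormal v i = 0 := by
  rw [tangPart, sub_dotProduct, smul_dotProduct, unitNormal_dot_self hv, smul_eq_mul, mul_one,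
    sub_self]

include hv in
theorem tangPart_eq_zero_iff (i : Fin 4) (w : Pt) : tangPart (unitNormal v i) w = 0 ↔
    w ⬝ᵥ (faceVertex v i 1 - faceVertex v i 0) = 0 ∧
      w ⬝ᵥ (faceVertex v i 2 - faceVertex v i 0) = 0 := by
  constructor
  · intro h
    constructor <;> rw [← tangPart_dot_faceEdge, h, zero_dotProduct]
  · rintro ⟨h1, h2⟩
    refine ext_face hv (i := i) ?_ ?_ ?_
    · rw [tangPart_dot_faceEdge, h1, zero_dotProduct]
    · rw [tangPart_dot_faceEdge, h2, zero_dotProduct]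
    · rw [tangPart_dot_unitNormal hv, zero_dotProduct]

/-- A tangent vector of a face is a combination of two of its edges. -/
theorem eq_of_dot_unitNormal {i : Fin 4} {τ : Pt} (h : τ ⬝ᵥ unitNormal v i = 0) :
    τ = (dlam hv (i.succAbove 1) ⬝ᵥ τ) • (faceVertex v i 1 - faceVertex v i 0)
      + (dlam hv (i.succAbove 2) ⬝ᵥ τ) • (faceVertex v i 2 - faceVertex v i 0) := by
  have h1 := sum_dlam_dot_smul hv τ
  have h2 := sum_dlam_dot hv τ
  rw [Fin.sum_univ_succAbove _ i, (dot_unitNormal_eq_zero hv i τ).1 h, Fin.sum_univ_three] at h1 h2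
  simp only [zero_smul, zero_add] at h1 h2
  conv_lhs => rw [← h1]
  have h3 : dlam hv (i.succAbove 0) ⬝ᵥ τ
      = -(dlam hv (i.succAbove 1) ⬝ᵥ τ) - dlam hv (i.succAbove 2) ⬝ᵥ τ := by linarith
  rw [h3]
  simp only [faceVertex]
  module

/-! ### Polynomials that vanish on subsimplices -/

include hv in
/-- A polynomial that vanishes on a subsimplex vanishes on the affine span of the subsimplex. -/
theorem eval_eq_zero_of_subsimplex {S : Finset (Fin 4)} (hS : S.Nonempty) {p : Poly}
    (h : ∀ x ∈ tet v, (∀ j, j ∉ S → eval x (lam hv j) = 0) → eval x p = 0) {x : Pt}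
    (hx : ∀ j, j ∉ S → eval x (lam hv j) = 0) : eval x p = 0 := by
  -- The barycentre of the subsimplex is in its relative interior, so a short move from it towards
  -- any point of the affine span stays in the subsimplex.
  obtain ⟨c, hc1, hc2⟩ : ∃ c : Pt, (∀ j ∈ S, 0 < eval c (lam hv j)) ∧
      ∀ j, j ∉ S → eval c (lam hv j) = 0 := by
    let c : Pt := S.centroid ℝ v
    have hb : ∀ j, eval c (lam hv j) = (simplexBasis hv).coord j (S.centroid ℝ (simplexBasis hv)) :=
      fun j => eval_lam hv j c
    refine ⟨c, fun j hj => ?_, fun j hj => ?_⟩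
    · rw [hb, (simplexBasis hv).coord_apply_centroid hj]
      have := hS.card_pos
      positivity
    · rw [hb, Finset.centroid_def, (simplexBasis hv).coord_apply_combination_of_notMem hj]
      exact S.sum_centroidWeights_eq_one_of_nonempty ℝ hS
  have hev : ∀ᶠ τ in 𝓝[>] (0 : ℝ), ∀ j ∈ S,
      0 < (1 - τ) * eval c (lam hv j) + τ * eval x (lam hv j) := by
    rw [Filter.eventually_all_finset]
    intro j hj
    have hcont : ContinuousAt
        (fun τ : ℝ => (1 - τ) * eval c (lam hv j) + τ * eval x (lam hv j)) 0 := by fun_prop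
    refine nhdsWithin_le_nhds (hcont.eventually (lt_mem_nhds ?_))
    simpa using hc1 j hj
  obtain ⟨δ, hδ, hδ'⟩ := (mem_nhdsGT_iff_exists_Ioo_subset).1 hev
  refine eval_eq_zero_of_segment p c x hδ fun τ hτ => ?_
  have h0 : ∀ j, j ∉ S → eval (c + τ • (x - c)) (lam hv j) = 0 := fun j hj => by
    rw [eval_lam_line, hc2 j hj, hx j hj]; ring
  refine h _ ((mem_tet hv).2 fun j => ?_) h0
  by_cases hj : j ∈ S
  · rw [eval_lam_line]
    exact (hδ' hτ j hj).le
  · exact (h0 j hj).ge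

include hv in
theorem eq_zero_of_eval_tet {p : Poly} (h : ∀ x ∈ tet v, eval x p = 0) : p = 0 := by
  refine MvPolynomial.funext fun x => ?_
  rw [map_zero]
  exact eval_eq_zero_of_subsimplex hv Finset.univ_nonempty (fun x hx _ => h x hx) (by simp)

/-- The substitution `x ↦ x - ℓ(x) e` of polynomials. For an affine function `ℓ` that increases with
unit speed in direction `e` it corresponds to the projection onto the plane `ℓ = 0`. -/
def shift (ℓ : Poly) (e : Pt) : Poly →ₐ[ℝ] Poly :=
  MvPolynomial.aeval fun a => X a - C (e a) * ℓ

theorem eval_shift (ℓ : Poly) (e : Pt) (p : Poly) (x : Pt) :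
    eval x (shift ℓ e p) = eval (x - eval x ℓ • e) p := by
  have h1 : ((MvPolynomial.aeval x).comp (shift ℓ e))
      = (MvPolynomial.aeval (x - eval x ℓ • e) : Poly →ₐ[ℝ] ℝ) := by
    ext a
    simp [shift, MvPolynomial.aeval_eq_eval, mul_comm]
  have h2 := congrArg (fun f : Poly →ₐ[ℝ] ℝ => f p) h1
  simpa only [AlgHom.comp_apply, MvPolynomial.aeval_eq_eval] using h2

theorem shift_mem_polyDeg {ℓ : Poly} (hℓ : ℓ ∈ polyDeg 1) (e : Pt) {m : ℤ} {p : Poly}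
    (hp : p ∈ polyDeg m) : shift ℓ e p ∈ polyDeg m :=
  aeval_mem_polyDeg (fun a => Submodule.sub_mem _ (X_mem_polyDeg a) (C_mul_mem_polyDeg _ hℓ)) hp

/-- Modulo `ℓ` the substitution sends every variable to itself, so it is the identity of the
quotient ring. -/
theorem dvd_sub_shift (ℓ : Poly) (e : Pt) (p : Poly) : ℓ ∣ p - shift ℓ e p := by
  rw [← Ideal.mem_span_singleton, ← Ideal.Quotient.eq]
  have h : (Ideal.Quotient.mkₐ ℝ (Ideal.span {ℓ})) =
      (Ideal.Quotient.mkₐ ℝ (Ideal.span {ℓ})).comp (shift ℓ e) := by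
    ext a
    simp only [shift, AlgHom.comp_apply, MvPolynomial.aeval_X, Ideal.Quotient.mkₐ_eq_mk]
    rw [Ideal.Quotient.eq, sub_sub_cancel, Ideal.mem_span_singleton]
    exact Dvd.intro_left _ rfl
  exact congrArg (fun f : Poly →ₐ[ℝ] _ => f p) h

theorem dvd_of_eval {ℓ : Poly} {e : Pt} (hℓ : ∀ x, eval (x - eval x ℓ • e) ℓ = 0) {p : Poly}
    (h : ∀ x, eval x ℓ = 0 → eval x p = 0) : ℓ ∣ p := by
  have h0 : shift ℓ e p = 0 := by
    refine MvPolynomial.funext fun x => ?_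
    rw [eval_shift, map_zero]
    exact h _ (hℓ x)
  have := dvd_sub_shift ℓ e p
  rwa [h0, sub_zero] at this

theorem eval_lam_shift (i j k : Fin 4) (x : Pt) (c : ℝ) :
    eval (x - c • (v i - v j)) (lam hv k) = eval x (lam hv k)
      - c * ((if k = i then 1 else 0) - (if k = j then 1 else 0)) := by
  have := eval_lam_sub hv k (x - c • (v i - v j)) x
  rw [sub_sub_cancel_left, dotProduct_neg, dotProduct_smul, dlam_dot_edge, smul_eq_mul] at this
  linarith

theorem lam_dvd_of_eval {i : Fin 4} {p : Poly}
    (h : ∀ x, eval x (lam hv i) = 0 → eval x p = 0) : lam hv i ∣ p := by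
  have hij : i ≠ i.succAbove 0 := (Fin.succAbove_ne i 0).symm
  refine dvd_of_eval (e := v i - v (i.succAbove 0)) (fun x => ?_) h
  rw [eval_lam_shift]
  simp [hij]

theorem lam_dvd_iff_eval {i : Fin 4} {p : Poly} :
    lam hv i ∣ p ↔ ∀ x, eval x (lam hv i) = 0 → eval x p = 0 := by
  refine ⟨?_, lam_dvd_of_eval hv⟩
  rintro ⟨A, rfl⟩ x hx
  rw [map_mul, hx, zero_mul]

theorem lam_dvd_iff_shift {i : Fin 4} {p : Poly} :
    lam hv i ∣ p ↔ shift (lam hv i) (v i - v (i.succAbove 0)) p = 0 := by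
  have hij : i ≠ i.succAbove 0 := (Fin.succAbove_ne i 0).symm
  constructor
  · rintro ⟨A, rfl⟩
    rw [map_mul]
    convert zero_mul _
    refine MvPolynomial.funext fun x => ?_
    rw [eval_shift, eval_lam_shift]
    simp [hij]
  · intro h
    have := dvd_sub_shift (lam hv i) (v i - v (i.succAbove 0)) p
    rwa [h, sub_zero] at this

/-- Divisibility by `λ_i` means lying in the kernel of an algebra homomorphism into a domain, by
`lam_dvd_iff_shift`; such a kernel is a prime ideal. -/
theorem prime_lam (i : Fin 4) : Prime (lam hv i) := by
  have hij : i ≠ i.succAbove 0 := (Fin.succAbove_ne i 0).symm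
  refine ⟨lam_ne_zero hv i, fun h => ?_, fun p q h => ?_⟩
  · have h1 := h.map (eval (v (i.succAbove 0)))
    rw [eval_lam_vertex] at h1
    simp [hij] at h1
  · rw [lam_dvd_iff_shift, map_mul, mul_eq_zero] at h
    simpa only [lam_dvd_iff_shift] using h

theorem not_lam_dvd_lam {i j : Fin 4} (hij : i ≠ j) : ¬ lam hv i ∣ lam hv j := by
  intro h
  have := (lam_dvd_iff_eval hv).1 h (v j) (by rw [eval_lam_vertex, if_neg hij])
  simp [eval_lam_vertex] at this

/-- Vanishing on the face extends to its plane, and vanishing on the plane gives the factor. This is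
how boundary conditions become algebra. -/
theorem lam_dvd_of_face {i : Fin 4} {p : Poly} (h : ∀ x ∈ face v i, eval x p = 0) :
    lam hv i ∣ p := by
  refine lam_dvd_of_eval hv fun x hx => ?_
  refine eval_eq_zero_of_subsimplex hv (S := Finset.univ.erase i)
    ⟨i.succAbove 0, by simp [Fin.succAbove_ne]⟩ (fun y hy hy0 => ?_) (by simpa using hx)
  exact h y ((mem_face hv).2 ⟨hy, hy0 i (by simp)⟩)

end MixedElasticity

end

/-! ### Bubble fields in the interior of the tetrahedron -/

noncomputable section

namespace MixedElasticity

open MvPolynomial (C X eval pderiv)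

/-! ### Products of polynomial fields with constant vectors -/

/-- The product of a polynomial vector field with a constant vector. -/
def pdot (c : Pt) (w : VecPoly) : Poly := ∑ a, C (c a) * w a

theorem eval_pdot (c : Pt) (w : VecPoly) (x : Pt) : eval x (pdot c w) = c ⬝ᵥ evalVec w x := by
  simp [pdot, evalVec, dotProduct]

theorem pdot_mem_polyDeg (c : Pt) {w : VecPoly} {m : ℤ} (hw : w ∈ vecDeg m) :
    pdot c w ∈ polyDeg m :=
  Submodule.sum_mem _ fun a _ => C_mul_mem_polyDeg _ (mem_vecDeg.1 hw a)

theorem pdot_add (c : Pt) (w u : VecPoly) : pdot c (w + u) = pdot c w + pdot c u := by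
  simp [pdot, mul_add, Finset.sum_add_distrib]

theorem evalVec_add (w u : VecPoly) (x : Pt) : evalVec (w + u) x = evalVec w x + evalVec u x := by
  funext a; simp [evalVec]

theorem evalVec_smul (c : ℝ) (w : VecPoly) (x : Pt) : evalVec (c • w) x = c • evalVec w x := by
  funext a; simp [evalVec, MvPolynomial.smul_eval]

theorem evalVec_zero (x : Pt) : evalVec 0 x = 0 := by
  funext a; simp [evalVec]

theorem evalVec_sum {ι : Type*} (s : Finset ι) (w : ι → VecPoly) (x : Pt) :
    evalVec (∑ i ∈ s, w i) x = ∑ i ∈ s, evalVec (w i) x := by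
  funext a; simp [evalVec, Finset.sum_apply]

theorem evalVec_injective {w u : VecPoly} (h : ∀ x, evalVec w x = evalVec u x) : w = u := by
  funext a
  exact MvPolynomial.funext fun x => congrFun (h x) a

/-- The field `s c` for a polynomial `s` and a constant vector `c`. -/
def pvec (s : Poly) (c : Pt) : VecPoly := fun a => C (c a) * s

theorem evalVec_pvec (s : Poly) (c x : Pt) : evalVec (pvec s c) x = eval x s • c := by
  funext a; simp [pvec, evalVec, mul_comm]

theorem pvec_mem_vecDeg {s : Poly} (c : Pt) {m : ℤ} (hs : s ∈ polyDeg m) : pvec s c ∈ vecDeg m :=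
  mem_vecDeg.2 fun _ => C_mul_mem_polyDeg _ hs

variable {v : Fin 4 → Pt} (hv : AffineIndependent ℝ v)

include hv in
theorem eq_of_dlam_dot {u w : Pt} (h : ∀ i, dlam hv i ⬝ᵥ u = dlam hv i ⬝ᵥ w) : u = w := by
  rw [← sum_dlam_dot_smul hv u, ← sum_dlam_dot_smul hv w]
  exact Finset.sum_congr rfl fun i _ => by rw [h]

include hv in
-- The edges `v_j - v_0` and the gradients `∇λ_j`, for `j = 1, 2, 3`, are dual bases.
theorem eq_of_dot_edge {u w : Pt}
    (h : ∀ j : Fin 3, (v j.succ - v 0) ⬝ᵥ u = (v j.succ - v 0) ⬝ᵥ w) : u = w := by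
  refine eq_of_dlam_dot hv fun i => ?_
  rw [dotProduct_comm _ u, dotProduct_comm _ w]
  have key : ∀ u : Pt, u = ∑ j : Fin 3, ((v j.succ - v 0) ⬝ᵥ u) • dlam hv j.succ := by
    intro u
    have h1 := sum_dot_smul_dlam hv u
    have h2 := sum_dlam hv
    rw [Fin.sum_univ_succ] at h1 h2
    conv_lhs => rw [← h1, eq_neg_of_add_eq_zero_left h2]
    simp only [sub_dotProduct, sub_smul, Finset.sum_sub_distrib, ← Finset.smul_sum]
    simp only [dotProduct_comm _ u, smul_neg]
    abel
  rw [key u, key w]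
  simp only [h]

/-! ### Interior fields of the Raviart-Thomas type -/

/-- The field `∑ λ_j (x - v_j) q_j`, where `j` runs through the vertices `1, 2, 3`. -/
def rtBubble : VecPoly →ₗ[ℝ] VecPoly where
  toFun q := fun a => ∑ j : Fin 3, lam hv j.succ * (X a - C (v j.succ a)) * q j
  map_add' p q := by
    funext a
    simp [mul_add, Finset.sum_add_distrib]
  map_smul' c q := by
    funext a
    simp [Finset.smul_sum]

theorem evalVec_rtBubble (q : VecPoly) (x : Pt) : evalVec (rtBubble hv q) x =
    ∑ j : Fin 3, (eval x (lam hv j.succ) * eval x (q j)) • (x - v j.succ) := by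
  funext a
  simp only [evalVec, rtBubble, LinearMap.coe_mk, AddHom.coe_mk, map_sum, map_mul, map_sub,
    MvPolynomial.eval_X, MvPolynomial.eval_C, Finset.sum_apply, Pi.smul_apply, Pi.sub_apply,
    smul_eq_mul]
  exact Finset.sum_congr rfl fun j _ => by ring

theorem dlam_dot_rtBubble (q : VecPoly) (x : Pt) (i : Fin 4) :
    dlam hv i ⬝ᵥ evalVec (rtBubble hv q) x = ∑ j : Fin 3, eval x (lam hv j.succ) * eval x (q j) *
      (eval x (lam hv i) - if i = j.succ then 1 else 0) := by
  rw [evalVec_rtBubble, dotProduct_sum]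
  refine Finset.sum_congr rfl fun j _ => ?_
  rw [dotProduct_smul, ← eval_lam_sub, eval_lam_vertex, smul_eq_mul]

theorem dlam_zero_dot_rtBubble (q : VecPoly) (x : Pt) :
    dlam hv 0 ⬝ᵥ evalVec (rtBubble hv q) x = eval x (lam hv 0) *
      ∑ j : Fin 3, eval x (lam hv j.succ) * eval x (q j) := by
  rw [dlam_dot_rtBubble, Finset.mul_sum]
  refine Finset.sum_congr rfl fun j _ => ?_
  rw [if_neg (Fin.succ_ne_zero j).symm]
  ring

theorem dlam_succ_dot_rtBubble (q : VecPoly) (x : Pt) (i : Fin 3) :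
    dlam hv i.succ ⬝ᵥ evalVec (rtBubble hv q) x = eval x (lam hv i.succ) *
      ((∑ j : Fin 3, eval x (lam hv j.succ) * eval x (q j)) - eval x (q i)) := by
  rw [dlam_dot_rtBubble]
  simp only [mul_sub, Finset.sum_sub_distrib, Fin.succ_inj]
  congr 1
  · rw [Finset.mul_sum]
    exact Finset.sum_congr rfl fun j _ => mul_comm _ _
  · simp

theorem rtBubble_mem_Pminus2 {m : ℤ} {q : VecPoly} (hq : q ∈ vecDeg m) :
    rtBubble hv q ∈ Pminus2 (m + 2) := by
  have h : ∀ j : Fin 3, lam hv j.succ * q j ∈ polyDeg (m + 2 - 1) := fun j =>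
    mul_mem_polyDeg (lam_mem_polyDeg hv _) (mem_vecDeg.1 hq j) (by linarith)
  refine ⟨fun a => -∑ j : Fin 3, C (v j.succ a) * (lam hv j.succ * q j), mem_vecDeg.2 fun a =>
    Submodule.neg_mem _ (Submodule.sum_mem _ fun j _ => C_mul_mem_polyDeg _ (h j)),
    ∑ j : Fin 3, lam hv j.succ * q j, Submodule.sum_mem _ fun j _ => h j, ?_⟩
  funext a
  simp only [rtBubble, LinearMap.coe_mk, AddHom.coe_mk, Pi.add_apply, Finset.mul_sum]
  rw [neg_add_eq_sub, ← Finset.sum_sub_distrib]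
  exact Finset.sum_congr rfl fun j _ => by ring

theorem dlam_dot_rtBubble_face (q : VecPoly) {i : Fin 4} {x : Pt} (hx : x ∈ face v i) :
    dlam hv i ⬝ᵥ evalVec (rtBubble hv q) x = 0 := by
  have h := ((mem_face hv).1 hx).2
  refine Fin.cases ?_ (fun i => ?_) i h
  · intro h
    rw [dlam_zero_dot_rtBubble, h, zero_mul]
  · intro h
    rw [dlam_succ_dot_rtBubble, h, zero_mul]

/-- The boundary condition gives `∇λ_i · w = λ_i A_i`. For `w = p + x s` one has `∇λ_i · x = λ_i -
λ_i(0)`, so `λ_i (A_i - s)` has degree at most `m + 1` and `A_i - s` has degree at most `m`. The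
differences `q_j = A_0 - A_j` thus lose the common top part `s`. They determine `w`: the sum of the
`λ_i A_i` is zero because the gradients add up to zero, and this gives `A_0 = ∑ λ_j q_j`. -/
theorem exists_rtBubble {m : ℤ} {w : VecPoly} (hw : w ∈ Pminus2 (m + 2))
    (h0 : ∀ i, ∀ x ∈ face v i, dlam hv i ⬝ᵥ evalVec w x = 0) :
    ∃ q ∈ vecDeg m, w = rtBubble hv q := by
  obtain ⟨p, hp, s, hs, hw⟩ := hw
  have hA : ∀ i, ∃ A, pdot (dlam hv i) w = lam hv i * A := fun i =>
    lam_dvd_of_face hv fun x hx => by rw [eval_pdot]; exact h0 i x hx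
  choose A hA using hA
  have hdeg : ∀ i, A i - s ∈ polyDeg m := by
    intro i
    have h1 : lam hv i * (A i - s) = pdot (dlam hv i) p
        - C ((simplexBasis hv).coord i 0) * s := by
      rw [mul_sub, ← hA, hw, pdot_add]
      simp only [pdot, lam, add_mul, Finset.sum_mul, mul_assoc]
      ring
    refine mem_polyDeg_of_lam_mul hv (m := m + 2 - 1) (i := i) ?_ (by linarith)
    rw [h1]
    exact Submodule.sub_mem _ (pdot_mem_polyDeg _ hp) (C_mul_mem_polyDeg _ hs)
  have hAev : ∀ i x, dlam hv i ⬝ᵥ evalVec w x = eval x (lam hv i) * eval x (A i) := by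
    intro i x
    rw [← eval_pdot, hA, map_mul]
  refine ⟨fun j => A 0 - A j.succ, mem_vecDeg.2 fun j => ?_, evalVec_injective fun x => ?_⟩
  · have := Submodule.sub_mem _ (hdeg 0) (hdeg j.succ)
    rwa [sub_sub_sub_cancel_right] at this
  · have hsum : ∑ i, eval x (lam hv i) * eval x (A i) = 0 := by
      rw [← sum_dlam_dot hv (evalVec w x)]
      exact Finset.sum_congr rfl fun i _ => (hAev i x).symm
    have h1 := sum_eval_lam hv x
    rw [Fin.sum_univ_succ] at hsum h1
    have hQ : ∑ j : Fin 3, eval x (lam hv j.succ) * eval x (A 0 - A j.succ) = eval x (A 0) := by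
      simp only [map_sub, mul_sub, Finset.sum_sub_distrib, ← Finset.sum_mul]
      linear_combination (eval x (A 0)) * h1 - hsum
    refine eq_of_dlam_dot hv fun i => ?_
    refine Fin.cases ?_ (fun i => ?_) i
    · rw [dlam_zero_dot_rtBubble, hQ, hAev]
    · rw [dlam_succ_dot_rtBubble, hQ, hAev, map_sub]
      ring

/-- The test field that belongs to `rtBubble hv q`. -/
def rtTest : VecPoly →ₗ[ℝ] VecPoly where
  toFun q := fun a => -∑ j : Fin 3, C (dlam hv j.succ a) * q j
  map_add' p q := by
    funext a
    simp only [Pi.add_apply, mul_add, Finset.sum_add_distrib, neg_add]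
  map_smul' c q := by
    funext a
    simp [Finset.smul_sum]

theorem rtTest_mem {m : ℤ} {q : VecPoly} (hq : q ∈ vecDeg m) : rtTest hv q ∈ vecDeg m :=
  mem_vecDeg.2 fun _ => Submodule.neg_mem _
    (Submodule.sum_mem _ fun j _ => C_mul_mem_polyDeg _ (mem_vecDeg.1 hq j))

theorem evalVec_rtTest (q : VecPoly) (x : Pt) : evalVec (rtTest hv q) x =
    -∑ j : Fin 3, eval x (q j) • dlam hv j.succ := by
  funext a
  simp [evalVec, rtTest, Finset.sum_apply, mul_comm]

/-- The product equals `∑ λ_j q_j² - (∑ λ_j q_j)²` with sums over `j = 1, 2, 3`. Since the four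
coordinates add up to one, this is `λ_0 ∑ λ_j q_j²` plus the sum of the terms `λ_i λ_j (q_i - q_j)²`
over pairs `i < j`. -/
theorem rtBubble_dot_rtTest_ge (q : VecPoly) {x : Pt} (hx : x ∈ tet v) :
    eval x (lam hv 0) * ∑ j : Fin 3, eval x (lam hv j.succ) * eval x (q j) ^ 2 ≤
      evalVec (rtBubble hv q) x ⬝ᵥ evalVec (rtTest hv q) x := by
  have hpos := (mem_tet hv).1 hx
  rw [evalVec_rtTest, dotProduct_neg, dotProduct_sum]
  simp only [dotProduct_smul, dotProduct_comm _ (dlam hv _), dlam_succ_dot_rtBubble, smul_eq_mul]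
  have h1 := sum_eval_lam hv x
  rw [Fin.sum_univ_succ] at h1
  simp only [Fin.sum_univ_three] at h1 ⊢
  have p1 := hpos (Fin.succ 0)
  have p2 := hpos (Fin.succ 1)
  have p3 := hpos (Fin.succ 2)
  have h0 : eval x (lam hv 0) = 1 - (eval x (lam hv (Fin.succ 0)) + eval x (lam hv (Fin.succ 1))
    + eval x (lam hv (Fin.succ 2))) := by linarith
  rw [h0]
  generalize eval x (lam hv (Fin.succ 0)) = a at *
  generalize eval x (lam hv (Fin.succ 1)) = b at *
  generalize eval x (lam hv (Fin.succ 2)) = c at *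
  generalize eval x (q 0) = s
  generalize eval x (q 1) = t
  generalize eval x (q 2) = u
  nlinarith [mul_nonneg (mul_nonneg p1 p2) (sq_nonneg (s - t)),
    mul_nonneg (mul_nonneg p1 p3) (sq_nonneg (s - u)),
    mul_nonneg (mul_nonneg p2 p3) (sq_nonneg (t - u))]

theorem rtBubble_dot_rtTest_nonneg (q : VecPoly) {x : Pt} (hx : x ∈ tet v) :
    0 ≤ evalVec (rtBubble hv q) x ⬝ᵥ evalVec (rtTest hv q) x :=
  (mul_nonneg ((mem_tet hv).1 hx 0) (Finset.sum_nonneg fun _ _ =>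
    mul_nonneg ((mem_tet hv).1 hx _) (sq_nonneg _))).trans (rtBubble_dot_rtTest_ge hv q hx)

theorem eq_zero_of_rtBubble_dot_rtTest {q : VecPoly}
    (h : ∀ x ∈ tet v, evalVec (rtBubble hv q) x ⬝ᵥ evalVec (rtTest hv q) x = 0) : q = 0 := by
  funext j
  have h1 : lam hv 0 * (lam hv j.succ * q j ^ 2) = 0 := by
    refine eq_zero_of_eval_tet hv fun x hx => ?_
    have hpos := (mem_tet hv).1 hx
    have h2 := rtBubble_dot_rtTest_ge hv q hx
    rw [h x hx, Finset.mul_sum] at h2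
    have h3 := Finset.single_le_sum (s := Finset.univ)
      (f := fun j : Fin 3 => eval x (lam hv 0) * (eval x (lam hv j.succ) * eval x (q j) ^ 2))
      (fun j _ => mul_nonneg (hpos _) (mul_nonneg (hpos _) (sq_nonneg _))) (Finset.mem_univ j)
    have h4 : 0 ≤ eval x (lam hv 0) * (eval x (lam hv j.succ) * eval x (q j) ^ 2) :=
      mul_nonneg (hpos _) (mul_nonneg (hpos _) (sq_nonneg _))
    simp only [map_mul, map_pow]
    exact le_antisymm (h3.trans h2) h4
  simpa [lam_ne_zero] using h1

/-! ### Interior fields of the Nédélec type -/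

/-- The field `∑ λ_k λ_l (λ_0 ∇λ_j - λ_j ∇λ_0) q_j`, where `{j, k, l} = {1, 2, 3}`. -/
def ndBubble : VecPoly →ₗ[ℝ] VecPoly where
  toFun q := fun a => ∑ j : Fin 3, lam hv (j + 1).succ * lam hv (j + 2).succ *
    (lam hv 0 * C (dlam hv j.succ a) - lam hv j.succ * C (dlam hv 0 a)) * q j
  map_add' p q := by
    funext a
    simp only [Pi.add_apply, mul_add, Finset.sum_add_distrib]
  map_smul' c q := by
    funext a
    simp [Finset.smul_sum]

theorem evalVec_ndBubble (q : VecPoly) (x : Pt) : evalVec (ndBubble hv q) x =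
    ∑ j : Fin 3, (eval x (lam hv (j + 1).succ) * eval x (lam hv (j + 2).succ) * eval x (q j)) •
      (eval x (lam hv 0) • dlam hv j.succ - eval x (lam hv j.succ) • dlam hv 0) := by
  funext a
  simp only [evalVec, ndBubble, LinearMap.coe_mk, AddHom.coe_mk, map_sum, map_mul, map_sub,
    MvPolynomial.eval_C, Finset.sum_apply, Pi.smul_apply, Pi.sub_apply, smul_eq_mul]
  exact Finset.sum_congr rfl fun j _ => by ring

theorem edge_dot_ndBubble (q : VecPoly) (x : Pt) (i : Fin 3) :
    (v i.succ - v 0) ⬝ᵥ evalVec (ndBubble hv q) x =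
      eval x (lam hv (i + 1).succ) * eval x (lam hv (i + 2).succ) *
        (eval x (lam hv 0) * eval x (q i) + eval x (lam hv i.succ) * ∑ j, eval x (q j)) := by
  rw [evalVec_ndBubble, dotProduct_comm, sum_dotProduct]
  simp only [smul_dotProduct, sub_dotProduct, dlam_dot_edge, smul_eq_mul, Fin.sum_univ_three]
  fin_cases i <;> simp [Fin.ext_iff] <;> ring

/-- With `λ_i = λ_i(0) + ∇λ_i · x`, the linear part is the expansion of the double product `x ×
(∇λ_j × ∇λ_i)`. Hence the Whitney fields are of the form `q + x × s` with constant `q` and `s`. -/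
theorem dlam_cross_form (i j : Fin 4) (a : Fin 3) :
    lam hv i * C (dlam hv j a) - lam hv j * C (dlam hv i a) =
      C ((simplexBasis hv).coord i 0 * dlam hv j a - (simplexBasis hv).coord j 0 * dlam hv i a) +
      crossProduct (fun i => (X i : Poly)) (fun a => C (crossProduct (dlam hv j) (dlam hv i) a))
        a := by
  simp only [lam, Fin.sum_univ_three, cross_apply, map_sub, map_mul]
  fin_cases a <;> simp <;> ring

theorem whitney_mem_Pminus1 (i j : Fin 4) {m : ℤ} {s : Poly} (hs : s ∈ polyDeg (m - 1)) :
    (fun a => s * (lam hv i * C (dlam hv j a) - lam hv j * C (dlam hv i a)) : VecPoly)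
      ∈ Pminus1 m := by
  refine ⟨fun a => C ((simplexBasis hv).coord i 0 * dlam hv j a
    - (simplexBasis hv).coord j 0 * dlam hv i a) * s,
    mem_vecDeg.2 fun a => C_mul_mem_polyDeg _ hs,
    fun a => C (crossProduct (dlam hv j) (dlam hv i) a) * s,
    mem_vecDeg.2 fun a => C_mul_mem_polyDeg _ hs, ?_⟩
  funext a
  rw [dlam_cross_form, mul_add, mul_comm s, Pi.add_apply]
  congr 1
  simp only [cross_apply]
  fin_cases a <;> simp <;> ring

theorem Pminus1_add {m : ℤ} {w u : VecPoly} (hw : w ∈ Pminus1 m) (hu : u ∈ Pminus1 m) :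
    w + u ∈ Pminus1 m := by
  obtain ⟨q, hq, s, hs, rfl⟩ := hw
  obtain ⟨q', hq', s', hs', rfl⟩ := hu
  exact ⟨q + q', Submodule.add_mem _ hq hq', s + s', Submodule.add_mem _ hs hs', by
    rw [map_add]; abel⟩

theorem Pminus1_smul {m : ℤ} {w : VecPoly} (c : ℝ) (hw : w ∈ Pminus1 m) : c • w ∈ Pminus1 m := by
  obtain ⟨q, hq, s, hs, rfl⟩ := hw
  refine ⟨c • q, Submodule.smul_mem _ c hq, c • s, Submodule.smul_mem _ c hs, ?_⟩
  funext a
  simp only [cross_apply, Pi.add_apply, Pi.smul_apply, smul_add]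
  fin_cases a <;> simp [smul_sub]

theorem ndBubble_mem_Pminus1 {m : ℤ} {q : VecPoly} (hq : q ∈ vecDeg m) :
    ndBubble hv q ∈ Pminus1 (m + 3) := by
  have h : ndBubble hv q = ∑ j : Fin 3, (fun a => lam hv (j + 1).succ * lam hv (j + 2).succ * q j *
      (lam hv 0 * C (dlam hv j.succ a) - lam hv j.succ * C (dlam hv 0 a)) : VecPoly) := by
    funext a
    simp only [ndBubble, LinearMap.coe_mk, AddHom.coe_mk, Finset.sum_apply]
    exact Finset.sum_congr rfl fun j _ => by ring
  have h2 : ∀ j : Fin 3, (fun a => lam hv (j + 1).succ * lam hv (j + 2).succ * q j *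
      (lam hv 0 * C (dlam hv j.succ a) - lam hv j.succ * C (dlam hv 0 a)) : VecPoly)
      ∈ Pminus1 (m + 3) := fun j =>
    whitney_mem_Pminus1 hv 0 j.succ (mul_mem_polyDeg (mul_mem_polyDeg (lam_mem_polyDeg hv _)
      (lam_mem_polyDeg hv _) le_rfl) (mem_vecDeg.1 hq j) (by linarith))
  rw [h, Fin.sum_univ_three]
  exact Pminus1_add (Pminus1_add (h2 0) (h2 1)) (h2 2)

theorem vertex_dot_eq (w : Pt) (a b : Fin 4) :
    w ⬝ᵥ (v a - v b) = (v a - v 0) ⬝ᵥ w - (v b - v 0) ⬝ᵥ w := by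
  simp only [sub_dotProduct, dotProduct_comm w]
  ring

theorem eq_add_one_or_eq_add_two {i j : Fin 3} (h : j ≠ i) : j = i + 1 ∨ j = i + 2 := by
  revert i j
  decide

theorem ndBubble_dot_edge_face (q : VecPoly) {i a b : Fin 4} (ha : a ≠ i) (hb : b ≠ i) {x : Pt}
    (hx : x ∈ face v i) : evalVec (ndBubble hv q) x ⬝ᵥ (v a - v b) = 0 := by
  have h := ((mem_face hv).1 hx).2
  -- It suffices that all vertices of the face give the same product `κ` with the edge from `v_0`.
  -- On face `0` the value is `λ_1 λ_2 λ_3 ∑ q_j`; the other faces contain `v_0`, so there it has to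
  -- be zero.
  suffices key : ∃ κ, ∀ a ≠ i, (v a - v 0) ⬝ᵥ evalVec (ndBubble hv q) x = κ by
    obtain ⟨κ, hκ⟩ := key
    rw [vertex_dot_eq, hκ a ha, hκ b hb, sub_self]
  revert h
  refine Fin.cases (fun h => ?_) (fun i h => ?_) i
  · refine ⟨eval x (lam hv (Fin.succ 0)) * eval x (lam hv (Fin.succ 1)) *
      eval x (lam hv (Fin.succ 2)) * ∑ j, eval x (q j), fun a ha => ?_⟩
    obtain ⟨a, rfl⟩ := Fin.exists_succ_eq.2 ha
    rw [edge_dot_ndBubble, h]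
    fin_cases a <;> simp <;> ring
  · refine ⟨0, fun a => ?_⟩
    refine Fin.cases (fun _ => by simp) (fun a ha => ?_) a
    rw [edge_dot_ndBubble]
    have hne : i ≠ a := fun e => ha (by rw [e])
    rcases eq_add_one_or_eq_add_two hne with e | e <;> rw [← e, h] <;> ring

theorem cross_dot_self_poly (s : VecPoly) : ∑ a, X a *
    crossProduct (fun i => (X i : Poly)) s a = 0 := by
  simp only [cross_apply, Fin.sum_univ_three]
  simp
  ring

theorem lam_dvd_pdot_edge {w : VecPoly} {i a b : Fin 4}
    (h : ∀ x ∈ face v i, evalVec w x ⬝ᵥ (v a - v b) = 0) : lam hv i ∣ pdot (v a - v b) w :=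
  lam_dvd_of_face hv fun x hx => by rw [eval_pdot, dotProduct_comm]; exact h x hx

theorem cross_mem_vecDeg {m : ℤ} {s : VecPoly} (hs : s ∈ vecDeg (m - 1)) :
    crossProduct (fun i => (X i : Poly)) s ∈ vecDeg m := by
  rw [mem_vecDeg] at *
  have h : ∀ i j, X i * s j ∈ polyDeg m := fun i j =>
    mul_mem_polyDeg (X_mem_polyDeg i) (hs j) (by linarith)
  intro i
  rw [cross_apply]
  fin_cases i
  · exact Submodule.sub_mem _ (h 1 2) (h 2 1)
  · exact Submodule.sub_mem _ (h 2 0) (h 0 2)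
  · exact Submodule.sub_mem _ (h 0 1) (h 1 0)

theorem Pminus1_subset_vecDeg {m : ℤ} {w : VecPoly} (hw : w ∈ Pminus1 m) : w ∈ vecDeg m := by
  obtain ⟨q, hq, s, hs, rfl⟩ := hw
  exact Submodule.add_mem _ (mem_vecDeg.2 fun i =>
    polyDeg_mono (by linarith) (mem_vecDeg.1 hq i)) (cross_mem_vecDeg hs)

/-- Since `x · (x × s) = 0`, only the part of degree `m - 1` contributes. The gain of one degree
over a general field of degree `m` is what characterizes the space in `exists_ndBubble`. -/
theorem sum_X_mul_mem_polyDeg {m : ℤ} {w : VecPoly} (hw : w ∈ Pminus1 m) :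
    ∑ a, X a * w a ∈ polyDeg m := by
  obtain ⟨q, hq, s, hs, rfl⟩ := hw
  simp only [Pi.add_apply, mul_add, Finset.sum_add_distrib, cross_dot_self_poly, add_zero]
  exact Submodule.sum_mem _ fun a _ =>
    mul_mem_polyDeg (X_mem_polyDeg a) (mem_vecDeg.1 hq a) (by linarith)

/-- The pairing of `w` with `x - v_0 = ∑ λ_j (v_j - v_0)`. -/
theorem sum_lam_mul_pdot_edge (w : VecPoly) :
    ∑ j : Fin 3, lam hv j.succ * pdot (v j.succ - v 0) w = ∑ a, X a * w a - pdot (v 0) w := by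
  refine MvPolynomial.funext fun x => ?_
  have h1 := sum_eval_lam_smul hv x
  have h2 := sum_eval_lam hv x
  rw [Fin.sum_univ_succ] at h1 h2
  have h3 : ∑ j : Fin 3, eval x (lam hv j.succ) • (v j.succ - v 0) = x - v 0 := by
    simp only [smul_sub, Finset.sum_sub_distrib, ← Finset.sum_smul]
    rw [eq_sub_of_add_eq' h1, eq_sub_of_add_eq' h2]
    module
  simp only [map_sum, map_mul, map_sub, eval_pdot, MvPolynomial.eval_X]
  have h4 : ∑ a, x a * eval x (w a) = x ⬝ᵥ evalVec w x := rfl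
  rw [h4, ← sub_dotProduct, ← h3, sum_dotProduct]
  simp only [smul_dotProduct, smul_eq_mul]

/-- The component along `v_i - v_0` vanishes on the two faces that contain this edge, hence it
equals `λ_k λ_l A_i`. The target is `A_i = λ_0 q_i + λ_i ∑ q_j`, as computed in `edge_dot_ndBubble`.
The condition on face `0` makes `A_i - λ_i ∑ A_j` divisible by `λ_0`; the quotients are the `q_i`,
and their sum is that of the `A_j`. -/
theorem exists_ndBubble {m : ℤ} {w : VecPoly} (hw : w ∈ Pminus1 (m + 3))
    (h0 : ∀ i a b, a ≠ i → b ≠ i → ∀ x ∈ face v i, evalVec w x ⬝ᵥ (v a - v b) = 0) :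
    ∃ q ∈ vecDeg m, w = ndBubble hv q := by
  have hA : ∀ i : Fin 3, ∃ A, pdot (v i.succ - v 0) w =
      lam hv (i + 1).succ * (lam hv (i + 2).succ * A) := by
    intro i
    have hne : ∀ i : Fin 3, i ≠ i + 1 ∧ i ≠ i + 2 ∧ i + 2 ≠ i + 1 := by decide
    obtain ⟨n1, n2, n3⟩ := hne i
    obtain ⟨B, hB⟩ := lam_dvd_pdot_edge hv (h0 (i + 1).succ i.succ 0
      (fun e => n1 (Fin.succ_injective _ e)) (Fin.succ_ne_zero _).symm)
    have h2 := lam_dvd_pdot_edge hv (h0 (i + 2).succ i.succ 0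
      (fun e => n2 (Fin.succ_injective _ e)) (Fin.succ_ne_zero _).symm)
    rw [hB] at h2
    obtain ⟨A, rfl⟩ := ((prime_lam hv _).dvd_or_dvd h2).resolve_left
      (not_lam_dvd_lam hv fun e => n3 (Fin.succ_injective _ e))
    exact ⟨A, hB⟩
  choose A hA using hA
  have hw' := Pminus1_subset_vecDeg hw
  have hAdeg : ∀ i, A i ∈ polyDeg (m + 1) := by
    intro i
    have h1 := pdot_mem_polyDeg (v i.succ - v 0) hw'
    rw [hA] at h1
    exact mem_polyDeg_of_lam_mul hv (mem_polyDeg_of_lam_mul hv h1 le_rfl) (by linarith)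
  -- Each `A j` has degree at most `m + 1`, but their sum has one degree less: `λ_1 λ_2 λ_3 ∑ A_j =
  -- (x - v_0) · w` has degree at most `m + 3` by `sum_X_mul_mem_polyDeg`.
  have hS : ∑ j, A j ∈ polyDeg m := by
    have h1 : lam hv (Fin.succ 0) * (lam hv (Fin.succ 1) * (lam hv (Fin.succ 2) * ∑ j, A j))
        ∈ polyDeg (m + 3) := by
      have h2 := sum_lam_mul_pdot_edge hv w
      have h3 : ∑ a, X a * w a - pdot (v 0) w ∈ polyDeg (m + 3) :=
        Submodule.sub_mem _ (sum_X_mul_mem_polyDeg hw) (pdot_mem_polyDeg _ hw')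
      rw [← h2] at h3
      convert h3 using 1
      simp only [hA, Fin.sum_univ_three]
      have e1 : (0 : Fin 3) + 1 = 1 := rfl
      have e2 : (0 : Fin 3) + 2 = 2 := rfl
      have e3 : (1 : Fin 3) + 1 = 2 := rfl
      have e4 : (1 : Fin 3) + 2 = 0 := rfl
      have e5 : (2 : Fin 3) + 1 = 0 := rfl
      have e6 : (2 : Fin 3) + 2 = 1 := rfl
      rw [e1, e2, e3, e4, e5, e6]
      ring
    exact mem_polyDeg_of_lam_mul hv (mem_polyDeg_of_lam_mul hv (mem_polyDeg_of_lam_mul hv h1 le_rfl)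
      le_rfl) (by linarith)
  -- On face `0` the component along `v_i - v_j` vanishes. It is the third barycentric coordinate,
  -- prime to `λ_0`, times this difference, up to the order of the factors.
  have hcross : ∀ i j : Fin 3, lam hv 0 ∣ lam hv j.succ * A i - lam hv i.succ * A j := by
    intro i j
    by_cases hij : i = j
    · subst hij; simp
    have h1 := lam_dvd_pdot_edge hv (h0 0 i.succ j.succ (Fin.succ_ne_zero _) (Fin.succ_ne_zero _))
    have h2 : pdot (v i.succ - v j.succ) w = pdot (v i.succ - v 0) w - pdot (v j.succ - v 0) w :=
      MvPolynomial.funext fun x => by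
        simp only [map_sub, eval_pdot, ← sub_dotProduct, sub_sub_sub_cancel_right]
    rw [h2, hA, hA] at h1
    have hd : ∀ i j : Fin 3, i ≠ j → (i + 1 = j ∧ j + 2 = i ∧ i + 2 = j + 1) ∨
        (i + 2 = j ∧ j + 1 = i ∧ i + 1 = j + 2) := by decide
    have hp := prime_lam hv 0
    have hn : ∀ k : Fin 3, ¬ lam hv 0 ∣ lam hv k.succ := fun k =>
      not_lam_dvd_lam hv (Fin.succ_ne_zero k).symm
    rcases hd i j hij with ⟨e1, e2, e3⟩ | ⟨e1, e2, e3⟩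
    · rw [e1, e2, e3] at h1
      have h3 : lam hv 0 ∣ lam hv (j + 1).succ * (lam hv j.succ * A i - lam hv i.succ * A j) := by
        convert h1 using 1; ring
      exact (hp.dvd_or_dvd h3).resolve_left (hn _)
    · rw [e1, e2, e3] at h1
      have h3 : lam hv 0 ∣ lam hv (j + 2).succ * (lam hv j.succ * A i - lam hv i.succ * A j) := by
        convert h1 using 1; ring
      exact (hp.dvd_or_dvd h3).resolve_left (hn _)
  have hsum := sum_lam hv
  rw [Fin.sum_univ_succ] at hsum
  have hq : ∀ i : Fin 3, ∃ q, A i - lam hv i.succ * ∑ j, A j = lam hv 0 * q := by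
    intro i
    have h1 : A i - lam hv i.succ * ∑ j, A j
        = lam hv 0 * A i + ∑ j : Fin 3, (lam hv j.succ * A i - lam hv i.succ * A j) := by
      rw [Finset.sum_sub_distrib, ← Finset.sum_mul, ← Finset.mul_sum]
      linear_combination (-A i) * hsum
    rw [h1]
    exact dvd_add (Dvd.intro _ rfl) (Finset.dvd_sum fun j _ => hcross i j)
  choose q hq using hq
  have hqsum : ∑ j, q j = ∑ j, A j := by
    refine mul_left_cancel₀ (lam_ne_zero hv 0) ?_
    rw [Finset.mul_sum]
    simp only [← hq, Finset.sum_sub_distrib, ← Finset.sum_mul]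
    linear_combination (-∑ j, A j) * hsum
  refine ⟨q, mem_vecDeg.2 fun i => ?_, evalVec_injective fun x => eq_of_dot_edge hv fun i => ?_⟩
  · refine mem_polyDeg_of_lam_mul hv (m := m + 1) (i := 0) ?_ (by linarith)
    rw [← hq]
    exact Submodule.sub_mem _ (hAdeg i) (mul_mem_polyDeg (lam_mem_polyDeg hv _) hS (by linarith))
  · rw [edge_dot_ndBubble, ← eval_pdot, hA, ← map_sum, hqsum]
    have h1 := hq i
    have h2 : A i = lam hv 0 * q i + lam hv i.succ * ∑ j, A j := by rw [← h1]; ring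
    rw [h2]
    simp only [map_mul, map_add]
    ring

/-- The test field that belongs to `ndBubble hv q`. -/
def ndTest (v : Fin 4 → Pt) : VecPoly →ₗ[ℝ] VecPoly where
  toFun q := fun a => ∑ j : Fin 3, C ((v j.succ - v 0) a) * q j
  map_add' p q := by
    funext a
    simp only [Pi.add_apply, mul_add, Finset.sum_add_distrib]
  map_smul' c q := by
    funext a
    simp [Finset.smul_sum]

theorem ndTest_mem (v : Fin 4 → Pt) {m : ℤ} {q : VecPoly} (hq : q ∈ vecDeg m) :
    ndTest v q ∈ vecDeg m :=
  mem_vecDeg.2 fun _ => Submodule.sum_mem _ fun j _ => C_mul_mem_polyDeg _ (mem_vecDeg.1 hq j)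

theorem evalVec_ndTest (q : VecPoly) (x : Pt) : evalVec (ndTest v q) x =
    ∑ j : Fin 3, eval x (q j) • (v j.succ - v 0) := by
  funext a
  simp [evalVec, ndTest, Finset.sum_apply, mul_comm]

/-- The test field is a combination of the edges at `v_0`, so only the edge components of the bubble
enter, and the pairing is a sum of squares whose weights are products of barycentric coordinates. -/
theorem ndBubble_dot_ndTest (q : VecPoly) (x : Pt) :
    evalVec (ndBubble hv q) x ⬝ᵥ evalVec (ndTest v q) x =
      (∑ j : Fin 3, eval x (lam hv 0) * (eval x (lam hv (j + 1).succ) *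
        eval x (lam hv (j + 2).succ) * eval x (q j) ^ 2)) +
      eval x (lam hv (Fin.succ 0)) * eval x (lam hv (Fin.succ 1)) * eval x (lam hv (Fin.succ 2)) *
        (∑ j, eval x (q j)) ^ 2 := by
  rw [evalVec_ndTest, dotProduct_sum]
  simp only [dotProduct_smul, dotProduct_comm _ (v _ - v 0), edge_dot_ndBubble, smul_eq_mul]
  simp only [Fin.sum_univ_three]
  have e1 : (0 : Fin 3) + 1 = 1 := rfl
  have e2 : (0 : Fin 3) + 2 = 2 := rfl
  have e3 : (1 : Fin 3) + 1 = 2 := rfl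
  have e4 : (1 : Fin 3) + 2 = 0 := rfl
  have e5 : (2 : Fin 3) + 1 = 0 := rfl
  have e6 : (2 : Fin 3) + 2 = 1 := rfl
  rw [e1, e2, e3, e4, e5, e6]
  ring

theorem ndBubble_dot_ndTest_nonneg (q : VecPoly) {x : Pt} (hx : x ∈ tet v) :
    0 ≤ evalVec (ndBubble hv q) x ⬝ᵥ evalVec (ndTest v q) x := by
  have hpos := (mem_tet hv).1 hx
  rw [ndBubble_dot_ndTest]
  refine add_nonneg (Finset.sum_nonneg fun j _ => ?_) ?_
  · exact mul_nonneg (hpos _) (mul_nonneg (mul_nonneg (hpos _) (hpos _)) (sq_nonneg _))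
  · exact mul_nonneg (mul_nonneg (mul_nonneg (hpos _) (hpos _)) (hpos _)) (sq_nonneg _)

theorem eq_zero_of_ndBubble_dot_ndTest {q : VecPoly}
    (h : ∀ x ∈ tet v, evalVec (ndBubble hv q) x ⬝ᵥ evalVec (ndTest v q) x = 0) : q = 0 := by
  funext j
  have h1 : lam hv 0 * (lam hv (j + 1).succ * lam hv (j + 2).succ * q j ^ 2) = 0 := by
    refine eq_zero_of_eval_tet hv fun x hx => ?_
    have hpos := (mem_tet hv).1 hx
    have h2 := h x hx
    rw [ndBubble_dot_ndTest] at h2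
    have h3 : ∀ j ∈ Finset.univ, 0 ≤ eval x (lam hv 0) * (eval x (lam hv (j + 1 : Fin 3).succ) *
        eval x (lam hv (j + 2).succ) * eval x (q j) ^ 2) := fun j _ =>
      mul_nonneg (hpos _) (mul_nonneg (mul_nonneg (hpos _) (hpos _)) (sq_nonneg _))
    have h4 := (add_eq_zero_iff_of_nonneg (Finset.sum_nonneg h3)
      (mul_nonneg (mul_nonneg (mul_nonneg (hpos _) (hpos _)) (hpos _)) (sq_nonneg _))).1 h2
    simpa using (Finset.sum_eq_zero_iff_of_nonneg h3).1 h4.1 j (Finset.mem_univ j)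
  simpa [lam_ne_zero] using h1

end MixedElasticity

end

/-! ### Bubble fields on a face -/

noncomputable section

namespace MixedElasticity

open MvPolynomial (C X eval pderiv)

variable {v : Fin 4 → Pt} (hv : AffineIndependent ℝ v)

/-! ### Face fields of the Nédélec type -/

/-- The field `λ_c (λ_a ∇λ_b - λ_b ∇λ_a) p + λ_b (λ_a ∇λ_c - λ_c ∇λ_a) q` of the face with vertices
`a, b, c`. -/
def faceBubble (i : Fin 4) (p q : Poly) : VecPoly := fun e =>
  lam hv (i.succAbove 2) * p * (lam hv (i.succAbove 0) * C (dlam hv (i.succAbove 1) e)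
    - lam hv (i.succAbove 1) * C (dlam hv (i.succAbove 0) e)) +
  lam hv (i.succAbove 1) * q * (lam hv (i.succAbove 0) * C (dlam hv (i.succAbove 2) e)
    - lam hv (i.succAbove 2) * C (dlam hv (i.succAbove 0) e))

theorem evalVec_faceBubble (i : Fin 4) (p q : Poly) (x : Pt) : evalVec (faceBubble hv i p q) x =
    (eval x (lam hv (i.succAbove 2)) * eval x p) •
      (eval x (lam hv (i.succAbove 0)) • dlam hv (i.succAbove 1)
        - eval x (lam hv (i.succAbove 1)) • dlam hv (i.succAbove 0)) +
    (eval x (lam hv (i.succAbove 1)) * eval x q) •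
      (eval x (lam hv (i.succAbove 0)) • dlam hv (i.succAbove 2)
        - eval x (lam hv (i.succAbove 2)) • dlam hv (i.succAbove 0)) := by
  funext e
  simp [evalVec, faceBubble]

theorem faceBubble_dot_edge1 (i : Fin 4) (p q : Poly) (x : Pt) :
    evalVec (faceBubble hv i p q) x ⬝ᵥ (faceVertex v i 1 - faceVertex v i 0) =
      eval x (lam hv (i.succAbove 2)) * ((eval x (lam hv (i.succAbove 0)) +
        eval x (lam hv (i.succAbove 1))) * eval x p + eval x (lam hv (i.succAbove 1)) * eval x q)
      := by
  rw [evalVec_faceBubble]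
  simp only [add_dotProduct, smul_dotProduct, sub_dotProduct, dlam_succAbove_dot_faceEdge,
    smul_eq_mul]
  simp
  ring

theorem faceBubble_dot_edge2 (i : Fin 4) (p q : Poly) (x : Pt) :
    evalVec (faceBubble hv i p q) x ⬝ᵥ (faceVertex v i 2 - faceVertex v i 0) =
      eval x (lam hv (i.succAbove 1)) * (eval x (lam hv (i.succAbove 2)) * eval x p +
        (eval x (lam hv (i.succAbove 0)) + eval x (lam hv (i.succAbove 2))) * eval x q) := by
  rw [evalVec_faceBubble]
  simp only [add_dotProduct, smul_dotProduct, sub_dotProduct, dlam_succAbove_dot_faceEdge,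
    smul_eq_mul]
  simp
  ring

theorem faceBubble_mem_Pminus1 (i : Fin 4) {m : ℤ} {p q : Poly} (hp : p ∈ polyDeg (m - 2))
    (hq : q ∈ polyDeg (m - 2)) : faceBubble hv i p q ∈ Pminus1 m :=
  Pminus1_add (whitney_mem_Pminus1 hv _ _ (mul_mem_polyDeg (lam_mem_polyDeg hv _) hp (by linarith)))
    (whitney_mem_Pminus1 hv _ _ (mul_mem_polyDeg (lam_mem_polyDeg hv _) hq (by linarith)))

/-- Every term contains each of the three barycentric coordinates of face `i` either as a factor or
differentiated. The one that belongs to vertex `j` vanishes on face `j`, and its gradient is normal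
to that face. -/
theorem faceBubble_dot_of_ne {i j : Fin 4} (hij : i ≠ j) (p q : Poly) {x : Pt}
    (hx : x ∈ face v j) {a b : Fin 4} (ha : a ≠ j) (hb : b ≠ j) :
    evalVec (faceBubble hv i p q) x ⬝ᵥ (v a - v b) = 0 := by
  obtain ⟨k, rfl⟩ := Fin.exists_succAbove_eq hij.symm
  have h0 := ((mem_face hv).1 hx).2
  rw [evalVec_faceBubble]
  simp only [add_dotProduct, smul_dotProduct, sub_dotProduct, dlam_dot_edge, smul_eq_mul]
  have ha' : i.succAbove k ≠ a := ha.symm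
  have hb' : i.succAbove k ≠ b := hb.symm
  fin_cases k
  · simp only [Fin.zero_eta] at h0 ha' hb'
    rw [h0, if_neg ha', if_neg hb']
    ring
  · simp only [Fin.mk_one] at h0 ha' hb'
    rw [h0, if_neg ha', if_neg hb']
    ring
  · simp only [Fin.reduceFinMk] at h0 ha' hb'
    rw [h0, if_neg ha', if_neg hb']
    ring

theorem sub_faceVertex_eq {i : Fin 4} {x : Pt} (hx : eval x (lam hv i) = 0) :
    x - faceVertex v i 0 =
      eval x (lam hv (i.succAbove 1)) • (faceVertex v i 1 - faceVertex v i 0)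
      + eval x (lam hv (i.succAbove 2)) • (faceVertex v i 2 - faceVertex v i 0) := by
  have h1 := sum_eval_lam_smul hv x
  have h2 := sum_eval_lam hv x
  rw [Fin.sum_univ_succAbove _ i, hx, Fin.sum_univ_three] at h1 h2
  have h3 : eval x (lam hv (i.succAbove 0)) = 1 - eval x (lam hv (i.succAbove 1))
    - eval x (lam hv (i.succAbove 2)) := by linarith
  rw [h3] at h1
  conv_lhs => rw [← h1]
  simp only [faceVertex]
  module

/-- The triple product of the unit normal with the two edges of a face. -/
def faceTriple (v : Fin 4 → Pt) (i : Fin 4) : ℝ := unitNormal v i ⬝ᵥ faceCross v i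

include hv in
theorem faceTriple_ne_zero (i : Fin 4) : faceTriple v i ≠ 0 := by
  have h := faceCross_dot_self_pos hv i
  rw [faceTriple, unitNormal, smul_dotProduct, smul_eq_mul]
  have h2 := Real.sqrt_pos.2 h
  positivity

theorem cross_unitNormal_dot_edge1 {i : Fin 4} {x : Pt} (hx : eval x (lam hv i) = 0) :
    crossProduct (unitNormal v i) (x - faceVertex v i 0) ⬝ᵥ
      (faceVertex v i 1 - faceVertex v i 0) =
    -(faceTriple v i * eval x (lam hv (i.succAbove 2))) := by
  rw [sub_faceVertex_eq hv hx]
  simp only [faceTriple, faceCross, cross_apply, dotProduct, Fin.sum_univ_three]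
  simp
  ring

theorem cross_unitNormal_dot_edge2 {i : Fin 4} {x : Pt} (hx : eval x (lam hv i) = 0) :
    crossProduct (unitNormal v i) (x - faceVertex v i 0) ⬝ᵥ
      (faceVertex v i 2 - faceVertex v i 0) =
    faceTriple v i * eval x (lam hv (i.succAbove 1)) := by
  rw [sub_faceVertex_eq hv hx]
  simp only [faceTriple, faceCross, cross_apply, dotProduct, Fin.sum_univ_three]
  simp
  ring

theorem cross_dot_self_left (n y : Pt) : crossProduct n y ⬝ᵥ n = 0 := by
  rw [dotProduct_comm, dot_self_cross]

/-- With `κ` the triple product and `y^⊥ = n × (x - a)`, the tangential part of `λ_a ∇λ_b - λ_b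
∇λ_a` on the face is that of `∇λ_b` plus `κ⁻¹ y^⊥`, and the one of `λ_a ∇λ_c - λ_c ∇λ_a` is that of
`∇λ_c` minus `κ⁻¹ y^⊥`. This yields the two witnesses. -/
theorem faceBubble_isFacePminus1 (i : Fin 4) {m : ℤ} {p q : Poly} (hp : p ∈ polyDeg (m - 2))
    (hq : q ∈ polyDeg (m - 2)) :
    IsFacePminus1 v i m fun x => tangPart (unitNormal v i) (evalVec (faceBubble hv i p q) x) := by
  have hp' : lam hv (i.succAbove 2) * p ∈ polyDeg (m - 1) :=
    mul_mem_polyDeg (lam_mem_polyDeg hv _) hp (by linarith)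
  have hq' : lam hv (i.succAbove 1) * q ∈ polyDeg (m - 1) :=
    mul_mem_polyDeg (lam_mem_polyDeg hv _) hq (by linarith)
  have hκ := faceTriple_ne_zero hv i
  refine ⟨pvec (lam hv (i.succAbove 2) * p) (tangPart (unitNormal v i) (dlam hv (i.succAbove 1)))
      + pvec (lam hv (i.succAbove 1) * q) (tangPart (unitNormal v i) (dlam hv (i.succAbove 2))),
    Submodule.add_mem _ (pvec_mem_vecDeg _ hp') (pvec_mem_vecDeg _ hq'),
    C (faceTriple v i)⁻¹ * (lam hv (i.succAbove 2) * p - lam hv (i.succAbove 1) * q),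
    C_mul_mem_polyDeg _ (Submodule.sub_mem _ hp' hq'), fun x _ => ?_, fun x hx => ?_⟩
  · rw [evalVec_add, evalVec_pvec, evalVec_pvec, add_dotProduct, smul_dotProduct, smul_dotProduct,
      tangPart_dot_unitNormal hv, tangPart_dot_unitNormal hv]
    simp
  · have h0 := ((mem_face hv).1 hx).2
    have h2 := sum_eval_lam hv x
    rw [Fin.sum_univ_succAbove _ i, h0, Fin.sum_univ_three] at h2
    have h3 : eval x (lam hv (i.succAbove 0)) = 1 - eval x (lam hv (i.succAbove 1))
      - eval x (lam hv (i.succAbove 2)) := by linarith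
    refine ext_face hv (i := i) ?_ ?_ ?_
    · rw [tangPart_dot_faceEdge, faceBubble_dot_edge1, add_dotProduct, smul_dotProduct,
        cross_unitNormal_dot_edge1 hv h0, evalVec_add, evalVec_pvec, evalVec_pvec, add_dotProduct,
        smul_dotProduct, smul_dotProduct, tangPart_dot_faceEdge, tangPart_dot_faceEdge,
        dlam_succAbove_dot_faceEdge, dlam_succAbove_dot_faceEdge, h3]
      simp
      field_simp
      ring
    · rw [tangPart_dot_faceEdge, faceBubble_dot_edge2, add_dotProduct, smul_dotProduct,
        cross_unitNormal_dot_edge2 hv h0, evalVec_add, evalVec_pvec, evalVec_pvec, add_dotProduct,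
        smul_dotProduct, smul_dotProduct, tangPart_dot_faceEdge, tangPart_dot_faceEdge,
        dlam_succAbove_dot_faceEdge, dlam_succAbove_dot_faceEdge, h3]
      simp
      field_simp
      ring
    · rw [tangPart_dot_unitNormal hv, add_dotProduct, smul_dotProduct, cross_dot_self_left,
        evalVec_add, evalVec_pvec, evalVec_pvec, add_dotProduct, smul_dotProduct, smul_dotProduct,
        tangPart_dot_unitNormal hv, tangPart_dot_unitNormal hv]
      simp

theorem one_le_totalDegree_of_eval_ne {p : Poly} {x y : Pt} (h : eval x p ≠ eval y p) :
    1 ≤ p.totalDegree := by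
  by_contra! h0
  have h1 : p.totalDegree = 0 := by omega
  rw [MvPolynomial.totalDegree_eq_zero_iff_eq_C] at h1
  rw [h1] at h
  simp at h

/-- The tangential components of a face field without edge components are those of a face bubble.
-/
theorem exists_faceBubble {i : Fin 4} {m : ℤ} {u : Pt → Pt} (hu : IsFacePminus1 v i (m + 2) u)
    (h0 : ∀ a b, a ≠ b → ∀ x ∈ segment ℝ (faceVertex v i a) (faceVertex v i b),
      u x ⬝ᵥ (faceVertex v i b - faceVertex v i a) = 0) :
    ∃ p ∈ polyDeg m, ∃ q ∈ polyDeg m, ∀ x ∈ face v i,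
      u x ⬝ᵥ (faceVertex v i 1 - faceVertex v i 0) =
        evalVec (faceBubble hv i p q) x ⬝ᵥ (faceVertex v i 1 - faceVertex v i 0) ∧
      u x ⬝ᵥ (faceVertex v i 2 - faceVertex v i 0) =
        evalVec (faceBubble hv i p q) x ⬝ᵥ (faceVertex v i 2 - faceVertex v i 0) := by
  obtain ⟨w, hw, s, hs, -, hu⟩ := hu
  have hm : m + 2 - 1 = m + 1 := by ring
  rw [hm] at hw hs
  set κ := faceTriple v i
  set La := lam hv (i.succAbove 0) with hLa
  set Lb := lam hv (i.succAbove 1) with hLb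
  set Lc := lam hv (i.succAbove 2) with hLc
  set e1 := faceVertex v i 1 - faceVertex v i 0
  set e2 := faceVertex v i 2 - faceVertex v i 0
  -- Polynomials on the face are represented by polynomials on space that are constant in the
  -- direction from vertex `a` to the opposite vertex `i`. Divisibility on the face then becomes
  -- divisibility in three variables.
  let σ : Poly →ₐ[ℝ] Poly := shift (lam hv i) (v i - v (i.succAbove 0))
  have hσ : ∀ {m : ℤ} {p : Poly}, p ∈ polyDeg m → σ p ∈ polyDeg m := fun hp =>
    shift_mem_polyDeg (lam_mem_polyDeg hv i) _ hp
  let π : Pt → Pt := fun x => x - eval x (lam hv i) • (v i - v (i.succAbove 0))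
  have hσe : ∀ p x, eval x (σ p) = eval (π x) p := fun p x => eval_shift _ _ _ _
  have hn0 : i ≠ i.succAbove 0 := (Fin.succAbove_ne i 0).symm
  have hπi : ∀ x, eval (π x) (lam hv i) = 0 := fun x => by
    rw [eval_lam_shift]; simp [hn0]
  have hπa : ∀ x, eval (π x) La = eval x La + eval x (lam hv i) := fun x => by
    rw [hLa, eval_lam_shift]; simp
  have hπb : ∀ x, eval (π x) Lb = eval x Lb := fun x => by
    rw [hLb, eval_lam_shift]; simp
  have hπc : ∀ x, eval (π x) Lc = eval x Lc := fun x => by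
    rw [hLc, eval_lam_shift]; simp
  -- The coordinate of vertex `a` after the projection. The identity `ℓ + Lb + Lc = 1` holds
  -- everywhere and not just on the face.
  let ℓ : Poly := La + lam hv i
  have hsum : ℓ + Lb + Lc = 1 := by
    have := sum_lam hv
    rw [Fin.sum_univ_succAbove _ i, Fin.sum_univ_three] at this
    rw [← this]
    simp only [ℓ, hLa, hLb, hLc]
    ring
  have hLbd : Lb ∈ polyDeg 1 := lam_mem_polyDeg hv _
  have hLcd : Lc ∈ polyDeg 1 := lam_mem_polyDeg hv _
  -- The edge components of `u` on the face, extended constantly along the direction of the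
  -- projection.
  let U1 : Poly := σ (pdot e1 w) - C κ * (Lc * σ s)
  let U2 : Poly := σ (pdot e2 w) + C κ * (Lb * σ s)
  have hwe1 := pdot_mem_polyDeg e1 hw
  have hwe2 := pdot_mem_polyDeg e2 hw
  have hU1d : U1 ∈ polyDeg (m + 2) :=
    Submodule.sub_mem _ (polyDeg_mono (by linarith) (hσ hwe1))
      (C_mul_mem_polyDeg _ (mul_mem_polyDeg hLcd (hσ hs) (by linarith)))
  have hU2d : U2 ∈ polyDeg (m + 2) :=
    Submodule.add_mem _ (polyDeg_mono (by linarith) (hσ hwe2))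
      (C_mul_mem_polyDeg _ (mul_mem_polyDeg hLbd (hσ hs) (by linarith)))
  have hππ : ∀ x, π (π x) = π x := fun x => by
    change π x - eval (π x) (lam hv i) • _ = π x
    rw [hπi, zero_smul, sub_zero]
  have hπid : ∀ x, eval x (lam hv i) = 0 → π x = x := fun x hx => by
    change x - eval x (lam hv i) • _ = x
    rw [hx, zero_smul, sub_zero]
  have hU1π : ∀ x, eval x U1 = eval (π x) U1 := fun x => by
    simp only [U1, map_sub, map_mul, hσe, hππ, hπc, MvPolynomial.eval_C]
  have hU2π : ∀ x, eval x U2 = eval (π x) U2 := fun x => by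
    simp only [U2, map_add, map_mul, hσe, hππ, hπb, MvPolynomial.eval_C]
  have hU1 : ∀ x ∈ face v i, u x ⬝ᵥ e1 = eval x U1 := fun x hx => by
    have hx0 := ((mem_face hv).1 hx).2
    rw [hu x hx, add_dotProduct, smul_dotProduct, cross_unitNormal_dot_edge1 hv hx0]
    simp only [U1, map_sub, map_mul, hσe, hπid x hx0, MvPolynomial.eval_C, eval_pdot,
      dotProduct_comm e1, smul_eq_mul]
    ring
  have hU2 : ∀ x ∈ face v i, u x ⬝ᵥ e2 = eval x U2 := fun x hx => by
    have hx0 := ((mem_face hv).1 hx).2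
    rw [hu x hx, add_dotProduct, smul_dotProduct, cross_unitNormal_dot_edge2 hv hx0]
    simp only [U2, map_add, map_mul, hσe, hπid x hx0, MvPolynomial.eval_C, eval_pdot,
      dotProduct_comm e2, smul_eq_mul]
    ring
  have hinj : Function.Injective i.succAbove := Fin.succAbove_right_injective
  -- a polynomial that vanishes on the edge `a b` of the face vanishes on the line through `a`, `b`
  have hline : ∀ (a b c : Fin 3), a ≠ b → c ≠ a → c ≠ b → ∀ p : Poly,
      (∀ x ∈ segment ℝ (faceVertex v i a) (faceVertex v i b), x ∈ face v i → eval x p = 0) →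
      ∀ x, eval x (lam hv i) = 0 → eval x (lam hv (i.succAbove c)) = 0 → eval x p = 0 := by
    intro a b c hab hca hcb p hp x hxi hxc
    have hout : ∀ j, j ∉ ({i.succAbove a, i.succAbove b} : Finset (Fin 4)) →
        j = i ∨ j = i.succAbove c := by
      intro j hj
      rcases eq_or_ne j i with rfl | hji
      · exact Or.inl rfl
      · right
        obtain ⟨d, rfl⟩ := Fin.exists_succAbove_eq hji
        have : d ≠ a ∧ d ≠ b := by
          simpa [hinj.eq_iff] using hj
        have hd : ∀ a b c d : Fin 3, a ≠ b → c ≠ a → c ≠ b → d ≠ a → d ≠ b → d = c := by decide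
        rw [hd a b c d hab hca hcb this.1 this.2]
    refine eval_eq_zero_of_subsimplex hv (S := {i.succAbove a, i.succAbove b})
      ⟨_, Finset.mem_insert_self _ _⟩ (fun y hy hy0 => ?_) ?_
    · have hyi : eval y (lam hv i) = 0 := by
        refine hy0 i ?_
        simp [(Fin.succAbove_ne i _).symm]
      refine hp y ((mem_segment_vertex hv (hinj.ne hab)).2 ⟨hy, fun k hka hkb => ?_⟩)
        ((mem_face hv).2 ⟨hy, hyi⟩)
      exact hy0 k (by simp [hka, hkb])
    · intro j hj
      rcases hout j hj with rfl | rfl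
      · exact hxi
      · exact hxc
  obtain ⟨A, hA⟩ : Lc ∣ U1 := by
    refine lam_dvd_of_eval hv fun x hx => ?_
    rw [hU1π]
    refine hline 0 1 2 (by decide) (by decide) (by decide) U1 (fun y hy hyF => ?_) _ (hπi x)
      ((hπc x).trans hx)
    rw [← hU1 y hyF]
    exact h0 0 1 (by decide) y hy
  obtain ⟨B, hB⟩ : Lb ∣ U2 := by
    refine lam_dvd_of_eval hv fun x hx => ?_
    rw [hU2π]
    refine hline 0 2 1 (by decide) (by decide) (by decide) U2 (fun y hy hyF => ?_) _ (hπi x)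
      ((hπb x).trans hx)
    rw [← hU2 y hyF]
    exact h0 0 2 (by decide) y hy
  -- On the third edge the field has no component along `e1 - e2`, so there the two components
  -- agree.
  obtain ⟨R, hR⟩ : ℓ ∣ U1 - U2 := by
    refine dvd_of_eval (e := v (i.succAbove 0) - v (i.succAbove 1)) (fun x => ?_) fun x hx => ?_
    · simp only [ℓ, hLa, map_add, eval_lam_shift]
      simp [hn0, (Fin.succAbove_ne i _).symm]
    · rw [map_sub, hU1π, hU2π, ← map_sub]
      refine hline 1 2 0 (by decide) (by decide) (by decide) _ (fun y hy hyF => ?_) _ (hπi x) ?_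
      · rw [map_sub, ← hU1 y hyF, ← hU2 y hyF, ← dotProduct_sub]
        have h3 := h0 1 2 (by decide) y hy
        have h4 : e1 - e2 = -(faceVertex v i 2 - faceVertex v i 1) := by
          simp only [e1, e2]; abel
        rw [h4, dotProduct_neg, h3, neg_zero]
      · rw [← hLa, hπa, ← map_add]
        exact hx
  have hAd : A ∈ polyDeg (m + 1) := by
    rw [hA] at hU1d
    exact mem_polyDeg_of_lam_mul hv hU1d (by linarith)
  have hBd : B ∈ polyDeg (m + 1) := by
    rw [hB] at hU2d
    exact mem_polyDeg_of_lam_mul hv hU2d (by linarith)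
  -- In `Lb U1 + Lc U2` the terms with `s` cancel, because `y^⊥` is orthogonal to the position
  -- vector `y`. The sum has degree at most `m + 2` instead of `m + 3`.
  have hSd : A + B ∈ polyDeg m := by
    have h1 : Lb * U1 + Lc * U2 = Lb * σ (pdot e1 w) + Lc * σ (pdot e2 w) := by
      simp only [U1, U2]; ring
    have h2 : Lb * (Lc * (A + B)) ∈ polyDeg (m + 2) := by
      have h3 : Lb * (Lc * (A + B)) = Lb * σ (pdot e1 w) + Lc * σ (pdot e2 w) := by
        rw [← h1, hA, hB]; ring
      rw [h3]
      exact Submodule.add_mem _ (mul_mem_polyDeg hLbd (hσ hwe1) (by linarith))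
        (mul_mem_polyDeg hLcd (hσ hwe2) (by linarith))
    exact mem_polyDeg_of_lam_mul hv (mem_polyDeg_of_lam_mul hv h2 le_rfl) (by linarith)
  have hℓ : 1 ≤ ℓ.totalDegree := by
    refine one_le_totalDegree_of_eval_ne (x := v (i.succAbove 0)) (y := v (i.succAbove 1)) ?_
    simp [ℓ, hLa, eval_lam_vertex, (Fin.succAbove_ne i _).symm]
  have hℓ0 : ℓ ≠ 0 := by
    intro h; rw [h] at hℓ; simp at hℓ
  have hdeg : ∀ q : Poly, ℓ * q ∈ polyDeg (m + 1) → q ∈ polyDeg m := fun q hq =>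
    polyDeg_mono (by linarith) (mem_polyDeg_of_mul (n := 1) hℓ0 (by exact_mod_cast hℓ) hq)
  -- The required equations are `A = ℓ p + Lb (p + q)` and `B = ℓ q + Lc (p + q)`; adding them gives
  -- `p + q = A + B`. The quotients by `ℓ` are `p = R + A` and `q = B - R`.
  have hp : ℓ * (R + A) = A - Lb * (A + B) := by
    linear_combination A * hsum - hR + hA - hB
  have hq : ℓ * (B - R) = B - Lc * (A + B) := by
    linear_combination B * hsum + hR - hA + hB
  refine ⟨R + A, hdeg _ ?_, B - R, hdeg _ ?_, fun x hx => ?_⟩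
  · rw [hp]
    exact Submodule.sub_mem _ hAd (mul_mem_polyDeg hLbd hSd (by linarith))
  · rw [hq]
    exact Submodule.sub_mem _ hBd (mul_mem_polyDeg hLcd hSd (by linarith))
  · have hx0 := ((mem_face hv).1 hx).2
    have hLe : eval x La = eval x ℓ := by simp [ℓ, hx0]
    have hp' := congrArg (eval x) hp
    have hq' := congrArg (eval x) hq
    simp only [map_mul, map_add, map_sub] at hp' hq'
    rw [hU1 x hx, hU2 x hx, faceBubble_dot_edge1, faceBubble_dot_edge2, hA, hB, ← hLa, ← hLb, ← hLc,
      hLe]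
    simp only [map_mul, map_add, map_sub]
    exact ⟨by linear_combination (-eval x Lc) * hp', by linear_combination (-eval x Lb) * hq'⟩

/-- In this shape the form is visibly symmetric and, on the tetrahedron, positive semidefinite: it
is a combination of the products for `p`, for `q` and for `p + q` with weights that are products of
barycentric coordinates. -/
theorem faceBubble_form (i : Fin 4) (p q p' q' : Poly) (x : Pt) :
    evalVec (faceBubble hv i p q) x ⬝ᵥ (faceVertex v i 1 - faceVertex v i 0) * eval x p' +
    evalVec (faceBubble hv i p q) x ⬝ᵥ (faceVertex v i 2 - faceVertex v i 0) * eval x q' =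
    eval x (lam hv (i.succAbove 2)) * eval x (lam hv (i.succAbove 0)) * (eval x p * eval x p') +
    eval x (lam hv (i.succAbove 1)) * eval x (lam hv (i.succAbove 0)) * (eval x q * eval x q') +
    eval x (lam hv (i.succAbove 2)) * eval x (lam hv (i.succAbove 1)) *
      ((eval x p + eval x q) * (eval x p' + eval x q')) := by
  rw [faceBubble_dot_edge1, faceBubble_dot_edge2]
  ring

theorem faceBubble_form_nonneg (i : Fin 4) (p q : Poly) {x : Pt} (hx : x ∈ tet v) :
    0 ≤ evalVec (faceBubble hv i p q) x ⬝ᵥ (faceVertex v i 1 - faceVertex v i 0) * eval x p +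
      evalVec (faceBubble hv i p q) x ⬝ᵥ (faceVertex v i 2 - faceVertex v i 0) * eval x q := by
  have hpos := (mem_tet hv).1 hx
  rw [faceBubble_form]
  exact add_nonneg (add_nonneg (mul_nonneg (mul_nonneg (hpos _) (hpos _)) (mul_self_nonneg _))
    (mul_nonneg (mul_nonneg (hpos _) (hpos _)) (mul_self_nonneg _)))
    (mul_nonneg (mul_nonneg (hpos _) (hpos _)) (mul_self_nonneg _))

/-- The polynomial `λ_i` is prime and divides neither `λ_j` nor `λ_k`, so it divides `p`. -/
theorem eq_zero_on_face_of_mul {i j k : Fin 4} (hj : j ≠ i) (hk : k ≠ i) {p : Poly}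
    (h : ∀ x ∈ face v i, eval x (lam hv j) * eval x (lam hv k) * (eval x p * eval x p) = 0) :
    ∀ x ∈ face v i, eval x p = 0 := by
  have h1 : lam hv i ∣ lam hv j * lam hv k * (p * p) :=
    lam_dvd_of_face hv fun x hx => by simpa only [map_mul] using h x hx
  have hp := prime_lam hv i
  have h2 : lam hv i ∣ p := by
    rcases hp.dvd_or_dvd h1 with h1 | h1
    · rcases hp.dvd_or_dvd h1 with h1 | h1
      · exact absurd h1 (not_lam_dvd_lam hv hj.symm)
      · exact absurd h1 (not_lam_dvd_lam hv hk.symm)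
    · exact (hp.dvd_or_dvd h1).elim id id
  exact fun x hx => (lam_dvd_iff_eval hv).1 h2 x ((mem_face hv).1 hx).2

theorem faceBubble_form_eq_zero {i : Fin 4} {p q : Poly} (h : ∀ x ∈ face v i,
    evalVec (faceBubble hv i p q) x ⬝ᵥ (faceVertex v i 1 - faceVertex v i 0) * eval x p +
      evalVec (faceBubble hv i p q) x ⬝ᵥ (faceVertex v i 2 - faceVertex v i 0) * eval x q = 0) :
    (∀ x ∈ face v i, eval x p = 0) ∧ ∀ x ∈ face v i, eval x q = 0 := by
  simp only [faceBubble_form] at h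
  have key : ∀ x ∈ face v i,
      eval x (lam hv (i.succAbove 2)) * eval x (lam hv (i.succAbove 0)) * (eval x p * eval x p) = 0
      ∧ eval x (lam hv (i.succAbove 1)) * eval x (lam hv (i.succAbove 0)) *
        (eval x q * eval x q) = 0 := by
    intro x hx
    have hpos := (mem_tet hv).1 (face_subset_tet i hx)
    have n1 := mul_nonneg (mul_nonneg (hpos (i.succAbove 2)) (hpos (i.succAbove 0)))
      (mul_self_nonneg (eval x p))
    have n2 := mul_nonneg (mul_nonneg (hpos (i.succAbove 1)) (hpos (i.succAbove 0)))
      (mul_self_nonneg (eval x q))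
    have n3 := mul_nonneg (mul_nonneg (hpos (i.succAbove 2)) (hpos (i.succAbove 1)))
      (mul_self_nonneg (eval x p + eval x q))
    have h1 := h x hx
    constructor <;> linarith
  exact ⟨eq_zero_on_face_of_mul hv (Fin.succAbove_ne i _) (Fin.succAbove_ne i _)
      fun x hx => (key x hx).1,
    eq_zero_on_face_of_mul hv (Fin.succAbove_ne i _) (Fin.succAbove_ne i _)
      fun x hx => (key x hx).2⟩

theorem dot_edges_eq_zero_of_form {i : Fin 4} {p q : Poly}
    (h : ∀ x ∈ face v i, eval x p = 0 ∧ eval x q = 0) {x : Pt} (hx : x ∈ face v i) :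
    evalVec (faceBubble hv i p q) x ⬝ᵥ (faceVertex v i 1 - faceVertex v i 0) = 0 ∧
      evalVec (faceBubble hv i p q) x ⬝ᵥ (faceVertex v i 2 - faceVertex v i 0) = 0 := by
  rw [faceBubble_dot_edge1, faceBubble_dot_edge2, (h x hx).1, (h x hx).2]
  simp

end MixedElasticity

end

/-! ### Integration over the tetrahedron and its faces -/

noncomputable section

namespace MixedElasticity

open MvPolynomial (C X eval pderiv)

variable {v : Fin 4 → Pt} (hv : AffineIndependent ℝ v)

/-! ### Integrals over the tetrahedron -/

instance : IsFiniteMeasure (volume.restrict (tet v)) :=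
  ⟨by rw [Measure.restrict_apply_univ]; exact isCompact_tet.measure_lt_top⟩

theorem measurableSet_tet : MeasurableSet (tet v) := isCompact_tet.measurableSet

theorem integrable_tet {f : Pt → ℝ} (hf : Continuous f) : Integrable f (volume.restrict (tet v)) :=
  hf.continuousOn.integrableOn_compact isCompact_tet

theorem memLp_tet {f : Pt → ℝ} (hf : Continuous f) : MemLp f 2 (volume.restrict (tet v)) := by
  obtain ⟨K, hK⟩ := isCompact_tet.exists_bound_of_continuousOn hf.continuousOn (s := tet v)
  exact MemLp.of_bound hf.aestronglyMeasurable K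
    ((ae_restrict_iff' measurableSet_tet).2 (ae_of_all _ hK))

include hv in
theorem interior_tet_nonempty : (interior (tet v)).Nonempty := by
  refine ⟨Finset.univ.centroid ℝ v, (mem_interior_tet hv).2 fun i => ?_⟩
  have : eval (Finset.univ.centroid ℝ v) (lam hv i)
      = (simplexBasis hv).coord i (Finset.univ.centroid ℝ (simplexBasis hv)) := eval_lam hv i _
  rw [this, (simplexBasis hv).coord_apply_centroid (Finset.mem_univ i)]
  simp

include hv in
theorem tet_subset_closure_interior : tet v ⊆ closure (interior (tet v)) := by
  rw [convex_tet.closure_interior_eq_closure_of_nonempty_interior (interior_tet_nonempty hv)]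
  exact subset_closure

include hv in
theorem eq_zero_of_integral_tet {f : Pt → ℝ} (hf : Continuous f) (h0 : ∀ x ∈ tet v, 0 ≤ f x)
    (h : ∫ x in tet v, f x = 0) : ∀ x ∈ tet v, f x = 0 := by
  rw [setIntegral_eq_zero_iff_of_nonneg_ae
    ((ae_restrict_iff' measurableSet_tet).2 (ae_of_all _ h0)) (integrable_tet hf)] at h
  exact Measure.eqOn_of_ae_eq h hf.continuousOn continuousOn_const (tet_subset_closure_interior hv)

theorem ae_mem_interior_tet : ∀ᵐ x ∂(volume.restrict (tet v)), x ∈ interior (tet v) := by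
  rw [ae_restrict_iff' measurableSet_tet]
  have h : volume (frontier (tet v)) = 0 := convex_tet.addHaar_frontier volume
  filter_upwards [compl_mem_ae_iff.2 h] with x hx hxT
  by_contra hxi
  exact hx ⟨subset_closure hxT, hxi⟩

/-! ### Integrals over the faces -/

/-- The reference triangle. -/
def refTriangle : Set (ℝ × ℝ) := {s | 0 ≤ s.1 ∧ 0 ≤ s.2 ∧ s.1 + s.2 ≤ 1}

/-- The affine parametrization of a face over the reference triangle. -/
def faceParam (v : Fin 4 → Pt) (i : Fin 4) (s : ℝ × ℝ) : Pt :=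
  faceVertex v i 0 + s.1 • (faceVertex v i 1 - faceVertex v i 0)
    + s.2 • (faceVertex v i 2 - faceVertex v i 0)

theorem continuous_faceParam (i : Fin 4) : Continuous (faceParam v i) := by
  unfold faceParam
  fun_prop

theorem faceMeasure_eq (i : Fin 4) : faceMeasure v i =
    ENNReal.ofReal (Real.sqrt (faceCross v i ⬝ᵥ faceCross v i)) •
      Measure.map (faceParam v i) (volume.restrict refTriangle) := rfl

theorem isCompact_refTriangle : IsCompact refTriangle := by
  refine Metric.isCompact_of_isClosed_isBounded ?_ ?_
  · exact (isClosed_le continuous_const continuous_fst).inter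
      ((isClosed_le continuous_const continuous_snd).inter
        (isClosed_le (continuous_fst.add continuous_snd) continuous_const))
  · refine (Metric.isBounded_Icc (0 : ℝ × ℝ) (1, 1)).subset fun s hs => ?_
    obtain ⟨h1, h2, h3⟩ := hs
    exact ⟨⟨h1, h2⟩, ⟨by simp; linarith, by simp; linarith⟩⟩

theorem refTriangle_subset_closure_interior : refTriangle ⊆ closure (interior refTriangle) := by
  have hconv : Convex ℝ refTriangle := by
    rintro s ⟨h1, h2, h3⟩ t ⟨h4, h5, h6⟩ a b ha hb hab
    refine ⟨?_, ?_, ?_⟩ <;> simp only [Prod.fst_add, Prod.snd_add, Prod.smul_fst, Prod.smul_snd,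
      smul_eq_mul]
    · positivity
    · positivity
    · nlinarith
  have hne : (interior refTriangle).Nonempty := by
    refine ⟨(1 / 4, 1 / 4), mem_interior.2 ⟨{s | 0 < s.1 ∧ 0 < s.2 ∧ s.1 + s.2 < 1},
      fun s hs => ⟨hs.1.le, hs.2.1.le, hs.2.2.le⟩, ?_, by norm_num⟩⟩
    exact (isOpen_lt continuous_const continuous_fst).inter
      ((isOpen_lt continuous_const continuous_snd).inter
        (isOpen_lt (continuous_fst.add continuous_snd) continuous_const))
  rw [hconv.closure_interior_eq_closure_of_nonempty_interior hne]
  exact subset_closure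

instance : IsFiniteMeasure (volume.restrict refTriangle) :=
  ⟨by rw [Measure.restrict_apply_univ]; exact isCompact_refTriangle.measure_lt_top⟩

instance (i : Fin 4) : IsFiniteMeasure (faceMeasure v i) := by
  have : IsFiniteMeasure (Measure.map (faceParam v i) (volume.restrict refTriangle)) :=
    inferInstance
  rw [faceMeasure_eq]
  exact Measure.smul_finite _ ENNReal.ofReal_ne_top

theorem faceParam_mem_face {i : Fin 4} {s : ℝ × ℝ} (hs : s ∈ refTriangle) :
    faceParam v i s ∈ face v i := by
  obtain ⟨h1, h2, h3⟩ := hs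
  have h : faceParam v i s = ∑ a : Fin 3, ![1 - s.1 - s.2, s.1, s.2] a • faceVertex v i a := by
    simp [faceParam, Fin.sum_univ_three]
    module
  rw [h]
  refine (convex_convexHull ℝ _).sum_mem (fun a _ => ?_) ?_
    fun a _ => subset_convexHull ℝ _ (Set.mem_range_self a)
  · fin_cases a
    · simp; linarith
    · exact h1
    · exact h2
  · simp [Fin.sum_univ_three]
    ring

include hv in
theorem exists_faceParam_eq {i : Fin 4} {x : Pt} (hx : x ∈ face v i) :
    ∃ s ∈ refTriangle, faceParam v i s = x := by
  have hx0 := ((mem_face hv).1 hx).2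
  have hpos := (mem_tet hv).1 ((mem_face hv).1 hx).1
  have h2 := sum_eval_lam hv x
  rw [Fin.sum_univ_succAbove _ i, hx0, Fin.sum_univ_three] at h2
  refine ⟨(eval x (lam hv (i.succAbove 1)), eval x (lam hv (i.succAbove 2))),
    ⟨hpos _, hpos _, ?_⟩, ?_⟩
  · have := hpos (i.succAbove 0)
    simp only
    linarith
  · rw [faceParam, add_assoc, ← sub_faceVertex_eq hv hx0, add_sub_cancel]

theorem ae_mem_face (i : Fin 4) : ∀ᵐ x ∂(faceMeasure v i), x ∈ face v i := by
  rw [faceMeasure_eq]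
  refine Measure.ae_smul_measure ?_ _
  rw [ae_map_iff (p := fun x => x ∈ face v i) (continuous_faceParam i).aemeasurable
    (isCompact_face i).measurableSet]
  exact (ae_restrict_iff' isCompact_refTriangle.measurableSet).2
    (ae_of_all _ fun s hs => faceParam_mem_face hs)

theorem memLp_face {f : Pt → ℝ} (hf : Continuous f) (i : Fin 4) : MemLp f 2 (faceMeasure v i) := by
  obtain ⟨K, hK⟩ := (isCompact_face i).exists_bound_of_continuousOn hf.continuousOn (s := face v i)
  exact MemLp.of_bound hf.aestronglyMeasurable K ((ae_mem_face i).mono hK)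

theorem integrable_face {f : Pt → ℝ} (hf : Continuous f) (i : Fin 4) :
    Integrable f (faceMeasure v i) :=
  (memLp_face hf i).integrable one_le_two

include hv in
-- After the pullback to the reference triangle, which lies in the closure of its interior,
-- continuity turns equality almost everywhere into equality.
theorem eqOn_face_of_ae {f g : Pt → ℝ} (hf : Continuous f) (hg : Continuous g) {i : Fin 4}
    (h : f =ᵐ[faceMeasure v i] g) : Set.EqOn f g (face v i) := by
  have hc : ENNReal.ofReal (Real.sqrt (faceCross v i ⬝ᵥ faceCross v i)) ≠ 0 := by
    simpa using faceCross_dot_self_pos hv i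
  rw [faceMeasure_eq, Filter.EventuallyEq, Measure.ae_ennreal_smul_measure_eq hc,
    ae_map_iff (continuous_faceParam i).aemeasurable
      (measurableSet_eq_fun hf.measurable hg.measurable)] at h
  have h2 := Measure.eqOn_of_ae_eq (f := fun s => f (faceParam v i s))
    (g := fun s => g (faceParam v i s)) h (hf.comp (continuous_faceParam i)).continuousOn
    (hg.comp (continuous_faceParam i)).continuousOn refTriangle_subset_closure_interior
  intro x hx
  obtain ⟨s, hs, rfl⟩ := exists_faceParam_eq hv hx
  exact h2 hs

include hv in
theorem eq_zero_of_integral_face {f : Pt → ℝ} (hf : Continuous f) {i : Fin 4}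
    (h0 : ∀ x ∈ face v i, 0 ≤ f x) (h : ∫ x, f x ∂(faceMeasure v i) = 0) :
    ∀ x ∈ face v i, f x = 0 := by
  rw [integral_eq_zero_iff_of_nonneg_ae ((ae_mem_face i).mono h0) (integrable_face hf i)] at h
  exact eqOn_face_of_ae hv hf continuous_const h

/-! ### Integration by parts for fields without normal component -/

/-- The divergence of a polynomial vector field. -/
def pdiv (u : VecPoly) : Poly := ∑ a, pderiv a (u a)

/-- A smooth step from `0` on `(-∞, 1]` to `1` on `[2, ∞)`. -/
def smoothStep (y : ℝ) : ℝ := Real.smoothTransition (y - 1)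

theorem contDiff_smoothStep : ContDiff ℝ ∞ smoothStep :=
  Real.smoothTransition.contDiff.comp (contDiff_id.sub contDiff_const)

theorem smoothStep_of_le_one {y : ℝ} (hy : y ≤ 1) : smoothStep y = 0 :=
  Real.smoothTransition.zero_of_nonpos (by linarith)

theorem smoothStep_of_two_le {y : ℝ} (hy : 2 ≤ y) : smoothStep y = 1 :=
  Real.smoothTransition.one_of_one_le (by linarith)

theorem abs_smoothStep_le_one (y : ℝ) : |smoothStep y| ≤ 1 :=
  abs_le.2 ⟨neg_one_lt_zero.le.trans (Real.smoothTransition.nonneg _), Real.smoothTransition.le_one _⟩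

theorem hasDerivAt_smoothStep (y : ℝ) : HasDerivAt smoothStep (deriv smoothStep y) y :=
  ((contDiff_smoothStep.differentiable (by simp)) y).hasDerivAt

theorem deriv_smoothStep_of_two_lt {y : ℝ} (hy : 2 < y) : deriv smoothStep y = 0 := by
  have h : smoothStep =ᶠ[𝓝 y] fun _ => 1 := by
    filter_upwards [lt_mem_nhds hy] with z hz
    exact smoothStep_of_two_le hz.le
  rw [h.deriv_eq, deriv_const]

/-- The derivative of the cutoff at scale `N` carries a factor `N`. This bound shows that one factor
`λ_i` of the field compensates it, uniformly in `N`. -/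
theorem exists_bound_mul_deriv_smoothStep :
    ∃ K, ∀ y, 0 ≤ y → |y * deriv smoothStep y| ≤ K := by
  have hc : Continuous fun y => y * deriv smoothStep y :=
    continuous_id.mul (contDiff_smoothStep.continuous_deriv (by simp))
  obtain ⟨K, hK⟩ := isCompact_Icc.exists_bound_of_continuousOn hc.continuousOn
    (s := Set.Icc (0 : ℝ) 2)
  refine ⟨K, fun y hy => ?_⟩
  rcases le_or_gt y 2 with h | h
  · exact hK y ⟨hy, h⟩
  · rw [deriv_smoothStep_of_two_lt h, mul_zero, abs_zero]
    exact (norm_nonneg _).trans (hK 0 ⟨le_rfl, by norm_num⟩)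

/-- A smooth function supported in the tetrahedron; it tends to one in the interior. -/
def cutoff (N : ℝ) (x : Pt) : ℝ := ∏ i, smoothStep (N * eval x (lam hv i))

theorem contDiff_cutoff (N : ℝ) : ContDiff ℝ ∞ (cutoff hv N) :=
  contDiff_prod fun _ _ => contDiff_smoothStep.comp (contDiff_const.mul (contDiff_eval _))

theorem cutoff_eq_zero {N : ℝ} (hN : 0 ≤ N) {x : Pt} (hx : x ∉ tet v) : cutoff hv N x = 0 := by
  rw [mem_tet hv] at hx
  push Not at hx
  obtain ⟨i, hi⟩ := hx
  refine Finset.prod_eq_zero (Finset.mem_univ i) (smoothStep_of_le_one ?_)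
  nlinarith

theorem hasCompactSupport_cutoff {N : ℝ} (hN : 0 ≤ N) : HasCompactSupport (cutoff hv N) :=
  HasCompactSupport.intro isCompact_tet fun _ hx => cutoff_eq_zero hv hN hx

theorem fderiv_lam (i : Fin 4) (x y : Pt) :
    fderiv ℝ (fun x : Pt => eval x (lam hv i)) x y = dlam hv i ⬝ᵥ y := by
  rw [(hasFDerivAt_eval _ x).fderiv]
  simp [pderiv_lam, dotProduct]

theorem fderiv_cutoff (N : ℝ) (x y : Pt) : fderiv ℝ (cutoff hv N) x y =
    ∑ i, (∏ j ∈ Finset.univ.erase i, smoothStep (N * eval x (lam hv j))) *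
      (deriv smoothStep (N * eval x (lam hv i)) * (N * (dlam hv i ⬝ᵥ y))) := by
  have h : ∀ i ∈ Finset.univ, HasFDerivAt (fun x : Pt => smoothStep (N * eval x (lam hv i)))
      (deriv smoothStep (N * eval x (lam hv i)) •
        (N • fderiv ℝ (fun x : Pt => eval x (lam hv i)) x)) x := fun i _ =>
    (hasDerivAt_smoothStep _).comp_hasFDerivAt x
      (((hasFDerivAt_eval (lam hv i) x).differentiableAt.hasFDerivAt).const_mul N)
  have h2 := HasFDerivAt.finsetProd h
  have h3 : HasFDerivAt (cutoff hv N) _ x := h2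
  rw [h3.fderiv]
  simp [fderiv_lam]

theorem integral_fderiv_mul_eq {θ : Pt → ℝ} (hθ : ContDiff ℝ ∞ θ) (hc : HasCompactSupport θ)
    {g : Pt → ℝ} (hg : ContDiff ℝ ∞ g) (y : Pt) :
    ∫ x, θ x * fderiv ℝ g x y = - ∫ x, fderiv ℝ θ x y * g x := by
  have c1 : Continuous fun x => fderiv ℝ θ x y :=
    (hθ.continuous_fderiv (by simp)).clm_apply continuous_const
  have c2 : Continuous fun x => fderiv ℝ g x y :=
    (hg.continuous_fderiv (by simp)).clm_apply continuous_const
  refine integral_mul_fderiv_eq_neg_fderiv_mul_of_integrable ?_ ?_ ?_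
    (fun x _ => hθ.differentiable (by simp) x) (fun x _ => hg.differentiable (by simp) x)
  · exact (c1.mul hg.continuous).integrable_of_hasCompactSupport (hc.fderiv_apply ℝ y).mul_right
  · exact (hθ.continuous.mul c2).integrable_of_hasCompactSupport hc.mul_right
  · exact (hθ.continuous.mul hg.continuous).integrable_of_hasCompactSupport hc.mul_right

theorem integral_cutoff_mul_pdiv {N : ℝ} (hN : 0 ≤ N) (u : VecPoly) :
    ∫ x in tet v, (cutoff hv N x * eval x (pdiv u) + fderiv ℝ (cutoff hv N) x (evalVec u x)) = 0
    := by
  have hθ := contDiff_cutoff hv N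
  have hc := hasCompactSupport_cutoff hv hN
  have c1 : ∀ y, Continuous fun x => fderiv ℝ (cutoff hv N) x y := fun y =>
    (hθ.continuous_fderiv (by simp)).clm_apply continuous_const
  have key : ∀ a : Fin 3, ∫ x, (cutoff hv N x * eval x (pderiv a (u a)) +
      fderiv ℝ (cutoff hv N) x (Pi.single a 1) * eval x (u a)) = 0 := by
    intro a
    have h := integral_fderiv_mul_eq hθ hc (contDiff_eval (u a)) (Pi.single a 1)
    simp only [fderiv_eval] at h
    rw [integral_add, h, neg_add_cancel]
    · exact (hθ.continuous.mul (continuous_eval _)).integrable_of_hasCompactSupport hc.mul_right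
    · exact ((c1 _).mul (continuous_eval _)).integrable_of_hasCompactSupport
        (hc.fderiv_apply ℝ _).mul_right
  have hsum : ∀ x, cutoff hv N x * eval x (pdiv u) + fderiv ℝ (cutoff hv N) x (evalVec u x) =
      ∑ a, (cutoff hv N x * eval x (pderiv a (u a)) +
        fderiv ℝ (cutoff hv N) x (Pi.single a 1) * eval x (u a)) := by
    intro x
    rw [Finset.sum_add_distrib, ← Finset.mul_sum, pdiv, map_sum]
    congr 1
    conv_lhs => rw [pi_eq_sum_univ' (evalVec u x)]
    simp [evalVec, mul_comm]
  rw [setIntegral_eq_integral_of_forall_compl_eq_zero]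
  · simp only [hsum]
    rw [integral_finsetSum]
    · exact Finset.sum_eq_zero fun a _ => key a
    · intro a _
      exact ((hθ.continuous.mul (continuous_eval _)).integrable_of_hasCompactSupport
        hc.mul_right).add (((c1 _).mul (continuous_eval _)).integrable_of_hasCompactSupport
        (hc.fderiv_apply ℝ _).mul_right)
  · intro x hx
    have hz : cutoff hv N =ᶠ[𝓝 x] fun _ => 0 := by
      filter_upwards [isCompact_tet.isClosed.isOpen_compl.mem_nhds hx] with y hy
      exact cutoff_eq_zero hv hN hy
    rw [cutoff_eq_zero hv hN hx, hz.fderiv_eq]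
    simp

/-- The divergence of a field without normal component on the boundary has mean value zero. -/
theorem integral_pdiv_eq_zero {u : VecPoly}
    (h0 : ∀ i, ∀ x ∈ face v i, dlam hv i ⬝ᵥ evalVec u x = 0) :
    ∫ x in tet v, eval x (pdiv u) = 0 := by
  -- The missing normal component supplies the factor `λ_i` that tames the gradient of the cutoff
  -- near face `i`.
  have hA : ∀ i, ∃ A, pdot (dlam hv i) u = lam hv i * A := fun i =>
    lam_dvd_of_face hv fun x hx => by rw [eval_pdot]; exact h0 i x hx
  choose A hA using hA
  have hAe : ∀ i x, dlam hv i ⬝ᵥ evalVec u x = eval x (lam hv i) * eval x (A i) := fun i x => by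
    rw [← eval_pdot, hA, map_mul]
  obtain ⟨K, hK⟩ := exists_bound_mul_deriv_smoothStep
  have hprod : ∀ (s : Finset (Fin 4)) (N : ℝ) (x : Pt),
      |∏ j ∈ s, smoothStep (N * eval x (lam hv j))| ≤ 1 := fun s N x => by
    rw [Finset.abs_prod]
    exact Finset.prod_le_one (fun _ _ => abs_nonneg _) fun _ _ => abs_smoothStep_le_one _
  let F : ℕ → Pt → ℝ := fun n x => cutoff hv n x * eval x (pdiv u)
    + fderiv ℝ (cutoff hv n) x (evalVec u x)
  have hF : ∀ n, ∫ x in tet v, F n x = 0 := fun n =>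
    integral_cutoff_mul_pdiv hv (Nat.cast_nonneg n) u
  have hFcont : ∀ n, Continuous (F n) := fun n => by
    have hθ := contDiff_cutoff hv (n : ℝ)
    refine (hθ.continuous.mul (continuous_eval _)).add
      ((hθ.continuous_fderiv (by simp)).clm_apply ?_)
    exact continuous_pi fun a => continuous_eval _
  have hlim : Tendsto (fun n => ∫ x in tet v, F n x) atTop
      (𝓝 (∫ x in tet v, eval x (pdiv u))) := by
    refine tendsto_integral_of_dominated_convergence
      (fun x => |eval x (pdiv u)| + ∑ i, K * |eval x (A i)|)
      (fun n => (hFcont n).aestronglyMeasurable) ?_ ?_ ?_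
    · refine integrable_tet ?_
      exact (continuous_eval _).abs.add (continuous_finsetSum _ fun i _ =>
        continuous_const.mul (continuous_eval _).abs)
    · intro n
      filter_upwards [ae_mem_interior_tet] with x hx
      have hpos := (mem_interior_tet hv).1 hx
      rw [Real.norm_eq_abs]
      refine (abs_add_le _ _).trans (add_le_add ?_ ?_)
      · rw [abs_mul]
        exact mul_le_of_le_one_left (abs_nonneg _) (hprod _ _ _)
      · rw [fderiv_cutoff]
        refine (Finset.abs_sum_le_sum_abs _ _).trans (Finset.sum_le_sum fun i _ => ?_)
        rw [abs_mul]
        refine (mul_le_of_le_one_left (abs_nonneg _) (hprod _ _ _)).trans ?_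
        have h1 := hK ((n : ℝ) * eval x (lam hv i))
          (mul_nonneg (Nat.cast_nonneg n) (hpos i).le)
        rw [hAe, show deriv smoothStep (n * eval x (lam hv i)) *
          (n * (eval x (lam hv i) * eval x (A i))) = (n * eval x (lam hv i) *
          deriv smoothStep (n * eval x (lam hv i))) * eval x (A i) by ring, abs_mul]
        exact mul_le_mul_of_nonneg_right h1 (abs_nonneg _)
    -- At a fixed interior point the cutoff is eventually one and its derivative zero.
    · filter_upwards [ae_mem_interior_tet] with x hx
      have hpos := (mem_interior_tet hv).1 hx
      have hev : ∀ᶠ n : ℕ in atTop, ∀ i, 2 < (n : ℝ) * eval x (lam hv i) := by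
        rw [Filter.eventually_all]
        intro i
        exact (tendsto_natCast_atTop_atTop.atTop_mul_const (hpos i)).eventually_gt_atTop 2
      refine tendsto_const_nhds.congr' ?_
      filter_upwards [hev] with n hn
      simp only [F, fderiv_cutoff, deriv_smoothStep_of_two_lt (hn _), zero_mul, mul_zero,
        Finset.sum_const_zero, add_zero, cutoff, smoothStep_of_two_le (hn _).le,
        Finset.prod_const_one, one_mul]
  simp only [hF] at hlim
  exact tendsto_nhds_unique hlim tendsto_const_nhds

theorem pdiv_mul (u : VecPoly) (p : Poly) :
    pdiv (fun a => p * u a) = p * pdiv u + ∑ a, u a * pderiv a p := by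
  simp only [pdiv, Derivation.leibniz, smul_eq_mul, Finset.sum_add_distrib, Finset.mul_sum]

/-- Integration by parts for a field without normal component on the boundary. -/
theorem integral_pdiv_mul {u : VecPoly}
    (h0 : ∀ i, ∀ x ∈ face v i, dlam hv i ⬝ᵥ evalVec u x = 0) (p : Poly) :
    ∫ x in tet v, eval x (pdiv u) * eval x p =
      -∫ x in tet v, ∑ a, eval x (u a) * eval x (pderiv a p) := by
  have h := integral_pdiv_eq_zero hv (u := fun a => p * u a) fun i x hx => by
    have h1 : evalVec (fun a => p * u a) x = eval x p • evalVec u x := by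
      funext a; simp [evalVec]
    rw [h1, dotProduct_smul, h0 i x hx, smul_zero]
  simp only [pdiv_mul, map_add, map_mul, map_sum] at h
  rw [integral_add] at h
  · rw [eq_neg_iff_add_eq_zero, ← h]
    congr 2
    funext x
    ring
  · exact integrable_tet ((continuous_eval _).mul (continuous_eval _))
  · exact integrable_tet (continuous_finsetSum _ fun a _ =>
      (continuous_eval _).mul (continuous_eval _))

end MixedElasticity

end

/-! ### Boundary values controlled by the `H¹` norm -/

noncomputable section

namespace MixedElasticity

open MvPolynomial (C X eval pderiv)

variable {v : Fin 4 → Pt} (hv : AffineIndependent ℝ v)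

/-! ### The trace inequality -/

/-- The parametrization of the tetrahedron as the cone with apex `v i` over face `i`. -/
def coneMap (v : Fin 4 → Pt) (i : Fin 4) (y : Pt) : Pt :=
  v i + y 0 • (faceParam v i (y 1, y 2) - v i)

/-- The Jacobian matrix of `coneMap`. -/
def coneJacobian (v : Fin 4 → Pt) (i : Fin 4) (y : Pt) : Mat := Matrix.of fun a =>
  ![faceParam v i (y 1, y 2) a - v i a, y 0 * (faceVertex v i 1 a - faceVertex v i 0 a),
    y 0 * (faceVertex v i 2 a - faceVertex v i 0 a)]

theorem hasFDerivAt_coneMap (i : Fin 4) (y : Pt) : HasFDerivAt (coneMap v i)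
    (Matrix.toLin' (coneJacobian v i y)).toContinuousLinearMap y := by
  rw [hasFDerivAt_pi']
  intro a
  have h0 : HasFDerivAt (fun x : Pt => x 0) (ContinuousLinearMap.proj (R := ℝ)
    (φ := fun _ : Fin 3 => ℝ) 0) y := hasFDerivAt_apply 0 y
  have h1 : HasFDerivAt (fun x : Pt => x 1) (ContinuousLinearMap.proj (R := ℝ)
    (φ := fun _ : Fin 3 => ℝ) 1) y := hasFDerivAt_apply 1 y
  have h2 : HasFDerivAt (fun x : Pt => x 2) (ContinuousLinearMap.proj (R := ℝ)
    (φ := fun _ : Fin 3 => ℝ) 2) y := hasFDerivAt_apply 2 y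
  have h3 : HasFDerivAt (fun x : Pt => faceVertex v i 0 a
      + x 1 * (faceVertex v i 1 a - faceVertex v i 0 a)
      + x 2 * (faceVertex v i 2 a - faceVertex v i 0 a) - v i a) _ y :=
    (((h1.mul_const _).const_add _).add (h2.mul_const _)).sub_const _
  have h4 := (h0.mul h3).const_add (v i a)
  have h5 : (fun x : Pt => coneMap v i x a) = fun x => v i a + ((fun x : Pt => x 0) *
      fun x : Pt => faceVertex v i 0 a + x 1 * (faceVertex v i 1 a - faceVertex v i 0 a)
        + x 2 * (faceVertex v i 2 a - faceVertex v i 0 a) - v i a) x := by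
    funext x
    simp [coneMap, faceParam]
  rw [h5]
  refine h4.congr_fderiv ?_
  ext1 z
  simp [coneJacobian, Matrix.mulVec, dotProduct, Fin.sum_univ_three, faceParam]
  ring

theorem det_coneJacobian (i : Fin 4) (y : Pt) :
    (Matrix.toLin' (coneJacobian v i y)).toContinuousLinearMap.det
      = y 0 ^ 2 * ((faceVertex v i 0 - v i) ⬝ᵥ faceCross v i) := by
  rw [ContinuousLinearMap.det, LinearMap.coe_toContinuousLinearMap, LinearMap.det_toLin',
    Matrix.det_fin_three]
  simp [coneJacobian, faceParam, faceCross, cross_apply, dotProduct, Fin.sum_univ_three]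
  ring

include hv in
theorem sub_dot_faceCross_ne_zero (i : Fin 4) :
    (faceVertex v i 0 - v i) ⬝ᵥ faceCross v i ≠ 0 := by
  obtain ⟨c, hc⟩ := eq_smul_dlam_of_dot hv (i := i) (N := faceCross v i)
    (by rw [faceCross, dotProduct_comm, dot_self_cross])
    (by rw [faceCross, dotProduct_comm, dot_cross_self])
  have hc0 : c ≠ 0 := by
    rintro rfl
    exact faceCross_ne_zero hv i (by rw [hc, zero_smul])
  rw [hc, dotProduct_smul, dotProduct_comm, faceVertex, dlam_dot_edge]
  simp [hc0, (Fin.succAbove_ne i _).symm]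

/-- The parameter domain of `coneMap`. -/
def coneDomain : Set Pt := {y | y 0 ∈ Set.Ioc 0 1 ∧ (y 1, y 2) ∈ refTriangle}

theorem measurableSet_coneDomain : MeasurableSet coneDomain :=
  (measurableSet_Ioc.preimage (measurable_pi_apply 0)).inter
    (isCompact_refTriangle.measurableSet.preimage
      ((measurable_pi_apply 1).prodMk (measurable_pi_apply 2)))

theorem eval_lam_coneMap (i : Fin 4) (j : Fin 4) (y : Pt) : eval (coneMap v i y) (lam hv j) =
    (1 - y 0) * (if j = i then 1 else 0)
      + y 0 * eval (faceParam v i (y 1, y 2)) (lam hv j) := by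
  rw [coneMap, eval_lam_line, eval_lam_vertex]

theorem eval_lam_faceParam (i : Fin 4) (s : ℝ × ℝ) (j : Fin 4) :
    eval (faceParam v i s) (lam hv j) = (if j = i.succAbove 0 then 1 else 0)
      + s.1 * ((if j = i.succAbove 1 then 1 else 0) - (if j = i.succAbove 0 then 1 else 0))
      + s.2 * ((if j = i.succAbove 2 then 1 else 0) - (if j = i.succAbove 0 then 1 else 0)) := by
  rw [faceParam, eval_lam_add, eval_lam_add, dotProduct_smul, dotProduct_smul]
  simp only [faceVertex, dlam_dot_edge, eval_lam_vertex, smul_eq_mul]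

include hv in
theorem injOn_coneMap (i : Fin 4) : Set.InjOn (coneMap v i) coneDomain := by
  rintro y ⟨hy, -⟩ z ⟨hz, -⟩ h
  -- The parameters are read off the barycentric coordinates `1 - y_0`, `y_0 y_1` and `y_0 y_2` of
  -- the image; the apex `y_0 = 0` is excluded from the domain.
  have key : ∀ y : Pt, eval (coneMap v i y) (lam hv i) = 1 - y 0 ∧
      eval (coneMap v i y) (lam hv (i.succAbove 1)) = y 0 * y 1 ∧
      eval (coneMap v i y) (lam hv (i.succAbove 2)) = y 0 * y 2 := by
    intro y
    simp only [eval_lam_coneMap, eval_lam_faceParam]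
    simp [(Fin.succAbove_ne i _).symm]
  obtain ⟨a1, a2, a3⟩ := key y
  obtain ⟨b1, b2, b3⟩ := key z
  rw [h] at a1 a2 a3
  have e0 : y 0 = z 0 := by linarith
  have hy0 : z 0 ≠ 0 := hz.1.ne'
  have e1 : y 1 = z 1 := by
    refine mul_left_cancel₀ hy0 ?_
    rw [← b2, a2, e0]
  have e2 : y 2 = z 2 := by
    refine mul_left_cancel₀ hy0 ?_
    rw [← b3, a3, e0]
  funext a
  fin_cases a
  · exact e0
  · exact e1
  · exact e2

theorem coneMap_mem_tet {i : Fin 4} {y : Pt} (hy : y ∈ coneDomain) : coneMap v i y ∈ tet v :=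
  convex_tet.add_smul_sub_mem (subset_convexHull ℝ _ (Set.mem_range_self i))
    (face_subset_tet i (faceParam_mem_face hy.2)) ⟨hy.1.1.le, hy.1.2⟩

include hv in
-- Change of variables, with Jacobian `y_0²` up to a constant. Injectivity and an image inside the
-- tetrahedron suffice for this inequality.
theorem lintegral_cone_le (i : Fin 4) (G : Pt → ℝ≥0∞) :
    ENNReal.ofReal |(faceVertex v i 0 - v i) ⬝ᵥ faceCross v i| *
      ∫⁻ y in coneDomain, ENNReal.ofReal (y 0 ^ 2) * G (coneMap v i y)
      ≤ ∫⁻ x in tet v, G x := by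
  have h := lintegral_image_eq_lintegral_abs_det_fderiv_mul volume measurableSet_coneDomain
    (fun y _ => (hasFDerivAt_coneMap (v := v) i y).hasFDerivWithinAt) (injOn_coneMap hv i) G
  have h2 : ∫⁻ x in coneMap v i '' coneDomain, G x ≤ ∫⁻ x in tet v, G x :=
    lintegral_mono_set (Set.image_subset_iff.2 fun y hy => coneMap_mem_tet hy)
  refine le_trans (le_of_eq ?_) h2
  rw [h, ← lintegral_const_mul' _ _ ENNReal.ofReal_ne_top]
  refine lintegral_congr fun y => ?_
  rw [det_coneJacobian, abs_mul, abs_of_nonneg (sq_nonneg (y 0)),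
    ENNReal.ofReal_mul (sq_nonneg _)]
  ring

/-- Triples of coordinates as a product. -/
theorem lintegral_coneDomain (f : Pt → ℝ≥0∞) (hf : Measurable f) :
    ∫⁻ y in coneDomain, f y =
      ∫⁻ s in refTriangle, ∫⁻ ρ in Set.Ioc (0 : ℝ) 1, f ![ρ, s.1, s.2] := by
  have e1 := volume_preserving_piFinSuccAbove (fun _ : Fin 3 => ℝ) 0
  have e2 := (MeasurePreserving.id (volume : Measure ℝ)).prod (volume_preserving_finTwoArrow ℝ)
  have e3 := e2.comp e1
  set Φ : Pt → ℝ × (ℝ × ℝ) := fun y => (y 0, (y 1, y 2)) with hΦ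
  have hΦe : MeasurePreserving Φ volume (volume.prod (volume.prod volume)) := e3
  have hinv : ∀ y, ![(Φ y).1, (Φ y).2.1, (Φ y).2.2] = y := by
    intro y; funext a; fin_cases a <;> rfl
  have hset : coneDomain = Φ ⁻¹' (Set.Ioc (0 : ℝ) 1 ×ˢ refTriangle) := rfl
  have hmeas : Measurable fun z : ℝ × (ℝ × ℝ) => f ![z.1, z.2.1, z.2.2] := by
    refine hf.comp (measurable_pi_lambda _ fun a => ?_)
    fin_cases a
    · exact measurable_fst
    · exact measurable_fst.comp measurable_snd
    · exact measurable_snd.comp measurable_snd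
  have h1 := (hΦe.restrict_preimage ((measurableSet_Ioc (a := (0 : ℝ)) (b := 1)).prod
    isCompact_refTriangle.measurableSet)).lintegral_comp hmeas
  simp only [hinv] at h1
  rw [hset, h1, ← Measure.prod_restrict, lintegral_prod_symm' _ hmeas]
  rfl

include hv in
/-- The trace inequality in squared form for smooth functions. -/
theorem exists_lintegral_face_le (i : Fin 4) : ∃ K : ℝ≥0∞, K ≠ ⊤ ∧ ∀ φ : Pt → ℝ, ContDiff ℝ ∞ φ →
    ∫⁻ x, ENNReal.ofReal (φ x ^ 2) ∂(faceMeasure v i) ≤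
      K * ∫⁻ x in tet v, ENNReal.ofReal (φ x ^ 2 +
        ∑ j, fderiv ℝ φ x (Pi.single j 1) ^ 2) := by
  obtain ⟨M, hM0, hM⟩ : ∃ M : ℝ, 0 ≤ M ∧ ∀ x ∈ tet v, ∀ j, |x j - v i j| ≤ M := by
    obtain ⟨M, hM⟩ := isCompact_tet.exists_bound_of_continuousOn (s := tet v)
      (f := fun x => x - v i) (by fun_prop)
    refine ⟨max M 0, le_max_right _ _, fun x hx j => ?_⟩
    exact ((norm_le_pi_norm (x - v i) j).trans (hM x hx)).trans (le_max_left _ _)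
  set D := |(faceVertex v i 0 - v i) ⬝ᵥ faceCross v i| with hD
  have hD0 : 0 < D := abs_pos.2 (sub_dot_faceCross_ne_zero hv i)
  set A := Real.sqrt (faceCross v i ⬝ᵥ faceCross v i) with hA
  -- With `d` the derivative along the ray and `S` the sum of the squared partial derivatives, `3 φ²
  -- + 2 ρ φ d ≤ 4 φ² + d²` for `0 ≤ ρ ≤ 1`, and `d² ≤ 3 M² S` by the Cauchy-Schwarz inequality.
  set K : ℝ := 4 + 3 * M ^ 2 with hK
  have hK0 : 0 ≤ K := by positivity
  refine ⟨ENNReal.ofReal A * (ENNReal.ofReal K * (ENNReal.ofReal D)⁻¹), ?_, fun φ hφ => ?_⟩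
  · exact ENNReal.mul_ne_top ENNReal.ofReal_ne_top (ENNReal.mul_ne_top ENNReal.ofReal_ne_top
      (ENNReal.inv_ne_top.2 (ENNReal.ofReal_pos.2 hD0).ne'))
  have hdiff : Differentiable ℝ φ := hφ.differentiable (by simp)
  have hdc : ∀ y, Continuous fun x => fderiv ℝ φ x y := fun y =>
    (hφ.continuous_fderiv (by simp)).clm_apply continuous_const
  let G : Pt → ℝ := fun x => φ x ^ 2 + ∑ j, fderiv ℝ φ x (Pi.single j 1) ^ 2
  have hGc : Continuous G :=
    (hφ.continuous.pow 2).add (continuous_finsetSum _ fun j _ => (hdc _).pow 2)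
  have hG0 : ∀ x, 0 ≤ G x := fun x => add_nonneg (sq_nonneg _)
    (Finset.sum_nonneg fun j _ => sq_nonneg _)
  have hcone : Continuous (coneMap v i) :=
    continuous_iff_continuousAt.2 fun y => (hasFDerivAt_coneMap i y).continuousAt
  -- the fundamental theorem of calculus on the rays through the apex
  have hray : ∀ s ∈ refTriangle, ENNReal.ofReal (φ (faceParam v i s) ^ 2) ≤
      ENNReal.ofReal K * ∫⁻ ρ in Set.Ioc (0 : ℝ) 1,
        ENNReal.ofReal (ρ ^ 2) * ENNReal.ofReal (G (coneMap v i ![ρ, s.1, s.2])) := by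
    intro s hs
    set w := faceParam v i s - v i with hw
    let p : ℝ → Pt := fun ρ => v i + ρ • w
    have hp : ∀ ρ, coneMap v i ![ρ, s.1, s.2] = p ρ := fun ρ => rfl
    have hpc : Continuous p := by fun_prop
    have hpd : ∀ ρ, HasDerivAt p w ρ := fun ρ => by
      have := ((hasDerivAt_id ρ).smul_const w).const_add (v i)
      rwa [one_smul] at this
    have hφp : ∀ ρ, HasDerivAt (fun ρ => φ (p ρ)) (fderiv ℝ φ (p ρ) w) ρ := fun ρ =>
      (hdiff (p ρ)).hasFDerivAt.comp_hasDerivAt ρ (hpd ρ)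
    -- The weight `ρ³` kills the value at the apex, and its derivative leaves the factor `ρ²` of the
    -- Jacobian of the cone.
    have hder : ∀ ρ, HasDerivAt (fun ρ => ρ ^ 3 * φ (p ρ) ^ 2)
        (3 * ρ ^ 2 * φ (p ρ) ^ 2 + ρ ^ 3 * (2 * φ (p ρ) * fderiv ℝ φ (p ρ) w)) ρ := fun ρ => by
      have := (hasDerivAt_pow 3 ρ).mul ((hφp ρ).pow 2)
      refine HasDerivAt.congr_deriv this ?_
      simp
    have hdcw : Continuous fun ρ => fderiv ℝ φ (p ρ) w := (hdc w).comp hpc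
    have hcont : Continuous fun ρ => 3 * ρ ^ 2 * φ (p ρ) ^ 2
        + ρ ^ 3 * (2 * φ (p ρ) * fderiv ℝ φ (p ρ) w) := by
      have := hφ.continuous.comp hpc
      fun_prop
    have hftc := intervalIntegral.integral_eq_sub_of_hasDerivAt (a := 0) (b := 1)
      (fun ρ _ => hder ρ) (hcont.intervalIntegrable _ _)
    have hp1 : p 1 = faceParam v i s := by simp [p, hw]
    have hwj : ∀ j, |w j| ≤ M := fun j => hM _ (face_subset_tet i (faceParam_mem_face hs)) j
    have hbound : ∀ ρ ∈ Set.Icc (0 : ℝ) 1, 3 * ρ ^ 2 * φ (p ρ) ^ 2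
        + ρ ^ 3 * (2 * φ (p ρ) * fderiv ℝ φ (p ρ) w) ≤ K * (ρ ^ 2 * G (p ρ)) := by
      rintro ρ ⟨h0, h1⟩
      have hexp : fderiv ℝ φ (p ρ) w = ∑ j, w j * fderiv ℝ φ (p ρ) (Pi.single j 1) := by
        conv_lhs => rw [pi_eq_sum_univ' w]
        simp
      have hsq : (fderiv ℝ φ (p ρ) w) ^ 2 ≤
          3 * M ^ 2 * ∑ j, fderiv ℝ φ (p ρ) (Pi.single j 1) ^ 2 := by
        rw [hexp]
        have hcs := Finset.sum_mul_sq_le_sq_mul_sq Finset.univ w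
          (fun j => fderiv ℝ φ (p ρ) (Pi.single j 1))
        refine hcs.trans (mul_le_mul_of_nonneg_right ?_
          (Finset.sum_nonneg fun j _ => sq_nonneg _))
        have : ∀ j ∈ (Finset.univ : Finset (Fin 3)), w j ^ 2 ≤ M ^ 2 := fun j _ =>
          sq_le_sq' (by linarith [neg_abs_le (w j), hwj j]) ((le_abs_self _).trans (hwj j))
        simpa using Finset.sum_le_sum this
      set d := fderiv ℝ φ (p ρ) w
      set S := ∑ j, fderiv ℝ φ (p ρ) (Pi.single j 1) ^ 2 with hS
      have hS0 : 0 ≤ S := Finset.sum_nonneg fun j _ => sq_nonneg _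
      have hG : G (p ρ) = φ (p ρ) ^ 2 + S := rfl
      have h2 : ρ * (2 * φ (p ρ) * d) ≤ φ (p ρ) ^ 2 + d ^ 2 := by
        have hr : ρ ^ 2 ≤ 1 := by nlinarith
        nlinarith [sq_nonneg (φ (p ρ) - ρ * d), sq_nonneg d,
          mul_nonneg (sub_nonneg.2 hr) (sq_nonneg d)]
      have h3 : 3 * ρ ^ 2 * φ (p ρ) ^ 2 + ρ ^ 3 * (2 * φ (p ρ) * d)
          = ρ ^ 2 * (3 * φ (p ρ) ^ 2 + ρ * (2 * φ (p ρ) * d)) := by ring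
      rw [h3, hG, mul_left_comm K]
      refine mul_le_mul_of_nonneg_left ?_ (sq_nonneg ρ)
      rw [hK]
      nlinarith [mul_nonneg (sq_nonneg M) (sq_nonneg (φ (p ρ)))]
    have hGp : Continuous fun ρ => ρ ^ 2 * G (p ρ) :=
      (continuous_pow 2).mul (hGc.comp hpc)
    have hle : φ (faceParam v i s) ^ 2 ≤ K * ∫ ρ in (0 : ℝ)..1, ρ ^ 2 * G (p ρ) := by
      rw [← hp1]
      have h4 : ∫ ρ in (0 : ℝ)..1, (3 * ρ ^ 2 * φ (p ρ) ^ 2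
          + ρ ^ 3 * (2 * φ (p ρ) * fderiv ℝ φ (p ρ) w)) = φ (p 1) ^ 2 := by
        rw [hftc]; simp
      rw [← h4, ← intervalIntegral.integral_const_mul]
      exact intervalIntegral.integral_mono_on zero_le_one (hcont.intervalIntegrable _ _)
        ((continuous_const.mul hGp).intervalIntegrable _ _) hbound
    refine (ENNReal.ofReal_le_ofReal hle).trans ?_
    rw [ENNReal.ofReal_mul hK0, intervalIntegral.integral_of_le zero_le_one,
      ofReal_integral_eq_lintegral_ofReal]
    · refine le_of_eq ?_
      congr 1
      refine lintegral_congr fun ρ => ?_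
      rw [hp, ENNReal.ofReal_mul (sq_nonneg _)]
    · exact (hGp.intervalIntegrable 0 1).1
    · exact ae_of_all _ fun ρ => mul_nonneg (sq_nonneg _) (hG0 _)
  have hmeas : Measurable fun y : Pt => ENNReal.ofReal (y 0 ^ 2) *
      ENNReal.ofReal (G (coneMap v i y)) :=
    (((measurable_pi_apply 0).pow_const 2).ennreal_ofReal).mul
      (hGc.comp hcone).measurable.ennreal_ofReal
  rw [faceMeasure_eq, lintegral_smul_measure, smul_eq_mul, mul_assoc]
  refine mul_le_mul_right ?_ _
  rw [lintegral_map (hφ.continuous.measurable.pow_const 2).ennreal_ofReal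
    (continuous_faceParam i).measurable]
  calc ∫⁻ s in refTriangle, ENNReal.ofReal (φ (faceParam v i s) ^ 2)
      ≤ ∫⁻ s in refTriangle, ENNReal.ofReal K * ∫⁻ ρ in Set.Ioc (0 : ℝ) 1,
        ENNReal.ofReal (ρ ^ 2) * ENNReal.ofReal (G (coneMap v i ![ρ, s.1, s.2])) :=
        setLIntegral_mono' isCompact_refTriangle.measurableSet hray
    _ = ENNReal.ofReal K * ∫⁻ y in coneDomain, ENNReal.ofReal (y 0 ^ 2) *
        ENNReal.ofReal (G (coneMap v i y)) := by
        rw [lintegral_coneDomain _ hmeas, lintegral_const_mul' _ _ ENNReal.ofReal_ne_top]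
        rfl
    _ ≤ ENNReal.ofReal K * (ENNReal.ofReal D)⁻¹ * ∫⁻ x in tet v, ENNReal.ofReal (G x) := by
        rw [mul_assoc]
        refine mul_le_mul_right ?_ _
        rw [← ENNReal.div_eq_inv_mul, ENNReal.le_div_iff_mul_le
          (Or.inl (ENNReal.ofReal_pos.2 hD0).ne') (Or.inl ENNReal.ofReal_ne_top), mul_comm]
        exact lintegral_cone_le hv i fun x => ENNReal.ofReal (G x)

end MixedElasticity

end

/-! ### Smoothing up to the boundary -/

noncomputable section

namespace MixedElasticity

open MvPolynomial (C X eval pderiv)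

variable {v : Fin 4 → Pt} (hv : AffineIndependent ℝ v)

/-! ### Mollification towards an interior point -/

theorem eLpNorm_two_sq {α : Type*} [MeasurableSpace α] (f : α → ℝ) (μ : Measure α) :
    eLpNorm f 2 μ ^ 2 = ∫⁻ x, ENNReal.ofReal (f x ^ 2) ∂μ := by
  have h := eLpNorm_nnreal_pow_eq_lintegral (f := f) (μ := μ) (p := 2) two_ne_zero
  simp only [NNReal.coe_ofNat, ENNReal.coe_ofNat, ENNReal.rpow_ofNat] at h
  rw [h]
  refine lintegral_congr fun x => ?_
  rw [← sq_abs, ENNReal.ofReal_pow (abs_nonneg _), Real.enorm_eq_ofReal_abs]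

/-- The rescaled and reflected bump function. -/
def kern {c : Pt} (b : ContDiffBump c) (ε : ℝ) (t : Pt) : ℝ :=
  (ε ^ 3)⁻¹ * b.normed volume (-(ε⁻¹ • t))

theorem contDiff_kern {c : Pt} (b : ContDiffBump c) (ε : ℝ) : ContDiff ℝ ∞ (kern b ε) :=
  contDiff_const.mul (b.contDiff_normed.comp (contDiff_id.const_smul _).neg)

theorem kern_eq_zero {c : Pt} (b : ContDiffBump c) {ε : ℝ} {t : Pt}
    (h : -(ε⁻¹ • t) ∉ Metric.closedBall c b.rOut) : kern b ε t = 0 := by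
  have h3 : b.normed volume (-(ε⁻¹ • t)) = 0 := Function.notMem_support.1 fun h2 => by
    rw [b.support_normed_eq] at h2
    exact h (Metric.ball_subset_closedBall h2)
  rw [kern, h3, mul_zero]

theorem hasCompactSupport_kern {c : Pt} (b : ContDiffBump c) {ε : ℝ} (hε : 0 < ε) :
    HasCompactSupport (kern b ε) := by
  have hcomp : IsCompact ((fun z : Pt => -(ε • z)) '' Metric.closedBall c b.rOut) :=
    (isCompact_closedBall c b.rOut).image (by fun_prop)
  refine HasCompactSupport.intro hcomp fun t ht => kern_eq_zero b fun h => ht ⟨_, h, ?_⟩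
  simp [smul_smul, hε.ne']

/-- The mollification of `u`, restricted to the tetrahedron, at scale `ε`. -/
def moll (v : Fin 4 → Pt) {c : Pt} (b : ContDiffBump c) (ε : ℝ) (u : Pt → ℝ) (x : Pt) : ℝ :=
  ∫ w in tet v, u w * kern b ε ((1 - ε) • x - w)

theorem moll_eq_convolution {c : Pt} (b : ContDiffBump c) (ε : ℝ) (u : Pt → ℝ) (x : Pt) :
    moll v b ε u x = convolution ((tet v).indicator u) (kern b ε) (ContinuousLinearMap.mul ℝ ℝ)
      volume ((1 - ε) • x) := by
  rw [moll, convolution_def, ← integral_indicator measurableSet_tet]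
  refine integral_congr_ae (ae_of_all _ fun w => ?_)
  by_cases hw : w ∈ tet v <;> simp [hw]

theorem integrable_indicator_tet {u : Pt → ℝ} (hu : Integrable u (volume.restrict (tet v))) :
    Integrable ((tet v).indicator u) volume :=
  (integrable_indicator_iff measurableSet_tet).2 hu

theorem contDiff_moll {c : Pt} (b : ContDiffBump c) {ε : ℝ} (hε : 0 < ε) {u : Pt → ℝ}
    (hu : Integrable u (volume.restrict (tet v))) : ContDiff ℝ ∞ (moll v b ε u) := by
  have h := (hasCompactSupport_kern b hε).contDiff_convolution_right
    (ContinuousLinearMap.mul ℝ ℝ) (integrable_indicator_tet hu).locallyIntegrable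
    (contDiff_kern b ε)
  have h2 := h.comp (contDiff_id.const_smul _ : ContDiff ℝ ∞ fun x : Pt => (1 - ε) • x)
  rw [show moll v b ε u = _ from funext (moll_eq_convolution b ε u)]
  exact h2

theorem fderiv_moll {c : Pt} (b : ContDiffBump c) {ε : ℝ} (hε : 0 < ε) {u : Pt → ℝ}
    (hu : Integrable u (volume.restrict (tet v))) (x y : Pt) :
    fderiv ℝ (moll v b ε u) x y =
      (1 - ε) * ∫ w in tet v, u w * fderiv ℝ (kern b ε) ((1 - ε) • x - w) y := by
  have hloc := (integrable_indicator_tet hu).locallyIntegrable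
  have hk := contDiff_kern b ε
  have h := (hasCompactSupport_kern b hε).hasFDerivAt_convolution_right
    (ContinuousLinearMap.mul ℝ ℝ) hloc (hk.of_le (by simp)) ((1 - ε) • x)
  have h2 := h.comp x ((hasFDerivAt_id x).const_smul (1 - ε))
  have h3 : HasFDerivAt (moll v b ε u) _ x :=
    h2.congr_of_eventuallyEq (Eventually.of_forall fun z => moll_eq_convolution b ε u z)
  rw [h3.fderiv]
  simp only [ContinuousLinearMap.comp_apply, _root_.smul_apply,
    ContinuousLinearMap.id_apply, map_smul, smul_eq_mul]
  rw [convolution_precompR_apply _ hloc ((hasCompactSupport_kern b hε).fderiv ℝ)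
    (hk.continuous_fderiv (by simp)), convolution_def, ← integral_indicator measurableSet_tet]
  congr 1
  refine integral_congr_ae (ae_of_all _ fun w => ?_)
  by_cases hw : w ∈ tet v <;> simp [hw]

/-- A combination of a point of the closed tetrahedron with a point of the ball in its interior is
interior, by convexity and `ε > 0`. Hence the kernel is an admissible test function even for `x` on
the boundary, and `u` need not be extended. -/
theorem kern_translate_support {c : Pt} (b : ContDiffBump c)
    (hb : Metric.closedBall c b.rOut ⊆ interior (tet v)) {ε : ℝ} (hε : 0 < ε) (hε1 : ε ≤ 1) {x : Pt}
    (hx : x ∈ tet v) : tsupport (fun w => kern b ε ((1 - ε) • x - w)) ⊆ interior (tet v) := by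
  have hK : IsCompact ((fun z : Pt => (1 - ε) • x + ε • z) '' Metric.closedBall c b.rOut) :=
    (isCompact_closedBall c b.rOut).image (by fun_prop)
  have h1 : (fun z : Pt => (1 - ε) • x + ε • z) '' Metric.closedBall c b.rOut
      ⊆ interior (tet v) := by
    rintro _ ⟨z, hz, rfl⟩
    have := convex_tet.combo_self_interior_mem_interior hx (hb hz) (sub_nonneg.2 hε1) hε
      (sub_add_cancel 1 ε)
    exact this
  refine (closure_minimal (fun w hw => ?_) hK.isClosed).trans h1
  by_contra hw2
  refine hw (kern_eq_zero b fun h => hw2 ⟨_, h, ?_⟩)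
  simp [smul_smul, hε.ne']

/-- The derivative falls on the kernel, where a derivative in `x` is `-(1 - ε)` times one in the
integration variable; the definition of the weak derivative moves it to `u`. -/
theorem fderiv_moll_weak {c : Pt} (b : ContDiffBump c)
    (hb : Metric.closedBall c b.rOut ⊆ interior (tet v)) {ε : ℝ} (hε : 0 < ε) (hε1 : ε ≤ 1)
    {u g : Pt → ℝ} (hu : Integrable u (volume.restrict (tet v))) {j : Fin 3}
    (hg : IsWeakPartial v j u g) {x : Pt} (hx : x ∈ tet v) :
    fderiv ℝ (moll v b ε u) x (Pi.single j 1) = (1 - ε) * moll v b ε g x := by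
  rw [fderiv_moll b hε hu]
  congr 1
  have hk := contDiff_kern b ε
  have hsm : ContDiff ℝ ∞ fun w => kern b ε ((1 - ε) • x - w) :=
    hk.comp (contDiff_const.sub contDiff_id)
  have hts := kern_translate_support b hb hε hε1 hx
  have h := hg.2 (fun w => kern b ε ((1 - ε) • x - w)) hsm
    (isCompact_tet.of_isClosed_subset (isClosed_tsupport _) (hts.trans interior_subset)) hts
  have hder : ∀ w, fderiv ℝ (fun w => kern b ε ((1 - ε) • x - w)) w (Pi.single j 1)
      = -fderiv ℝ (kern b ε) ((1 - ε) • x - w) (Pi.single j 1) := by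
    intro w
    have h1 := ((hk.differentiable (by simp)) ((1 - ε) • x - w)).hasFDerivAt.comp w
      ((hasFDerivAt_id w).const_sub ((1 - ε) • x))
    have h2 : HasFDerivAt (fun w => kern b ε ((1 - ε) • x - w)) _ w := h1
    rw [h2.fderiv]
    simp
  simp only [hder, mul_neg, integral_neg, neg_inj] at h
  exact h

/-! ### Convergence of the mollifications -/

/-- The probability measure whose density is the bump function. -/
def bumpMeasure {c : Pt} (b : ContDiffBump c) : Measure Pt :=
  volume.withDensity fun z => ENNReal.ofReal (b.normed volume z)

instance {c : Pt} (b : ContDiffBump c) : IsProbabilityMeasure (bumpMeasure b) := by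
  constructor
  rw [bumpMeasure, withDensity_apply _ MeasurableSet.univ, Measure.restrict_univ,
    ← ofReal_integral_eq_lintegral_ofReal b.integrable_normed
      (ae_of_all _ fun z => b.nonneg_normed z), b.integral_normed, ENNReal.ofReal_one]

theorem ae_bumpMeasure {c : Pt} (b : ContDiffBump c) :
    ∀ᵐ z ∂(bumpMeasure b), z ∈ Metric.closedBall c b.rOut := by
  rw [bumpMeasure, ae_withDensity_iff b.continuous_normed.measurable.ennreal_ofReal]
  refine ae_of_all _ fun z hz => ?_
  by_contra h
  refine hz ?_
  have h3 : b.normed volume z = 0 := Function.notMem_support.1 fun h2 => by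
    rw [b.support_normed_eq] at h2
    exact h (Metric.ball_subset_closedBall h2)
  rw [h3, ENNReal.ofReal_zero]

/-- The substitution `w = (1 - ε) x + ε z`. The mollification is an average of `u` over contractions
of `x` towards points of the ball. -/
theorem moll_eq_integral_bump {c : Pt} (b : ContDiffBump c) {ε : ℝ} (hε : 0 < ε) (u : Pt → ℝ)
    (x : Pt) : moll v b ε u x =
      ∫ z, (tet v).indicator u ((1 - ε) • x + ε • z) ∂(bumpMeasure b) := by
  rw [bumpMeasure, integral_withDensity_eq_integral_toReal_smul
    b.continuous_normed.measurable.ennreal_ofReal (ae_of_all _ fun _ => ENNReal.ofReal_lt_top)]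
  simp only [ENNReal.toReal_ofReal (b.nonneg_normed _), smul_eq_mul]
  let H : Pt → ℝ := fun z => b.normed volume z * (tet v).indicator u ((1 - ε) • x + ε • z)
  have h1 : moll v b ε u x = ∫ w, (ε ^ 3)⁻¹ * H (ε⁻¹ • (w - (1 - ε) • x)) := by
    rw [moll, ← integral_indicator measurableSet_tet]
    refine integral_congr_ae (ae_of_all _ fun w => ?_)
    have e1 : (1 - ε) • x + ε • ε⁻¹ • (w - (1 - ε) • x) = w := by
      rw [smul_smul, mul_inv_cancel₀ hε.ne', one_smul, add_sub_cancel]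
    have e2 : -(ε⁻¹ • ((1 - ε) • x - w)) = ε⁻¹ • (w - (1 - ε) • x) := by
      rw [← smul_neg, neg_sub]
    simp only [H, e1]
    by_cases hw : w ∈ tet v
    · simp only [Set.indicator_of_mem hw, kern]
      rw [e2]
      ring
    · simp [hw]
  rw [h1, integral_const_mul, integral_sub_right_eq_self (fun w => H (ε⁻¹ • w)),
    Measure.integral_comp_smul]
  simp only [Module.finrank_fintype_fun_eq_card, Fintype.card_fin, smul_eq_mul]
  have h2 : |(ε⁻¹ ^ 3)⁻¹| = ε ^ 3 := by rw [inv_pow, inv_inv, abs_of_pos (by positivity)]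
  rw [h2, ← mul_assoc, inv_mul_cancel₀ (by positivity), one_mul]

theorem lintegral_comp_affine {f : Pt → ℝ≥0∞} (hf : Measurable f) {r : ℝ} (hr : r ≠ 0) (a : Pt) :
    ∫⁻ x, f (r • x + a) = ENNReal.ofReal |(r ^ 3)⁻¹| * ∫⁻ x, f x := by
  have h1 : ∀ x, r • x + a = r • (x + r⁻¹ • a) := fun x => by
    rw [smul_add, smul_smul, mul_inv_cancel₀ hr, one_smul]
  simp only [h1]
  rw [lintegral_add_right_eq_self (fun x => f (r • x)), ← lintegral_map hf (measurable_const_smul r),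
    Measure.map_addHaar_smul volume hr, lintegral_smul_measure]
  simp

theorem moll_congr {c : Pt} (b : ContDiffBump c) (ε : ℝ) {u u' : Pt → ℝ}
    (h : u =ᵐ[volume.restrict (tet v)] u') (x : Pt) : moll v b ε u x = moll v b ε u' x :=
  integral_congr_ae (h.mono fun w hw => by simp only [hw])

/-- The average over a probability measure is bounded in the mean square, and after exchanging the
integrals each contraction by `1 - ε ≥ 1 / 2` costs at most a factor `(1 - ε)⁻³ ≤ 8`. -/
theorem eLpNorm_moll_sq_le_of_measurable {c : Pt} (b : ContDiffBump c) {ε : ℝ} (hε : 0 < ε)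
    (hε1 : ε ≤ 1 / 2) {u : Pt → ℝ} (hu : Measurable u) :
    eLpNorm (moll v b ε u) 2 volume ^ 2 ≤ 8 * eLpNorm u 2 (volume.restrict (tet v)) ^ 2 := by
  set f := (tet v).indicator u with hf
  have hfm : Measurable f := hu.indicator measurableSet_tet
  have hS : ∀ x : Pt, Measurable fun z : Pt => (1 - ε) • x + ε • z := fun x => by fun_prop
  have h1 : ∀ x, ENNReal.ofReal (moll v b ε u x ^ 2) ≤
      ∫⁻ z, ENNReal.ofReal (f ((1 - ε) • x + ε • z) ^ 2) ∂(bumpMeasure b) := by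
    intro x
    rw [← eLpNorm_two_sq (fun z => f ((1 - ε) • x + ε • z)), ← sq_abs,
      ENNReal.ofReal_pow (abs_nonneg _), ← Real.enorm_eq_ofReal_abs]
    have h2 : ‖moll v b ε u x‖ₑ ≤ eLpNorm (fun z => f ((1 - ε) • x + ε • z)) 1 (bumpMeasure b) := by
      rw [moll_eq_integral_bump b hε, eLpNorm_one_eq_lintegral_enorm]
      exact enorm_integral_le_lintegral_enorm _
    have h3 := eLpNorm_le_eLpNorm_of_exponent_le (μ := bumpMeasure b) (one_le_two (α := ℝ≥0∞))
      (hfm.comp (hS x)).aestronglyMeasurable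
    gcongr
    exact h2.trans h3
  rw [eLpNorm_two_sq, eLpNorm_two_sq]
  have hr : 1 - ε ≠ 0 := by linarith
  have hm : Measurable fun y => ENNReal.ofReal (f y ^ 2) := (hfm.pow_const 2).ennreal_ofReal
  calc ∫⁻ x, ENNReal.ofReal (moll v b ε u x ^ 2)
      ≤ ∫⁻ x, ∫⁻ z, ENNReal.ofReal (f ((1 - ε) • x + ε • z) ^ 2) ∂(bumpMeasure b) :=
        lintegral_mono h1
    _ = ∫⁻ z, (∫⁻ x, ENNReal.ofReal (f ((1 - ε) • x + ε • z) ^ 2)) ∂(bumpMeasure b) := by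
        refine lintegral_lintegral_swap (Measurable.aemeasurable ?_)
        exact hm.comp (by fun_prop : Measurable fun p : Pt × Pt => (1 - ε) • p.1 + ε • p.2)
    _ = ∫⁻ _z, (ENNReal.ofReal |((1 - ε) ^ 3)⁻¹| * ∫⁻ x, ENNReal.ofReal (f x ^ 2))
          ∂(bumpMeasure b) := by
        refine lintegral_congr fun z => ?_
        exact lintegral_comp_affine hm hr _
    _ = ENNReal.ofReal |((1 - ε) ^ 3)⁻¹| * ∫⁻ x, ENNReal.ofReal (f x ^ 2) := by
        rw [lintegral_const, measure_univ, mul_one]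
    _ ≤ 8 * ∫⁻ x in tet v, ENNReal.ofReal (u x ^ 2) := by
        refine mul_le_mul' ?_ (le_of_eq ?_)
        · have h8 : (8 : ℝ≥0∞) = ENNReal.ofReal 8 := by simp
          rw [h8]
          refine ENNReal.ofReal_le_ofReal ?_
          have h4 : (1 / 2 : ℝ) ^ 3 ≤ (1 - ε) ^ 3 := by gcongr; linarith
          rw [abs_of_nonneg (by positivity), inv_le_comm₀ (by linarith [h4]) (by norm_num)]
          linarith
        · rw [← lintegral_indicator measurableSet_tet]
          refine lintegral_congr fun x => ?_
          by_cases hx : x ∈ tet v <;> simp [hf, hx]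

theorem eLpNorm_moll_le {c : Pt} (b : ContDiffBump c) {ε : ℝ} (hε : 0 < ε)
    (hε1 : ε ≤ 1 / 2) {u : Pt → ℝ} (hu : MemLp u 2 (volume.restrict (tet v))) :
    eLpNorm (moll v b ε u) 2 (volume.restrict (tet v)) ≤
      3 * eLpNorm u 2 (volume.restrict (tet v)) := by
  have hae := hu.1.ae_eq_mk
  have h1 := eLpNorm_moll_sq_le_of_measurable (v := v) b hε hε1 hu.1.stronglyMeasurable_mk.measurable
  have h2 : moll v b ε u = moll v b ε (hu.1.mk u) := funext fun x => moll_congr b ε hae x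
  rw [← h2, ← eLpNorm_congr_ae hae] at h1
  refine (eLpNorm_mono_measure _ Measure.restrict_le_self).trans ?_
  -- The constant `3` works because `8 ≤ 3²`.
  rw [← ENNReal.pow_le_pow_left_iff two_ne_zero, mul_pow]
  refine h1.trans ?_
  gcongr
  norm_num

theorem integrable_mul_kern {c : Pt} (b : ContDiffBump c) {ε : ℝ} (hε : 0 < ε) {u : Pt → ℝ}
    (hu : Integrable u (volume.restrict (tet v))) (y : Pt) :
    Integrable (fun w => u w * kern b ε (y - w)) (volume.restrict (tet v)) := by
  obtain ⟨K, hK⟩ := (hasCompactSupport_kern b hε).exists_bound_of_continuous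
    (contDiff_kern b ε).continuous
  exact hu.mul_bdd ((contDiff_kern b ε).continuous.comp (by fun_prop)).aestronglyMeasurable
    (ae_of_all _ fun w => hK _)

theorem moll_sub {c : Pt} (b : ContDiffBump c) {ε : ℝ} (hε : 0 < ε) {u w : Pt → ℝ}
    (hu : Integrable u (volume.restrict (tet v))) (hw : Integrable w (volume.restrict (tet v)))
    (x : Pt) : moll v b ε (u - w) x = moll v b ε u x - moll v b ε w x := by
  rw [moll, moll, moll, ← integral_sub (integrable_mul_kern b hε hu _)
    (integrable_mul_kern b hε hw _)]
  simp only [Pi.sub_apply, sub_mul]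

/-- The sequence of scales that is used for the mollification. -/
def scale (n : ℕ) : ℝ := 1 / ((n : ℝ) + 2)

theorem scale_pos (n : ℕ) : 0 < scale n := by unfold scale; positivity

theorem scale_le (n : ℕ) : scale n ≤ 1 / 2 := by
  unfold scale
  gcongr
  linarith [(Nat.cast_nonneg n : (0 : ℝ) ≤ n)]

theorem tendsto_scale : Tendsto scale atTop (𝓝 0) := by
  have h := (tendsto_natCast_atTop_atTop (R := ℝ)).atTop_add (tendsto_const_nhds (x := (2 : ℝ)))
  exact h.inv_tendsto_atTop.congr fun n => by simp [scale]

/-- The averaged points differ from `x` by at most `ε` times a bound for the diameter, so uniform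
continuity gives uniform convergence on the tetrahedron. -/
theorem tendsto_moll_of_continuous {c : Pt} (b : ContDiffBump c)
    (hb : Metric.closedBall c b.rOut ⊆ interior (tet v)) {h : Pt → ℝ} (hh : Continuous h)
    (hc : HasCompactSupport h) :
    Tendsto (fun n => eLpNorm (fun x => moll v b (scale n) h x - h x) 2 (volume.restrict (tet v)))
      atTop (𝓝 0) := by
  obtain ⟨D, hD0, hD⟩ : ∃ D : ℝ, 0 < D ∧ ∀ x ∈ tet v, ∀ z ∈ tet v, ‖z - x‖ ≤ D := by
    obtain ⟨D, hD⟩ := (isCompact_tet.isBounded (s := tet v)).exists_norm_le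
    refine ⟨|D| + |D| + 1, by positivity, fun x hx z hz => (norm_sub_le _ _).trans ?_⟩
    linarith [(hD x hx).trans (le_abs_self D), (hD z hz).trans (le_abs_self D)]
  have huc := hc.uniformContinuous_of_continuous hh
  have hunif : ∀ η > 0, ∀ᶠ n in atTop, ∀ x ∈ tet v, |moll v b (scale n) h x - h x| ≤ η := by
    intro η hη
    obtain ⟨δ, hδ, hδ'⟩ := Metric.uniformContinuous_iff.1 huc η hη
    have h1 : ∀ᶠ n in atTop, scale n < δ / D := tendsto_scale.eventually_lt_const (by positivity)
    filter_upwards [h1] with n hn x hx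
    have hε := scale_pos n
    have hε1 : scale n ≤ 1 := (scale_le n).trans (by norm_num)
    have hae : ∀ᵐ z ∂(bumpMeasure b),
        |(tet v).indicator h ((1 - scale n) • x + scale n • z) - h x| ≤ η := by
      filter_upwards [ae_bumpMeasure b] with z hz
      have hzT : z ∈ tet v := interior_subset (hb hz)
      have hmem : (1 - scale n) • x + scale n • z ∈ tet v :=
        convex_tet hx hzT (sub_nonneg.2 hε1) hε.le (sub_add_cancel _ _)
      rw [Set.indicator_of_mem hmem]
      refine (hδ' ?_).le
      rw [dist_eq_norm]
      have e : (1 - scale n) • x + scale n • z - x = scale n • (z - x) := by module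
      rw [e, norm_smul, Real.norm_of_nonneg hε.le]
      calc scale n * ‖z - x‖ ≤ scale n * D := by gcongr; exact hD x hx z hzT
        _ < δ := (lt_div_iff₀ hD0).1 hn
    have hmeas : AEStronglyMeasurable
        (fun z => (tet v).indicator h ((1 - scale n) • x + scale n • z)) (bumpMeasure b) :=
      ((hh.measurable.indicator measurableSet_tet).comp
        (by fun_prop : Measurable fun z : Pt =>
          (1 - scale n) • x + scale n • z)).aestronglyMeasurable
    have hint : Integrable
        (fun z => (tet v).indicator h ((1 - scale n) • x + scale n • z)) (bumpMeasure b) := by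
      refine Integrable.of_bound hmeas (|h x| + η) (hae.mono fun z hz => ?_)
      rw [Real.norm_eq_abs]
      calc _ ≤ |(tet v).indicator h ((1 - scale n) • x + scale n • z) - h x| + |h x| := by
            simpa using abs_add_le ((tet v).indicator h ((1 - scale n) • x + scale n • z) - h x)
              (h x)
        _ ≤ |h x| + η := by linarith
    rw [moll_eq_integral_bump b hε]
    have e : ∫ z, (tet v).indicator h ((1 - scale n) • x + scale n • z) ∂(bumpMeasure b) - h x
        = ∫ z, ((tet v).indicator h ((1 - scale n) • x + scale n • z) - h x) ∂(bumpMeasure b) := by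
      rw [integral_sub hint (integrable_const _)]
      simp
    rw [e]
    have := norm_integral_le_of_norm_le_const (f := fun z =>
      (tet v).indicator h ((1 - scale n) • x + scale n • z) - h x) (μ := bumpMeasure b) (C := η) hae
    simpa using this
  rw [ENNReal.tendsto_nhds_zero]
  intro δ hδ
  set V := volume.restrict (tet v) Set.univ ^ ((2 : ℝ≥0∞).toReal⁻¹) with hV
  have hVtop : V ≠ ⊤ := ENNReal.rpow_ne_top_of_nonneg (by positivity) (measure_ne_top _ _)
  obtain ⟨η, hη, hη'⟩ : ∃ η : ℝ, 0 < η ∧ V * ENNReal.ofReal η ≤ δ := by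
    have ht : Tendsto (fun η : ℝ => V * ENNReal.ofReal η) (𝓝[>] 0) (𝓝 (V * ENNReal.ofReal 0)) :=
      (ENNReal.Tendsto.const_mul (ENNReal.continuous_ofReal.tendsto 0)
        (Or.inr hVtop)).mono_left nhdsWithin_le_nhds
    rw [ENNReal.ofReal_zero, mul_zero, ENNReal.tendsto_nhds_zero] at ht
    obtain ⟨η, h1, h2⟩ := ((ht δ hδ).and self_mem_nhdsWithin).exists
    exact ⟨η, h2, h1⟩
  filter_upwards [hunif η hη] with n hn
  refine (eLpNorm_le_of_ae_bound ?_).trans hη'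
  exact (ae_restrict_iff' measurableSet_tet).2 (ae_of_all _ hn)

theorem tendsto_moll {c : Pt} (b : ContDiffBump c)
    (hb : Metric.closedBall c b.rOut ⊆ interior (tet v)) {u : Pt → ℝ}
    (hu : MemLp u 2 (volume.restrict (tet v))) :
    Tendsto (fun n => eLpNorm (fun x => moll v b (scale n) u x - u x) 2 (volume.restrict (tet v)))
      atTop (𝓝 0) := by
  rw [ENNReal.tendsto_nhds_zero]
  intro δ hδ
  -- The fifths are spent as `3 + 1 + 1`: the mollification of `u - h` by `eLpNorm_moll_le`, the
  -- error for the continuous `h`, and `u - h` itself.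
  have hδ5 : δ / 5 ≠ 0 := (ENNReal.div_pos hδ.ne' (by simp)).ne'
  obtain ⟨h, hc, hle, hh, hmem⟩ := hu.exists_hasCompactSupport_eLpNorm_sub_le (by simp) hδ5
  have hev := (ENNReal.tendsto_nhds_zero.1 (tendsto_moll_of_continuous b hb hh hc)) (δ / 5)
    (pos_iff_ne_zero.2 hδ5)
  filter_upwards [hev] with n hn
  have hε := scale_pos n
  have hui := hu.integrable one_le_two
  have hhi := hmem.integrable one_le_two
  have hsplit : (fun x => moll v b (scale n) u x - u x) =
      (moll v b (scale n) (u - h) + fun x => moll v b (scale n) h x - h x) - (u - h) := by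
    funext x
    simp only [Pi.add_apply, Pi.sub_apply, moll_sub b hε hui hhi]
    ring
  have hm1 : AEStronglyMeasurable (moll v b (scale n) (u - h)) (volume.restrict (tet v)) :=
    (contDiff_moll b hε (hui.sub hhi)).continuous.aestronglyMeasurable
  have hm2 : AEStronglyMeasurable (fun x => moll v b (scale n) h x - h x)
      (volume.restrict (tet v)) :=
    ((contDiff_moll b hε hhi).continuous.sub hh).aestronglyMeasurable
  rw [hsplit]
  have h3 := eLpNorm_moll_le b hε (scale_le n) (hu.sub hmem)
  calc _ ≤ eLpNorm (moll v b (scale n) (u - h) + fun x => moll v b (scale n) h x - h x) 2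
        (volume.restrict (tet v)) + eLpNorm (u - h) 2 (volume.restrict (tet v)) :=
        eLpNorm_sub_le (hm1.add hm2) (hu.sub hmem).1 one_le_two
    _ ≤ (3 * (δ / 5) + δ / 5) + δ / 5 := by
        gcongr
        refine (eLpNorm_add_le hm1 hm2 one_le_two).trans ?_
        gcongr
        refine h3.trans ?_
        gcongr
    _ = 5 * (δ / 5) := by ring
    _ ≤ δ := ENNReal.mul_div_le

end MixedElasticity

end

/-! ### Density of smooth functions, traces and weak divergences -/

noncomputable section

namespace MixedElasticity

open MvPolynomial (C X eval pderiv)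

variable {v : Fin 4 → Pt} (hv : AffineIndependent ℝ v)

/-! ### Density of smooth functions and traces -/

theorem tendsto_eLpNorm_lincomb {α ι : Type*} [MeasurableSpace α] {μ : Measure α} {l : Filter ι}
    {f g : ι → α → ℝ} (hf : ∀ n, AEStronglyMeasurable (f n) μ)
    (hg : ∀ n, AEStronglyMeasurable (g n) μ)
    (hf0 : Tendsto (fun n => eLpNorm (f n) 2 μ) l (𝓝 0))
    (hg0 : Tendsto (fun n => eLpNorm (g n) 2 μ) l (𝓝 0)) (a b : ℝ) :
    Tendsto (fun n => eLpNorm (fun x => a * f n x + b * g n x) 2 μ) l (𝓝 0) := by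
  have h : Tendsto (fun n => ‖a‖ₑ * eLpNorm (f n) 2 μ + ‖b‖ₑ * eLpNorm (g n) 2 μ) l (𝓝 0) := by
    have h1 := ENNReal.Tendsto.const_mul (a := ‖a‖ₑ) hf0 (Or.inr (by simp))
    have h2 := ENNReal.Tendsto.const_mul (a := ‖b‖ₑ) hg0 (Or.inr (by simp))
    simpa using h1.add h2
  refine tendsto_of_tendsto_of_tendsto_of_le_of_le tendsto_const_nhds h (fun _ => zero_le)
    fun n => ?_
  refine (eLpNorm_add_le ((hf n).const_mul a) ((hg n).const_mul b) one_le_two).trans ?_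
  have h1 : eLpNorm (fun x => a * f n x) 2 μ = ‖a‖ₑ * eLpNorm (f n) 2 μ :=
    eLpNorm_const_smul a (f n) 2 μ
  have h2 : eLpNorm (fun x => b * g n x) 2 μ = ‖b‖ₑ * eLpNorm (g n) 2 μ :=
    eLpNorm_const_smul b (g n) 2 μ
  rw [h1, h2]

theorem continuous_partial {φ : Pt → ℝ} (h : ContDiff ℝ ∞ φ) (j : Fin 3) :
    Continuous fun x => fderiv ℝ φ x (Pi.single j 1) :=
  (h.continuous_fderiv (by simp)).clm_apply continuous_const

include hv in
-- The trace inequality as a statement on convergence, after taking square roots.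
theorem tendsto_eLpNorm_face (i : Fin 4) {ι : Type*} {l : Filter ι} {φ : ι → Pt → ℝ}
    (hφ : ∀ n, ContDiff ℝ ∞ (φ n))
    (h0 : Tendsto (fun n => eLpNorm (φ n) 2 (volume.restrict (tet v))) l (𝓝 0))
    (h1 : ∀ j, Tendsto (fun n => eLpNorm (fun x => fderiv ℝ (φ n) x (Pi.single j 1)) 2
      (volume.restrict (tet v))) l (𝓝 0)) :
    Tendsto (fun n => eLpNorm (φ n) 2 (faceMeasure v i)) l (𝓝 0) := by
  obtain ⟨K, hK, hKφ⟩ := exists_lintegral_face_le hv i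
  have hle : ∀ n, eLpNorm (φ n) 2 (faceMeasure v i) ^ 2 ≤
      K * (eLpNorm (φ n) 2 (volume.restrict (tet v)) ^ 2 + ∑ j,
        eLpNorm (fun x => fderiv ℝ (φ n) x (Pi.single j 1)) 2 (volume.restrict (tet v)) ^ 2) := by
    intro n
    simp only [eLpNorm_two_sq]
    refine (hKφ (φ n) (hφ n)).trans (le_of_eq ?_)
    congr 1
    have hm : ∀ j, Measurable fun x => ENNReal.ofReal (fderiv ℝ (φ n) x (Pi.single j 1) ^ 2) :=
      fun j => (((continuous_partial (hφ n) j).pow 2).measurable).ennreal_ofReal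
    rw [← lintegral_finsetSum _ fun j _ => hm j,
      ← lintegral_add_left (f := fun x => ENNReal.ofReal (φ n x ^ 2))
        (((hφ n).continuous.pow 2).measurable).ennreal_ofReal]
    refine lintegral_congr fun x => ?_
    rw [ENNReal.ofReal_add (sq_nonneg _) (Finset.sum_nonneg fun j _ => sq_nonneg _),
      ENNReal.ofReal_sum_of_nonneg fun j _ => sq_nonneg _]
  have hsq : ∀ {f : ι → ℝ≥0∞}, Tendsto f l (𝓝 0) → Tendsto (fun n => f n ^ 2) l (𝓝 0) := by
    intro f hf
    have := ((ENNReal.continuous_pow 2).tendsto 0).comp hf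
    rw [zero_pow two_ne_zero] at this
    exact this
  have hT : Tendsto (fun n => K * (eLpNorm (φ n) 2 (volume.restrict (tet v)) ^ 2 + ∑ j,
      eLpNorm (fun x => fderiv ℝ (φ n) x (Pi.single j 1)) 2 (volume.restrict (tet v)) ^ 2))
      l (𝓝 0) := by
    have h2 := tendsto_finsetSum Finset.univ fun j _ => hsq (h1 j)
    simpa using ENNReal.Tendsto.const_mul (a := K) ((hsq h0).add h2) (Or.inr hK)
  have hT2 : Tendsto (fun n => eLpNorm (φ n) 2 (faceMeasure v i) ^ 2) l (𝓝 0) :=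
    tendsto_of_tendsto_of_tendsto_of_le_of_le tendsto_const_nhds hT (fun _ => zero_le) hle
  have h3 := ((ENNReal.continuous_rpow_const (y := (1 / 2 : ℝ))).tendsto 0).comp hT2
  rw [ENNReal.zero_rpow_of_pos (by norm_num)] at h3
  refine h3.congr fun n => ?_
  simp only [Function.comp]
  rw [← ENNReal.rpow_natCast, ← ENNReal.rpow_mul]
  norm_num

theorem integrable_mul_of_memLp {u φ : Pt → ℝ} (hu : MemLp u 2 (volume.restrict (tet v)))
    (hφ : Continuous φ) : Integrable (fun x => u x * φ x) (volume.restrict (tet v)) :=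
  hu.integrable_mul (q := 2) (memLp_tet hφ)

theorem eq_zero_ae_of_weak {u : Pt → ℝ} (hu : MemLp u 2 (volume.restrict (tet v)))
    (h : ∀ φ : Pt → ℝ, ContDiff ℝ ∞ φ → HasCompactSupport φ → tsupport φ ⊆ interior (tet v) →
      ∫ x in tet v, u x * φ x = 0) : u =ᵐ[volume.restrict (tet v)] 0 := by
  have h1 : ∀ᵐ x ∂(volume.restrict (tet v)), x ∈ interior (tet v) → u x = 0 := by
    refine isOpen_interior.ae_eq_zero_of_integral_contDiff_smul_eq_zero
      ((hu.integrable one_le_two).locallyIntegrable.locallyIntegrableOn _) fun φ h1 h2 h3 => ?_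
    rw [← h φ h1 h2 h3]
    simp only [smul_eq_mul, mul_comm]
  filter_upwards [h1, ae_mem_interior_tet (v := v)] with x hx hx2
  exact hx hx2

theorem IsWeakPartial.ae_eq {j : Fin 3} {u g g' : Pt → ℝ}
    (hg : IsWeakPartial v j u g)
    (hg' : IsWeakPartial v j u g') : g =ᵐ[volume.restrict (tet v)] g' := by
  have h := eq_zero_ae_of_weak (hg.1.sub hg'.1) fun φ h1 h2 h3 => by
    have e1 := hg.2 φ h1 h2 h3
    have e2 := hg'.2 φ h1 h2 h3
    simp only [Pi.sub_apply, sub_mul]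
    rw [integral_sub (integrable_mul_of_memLp hg.1 h1.continuous)
      (integrable_mul_of_memLp hg'.1 h1.continuous)]
    linarith
  filter_upwards [h] with x hx
  exact sub_eq_zero.1 hx

theorem IsWeakPartial.lincomb {j : Fin 3} {u u' g g' : Pt → ℝ}
    (hu : MemLp u 2 (volume.restrict (tet v))) (hu' : MemLp u' 2 (volume.restrict (tet v)))
    (hg : IsWeakPartial v j u g) (hg' : IsWeakPartial v j u' g') (a b : ℝ) :
    IsWeakPartial v j (fun x => a * u x + b * u' x) fun x => a * g x + b * g' x := by
  refine ⟨(hg.1.const_mul a).add (hg'.1.const_mul b), fun φ h1 h2 h3 => ?_⟩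
  have c := continuous_partial h1 j
  simp only [add_mul, mul_assoc]
  rw [integral_add ((integrable_mul_of_memLp hu c).const_mul a)
      ((integrable_mul_of_memLp hu' c).const_mul b),
    integral_add ((integrable_mul_of_memLp hg.1 h1.continuous).const_mul a)
      ((integrable_mul_of_memLp hg'.1 h1.continuous).const_mul b)]
  simp only [integral_const_mul, hg.2 φ h1 h2 h3, hg'.2 φ h1 h2 h3]
  ring

theorem isWeakPartial_of_contDiff {φ : Pt → ℝ} (hφ : ContDiff ℝ ∞ φ) (j : Fin 3) :
    IsWeakPartial v j φ fun x => fderiv ℝ φ x (Pi.single j 1) := by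
  refine ⟨memLp_tet (continuous_partial hφ j), fun θ h1 h2 h3 => ?_⟩
  have h4 : tsupport θ ⊆ tet v := h3.trans interior_subset
  have e1 : ∫ x in tet v, φ x * fderiv ℝ θ x (Pi.single j 1)
      = ∫ x, fderiv ℝ θ x (Pi.single j 1) * φ x := by
    rw [setIntegral_eq_integral_of_forall_compl_eq_zero]
    · simp only [mul_comm]
    · intro x hx
      rw [fderiv_of_notMem_tsupport (𝕜 := ℝ) fun h => hx (h4 h)]
      simp
  have e2 : ∫ x in tet v, fderiv ℝ φ x (Pi.single j 1) * θ x
      = ∫ x, θ x * fderiv ℝ φ x (Pi.single j 1) := by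
    rw [setIntegral_eq_integral_of_forall_compl_eq_zero]
    · simp only [mul_comm]
    · intro x hx
      rw [image_eq_zero_of_notMem_tsupport fun h => hx (h4 h), mul_zero]
  rw [e1, e2, integral_fderiv_mul_eq h1 h2 hφ, neg_neg]

theorem memH1_of_contDiff {φ : Pt → ℝ} (hφ : ContDiff ℝ ∞ φ) : MemH1 v φ :=
  ⟨memLp_tet hφ.continuous, fun j => ⟨_, isWeakPartial_of_contDiff hφ j⟩⟩

include hv in
-- Mollifications of `u` converge in `L²`, and on the whole closed tetrahedron their derivatives are
-- `1 - ε` times the mollifications of the weak derivatives.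
theorem exists_smooth_approx {u : Pt → ℝ} (hu : MemLp u 2 (volume.restrict (tet v)))
    {g : Fin 3 → Pt → ℝ} (hg : ∀ j, IsWeakPartial v j u (g j)) :
    ∃ φ : ℕ → Pt → ℝ, (∀ n, ContDiff ℝ ∞ (φ n)) ∧
      Tendsto (fun n => eLpNorm (fun x => φ n x - u x) 2 (volume.restrict (tet v))) atTop (𝓝 0) ∧
      ∀ j, Tendsto (fun n => eLpNorm (fun x => fderiv ℝ (φ n) x (Pi.single j 1) - g j x) 2
        (volume.restrict (tet v))) atTop (𝓝 0) := by
  obtain ⟨c, hc⟩ := interior_tet_nonempty hv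
  obtain ⟨R, hR, hball⟩ := Metric.nhds_basis_closedBall.mem_iff.1 (isOpen_interior.mem_nhds hc)
  let b : ContDiffBump c := ⟨R / 2, R, half_pos hR, half_lt_self hR⟩
  have hb : Metric.closedBall c b.rOut ⊆ interior (tet v) := hball
  have hui := hu.integrable one_le_two
  refine ⟨fun n => moll v b (scale n) u, fun n => contDiff_moll b (scale_pos n) hui,
    tendsto_moll b hb hu, fun j => ?_⟩
  have hgi := (hg j).1.integrable one_le_two
  have hmm : ∀ n, AEStronglyMeasurable (fun x => moll v b (scale n) (g j) x)
      (volume.restrict (tet v)) := fun n =>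
    (contDiff_moll b (scale_pos n) hgi).continuous.aestronglyMeasurable
  have h1 := tendsto_moll b hb (hg j).1
  -- With `m` the mollification of `g j`, the error is split as `(1 - ε) m - g = (m - g) - ε g - ε
  -- (m - g)`.
  have h2 : Tendsto (fun n => eLpNorm (fun x => scale n * g j x) 2 (volume.restrict (tet v)))
      atTop (𝓝 0) := by
    have h3 : Tendsto (fun n => ‖scale n‖ₑ * eLpNorm (g j) 2 (volume.restrict (tet v))) atTop
        (𝓝 (‖(0 : ℝ)‖ₑ * eLpNorm (g j) 2 (volume.restrict (tet v)))) :=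
      ENNReal.Tendsto.mul_const (tendsto_scale.enorm) (Or.inr (hg j).1.2.ne)
    rw [enorm_zero, zero_mul] at h3
    exact h3.congr fun n => (eLpNorm_const_smul (scale n) (g j) 2 _).symm
  have h4 := tendsto_eLpNorm_lincomb (fun n => (hmm n).sub (hg j).1.1)
    (fun n => (hg j).1.1.const_mul (scale n)) h1 h2 1 (-1)
  have h5 : Tendsto (fun n => eLpNorm (fun x => (1 - scale n) * moll v b (scale n) (g j) x - g j x)
      2 (volume.restrict (tet v))) atTop (𝓝 0) := by
    have h6 : Tendsto (fun n => eLpNorm (fun x =>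
        scale n * (moll v b (scale n) (g j) x - g j x)) 2 (volume.restrict (tet v)))
        atTop (𝓝 0) := by
      have h3 := ENNReal.Tendsto.mul tendsto_scale.enorm (Or.inr (by simp)) h1 (Or.inr (by simp))
      rw [mul_zero] at h3
      exact h3.congr fun n => (eLpNorm_const_smul (scale n) (fun x =>
        moll v b (scale n) (g j) x - g j x) 2 _).symm
    have h7 := tendsto_eLpNorm_lincomb
      (fun n => (((hmm n).sub (hg j).1.1).const_mul 1).add
        (((hg j).1.1.const_mul (scale n)).const_mul (-1)))
      (fun n => ((hmm n).sub (hg j).1.1).const_mul (scale n)) h4 h6 1 (-1)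
    refine h7.congr fun n => ?_
    congr 1
    funext x
    simp only [Pi.add_apply, Pi.sub_apply]
    ring
  refine h5.congr fun n => eLpNorm_congr_ae ?_
  refine (ae_restrict_iff' measurableSet_tet).2 (ae_of_all _ fun x hx => ?_)
  have := fderiv_moll_weak b hb (scale_pos n) ((scale_le n).trans (by norm_num)) hui (hg j) hx
  simp only [this]

theorem fderiv_lincomb {φ ψ : Pt → ℝ} (hφ : ContDiff ℝ ∞ φ) (hψ : ContDiff ℝ ∞ ψ) (a b : ℝ)
    (x y : Pt) : fderiv ℝ (fun x => a * φ x + b * ψ x) x y =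
      a * fderiv ℝ φ x y + b * fderiv ℝ ψ x y := by
  have h1 := ((hφ.differentiable (by simp)) x).hasFDerivAt.const_mul a
  have h2 := ((hψ.differentiable (by simp)) x).hasFDerivAt.const_mul b
  rw [(h1.fun_add h2).fderiv]
  simp

theorem contDiff_lincomb {φ ψ : Pt → ℝ} (hφ : ContDiff ℝ ∞ φ) (hψ : ContDiff ℝ ∞ ψ) (a b : ℝ) :
    ContDiff ℝ ∞ fun x => a * φ x + b * ψ x :=
  (contDiff_const.mul hφ).add (contDiff_const.mul hψ)

include hv in
/-- Smooth functions with a common limit in `H¹` have differences that converge to zero on the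
faces. -/
theorem tendsto_eLpNorm_face_sub (i : Fin 4) {ι : Type*} {l : Filter ι} {φ ψ : ι → Pt → ℝ}
    (hφ : ∀ n, ContDiff ℝ ∞ (φ n)) (hψ : ∀ n, ContDiff ℝ ∞ (ψ n)) {u : Pt → ℝ}
    {g : Fin 3 → Pt → ℝ}
    (hu : AEStronglyMeasurable u (volume.restrict (tet v)))
    (hg : ∀ j, AEStronglyMeasurable (g j) (volume.restrict (tet v)))
    (h0 : Tendsto (fun n => eLpNorm (fun x => φ n x - u x) 2 (volume.restrict (tet v))) l (𝓝 0))
    (h0' : Tendsto (fun n => eLpNorm (fun x => ψ n x - u x) 2 (volume.restrict (tet v))) l (𝓝 0))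
    (h1 : ∀ j, Tendsto (fun n => eLpNorm (fun x => fderiv ℝ (φ n) x (Pi.single j 1) - g j x) 2
      (volume.restrict (tet v))) l (𝓝 0))
    (h1' : ∀ j, Tendsto (fun n => eLpNorm (fun x => fderiv ℝ (ψ n) x (Pi.single j 1) - g j x) 2
      (volume.restrict (tet v))) l (𝓝 0)) :
    Tendsto (fun n => eLpNorm (fun x => φ n x - ψ n x) 2 (faceMeasure v i)) l (𝓝 0) := by
  have key := tendsto_eLpNorm_face hv i (l := l)
    (φ := fun n x => 1 * φ n x + -1 * ψ n x) (fun n => contDiff_lincomb (hφ n) (hψ n) _ _) ?_ ?_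
  · refine key.congr fun n => ?_
    congr 1
    funext x
    ring
  · refine (tendsto_eLpNorm_lincomb (fun n => (hφ n).continuous.aestronglyMeasurable.sub hu)
      (fun n => (hψ n).continuous.aestronglyMeasurable.sub hu) h0 h0' 1 (-1)).congr fun n => ?_
    congr 1
    funext x
    simp only [Pi.sub_apply]
    ring
  · intro j
    refine (tendsto_eLpNorm_lincomb
      (fun n => (continuous_partial (hφ n) j).aestronglyMeasurable.sub (hg j))
      (fun n => (continuous_partial (hψ n) j).aestronglyMeasurable.sub (hg j))
      (h1 j) (h1' j) 1 (-1)).congr fun n => ?_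
    congr 1
    funext x
    rw [fderiv_lincomb (hφ n) (hψ n)]
    simp only [Pi.sub_apply]
    ring

include hv in
-- By the trace inequality the smooth approximations form a Cauchy sequence in `L²` of the face; the
-- trace is its limit.
theorem exists_isFaceTrace (i : Fin 4) {u : Pt → ℝ} (hu : MemH1 v u) :
    ∃ γ, IsFaceTrace v i u γ := by
  choose g hg using hu.2
  obtain ⟨φ, hφ, h0, h1⟩ := exists_smooth_approx hv hu.1 hg
  have hmem : ∀ n, MemLp (φ n) 2 (faceMeasure v i) := fun n => memLp_face (hφ n).continuous i
  have hcau : CauchySeq fun n => (hmem n).toLp (φ n) := by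
    rw [Lp.cauchySeq_Lp_iff_cauchySeq_eLpNorm, ← prod_atTop_atTop_eq]
    have h := tendsto_eLpNorm_face_sub hv i (l := atTop ×ˢ atTop)
      (φ := fun n : ℕ × ℕ => φ n.1) (ψ := fun n => φ n.2) (fun n => hφ _) (fun n => hφ _)
      hu.1.1 (fun j => (hg j).1.1) (h0.comp tendsto_fst) (h0.comp tendsto_snd)
      (fun j => (h1 j).comp tendsto_fst) (fun j => (h1 j).comp tendsto_snd)
    refine h.congr fun n => eLpNorm_congr_ae ?_
    filter_upwards [(hmem n.1).coeFn_toLp, (hmem n.2).coeFn_toLp] with x e1 e2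
    simp only [Pi.sub_apply, e1, e2]
  obtain ⟨γ, hγ⟩ := cauchySeq_tendsto_of_complete hcau
  refine ⟨γ, Lp.memLp γ, φ, g, hφ, hg, h0, h1, ?_⟩
  rw [Lp.tendsto_Lp_iff_tendsto_eLpNorm'] at hγ
  refine hγ.congr fun n => eLpNorm_congr_ae ?_
  filter_upwards [(hmem n).coeFn_toLp] with x e1
  simp only [Pi.sub_apply, e1]

/-- Weak derivatives are unique, so the two approximating sequences have the same limit in `H¹` and
their difference tends to zero on the face. -/
theorem IsFaceTrace.ae_eq (hv : AffineIndependent ℝ v) {i : Fin 4} {u γ γ' : Pt → ℝ}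
    (hu : MemLp u 2 (volume.restrict (tet v)))
    (h : IsFaceTrace v i u γ) (h' : IsFaceTrace v i u γ') : γ =ᵐ[faceMeasure v i] γ' := by
  obtain ⟨hγ, φ, g, hφ, hg, h0, h1, h2⟩ := h
  obtain ⟨hγ', ψ, g', hψ, hg', h0', h1', h2'⟩ := h'
  have h1'' : ∀ j, Tendsto (fun n => eLpNorm (fun x => fderiv ℝ (ψ n) x (Pi.single j 1) - g j x) 2
      (volume.restrict (tet v))) atTop (𝓝 0) := fun j =>
    (h1' j).congr fun n => eLpNorm_congr_ae <| ((hg' j).ae_eq (hg j)).mono fun x hx => by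
      simp only [hx]
  have h3 := tendsto_eLpNorm_face_sub hv i hφ hψ hu.1 (fun j => (hg j).1.1) h0 h0' h1 h1''
  have m1 : ∀ n, AEStronglyMeasurable (fun x => φ n x - γ x) (faceMeasure v i) := fun n =>
    (hφ n).continuous.aestronglyMeasurable.sub hγ.1
  have m2 : ∀ n, AEStronglyMeasurable (fun x => ψ n x - γ' x) (faceMeasure v i) := fun n =>
    (hψ n).continuous.aestronglyMeasurable.sub hγ'.1
  have m3 : ∀ n, AEStronglyMeasurable (fun x => φ n x - ψ n x) (faceMeasure v i) := fun n =>
    ((hφ n).continuous.sub (hψ n).continuous).aestronglyMeasurable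
  have h4 := tendsto_eLpNorm_lincomb m2 m1 h2' h2 1 (-1)
  have h5 := tendsto_eLpNorm_lincomb (fun n => ((m2 n).const_mul 1).add ((m1 n).const_mul (-1)))
    m3 h4 h3 1 1
  have h6 : Tendsto (fun _ : ℕ => eLpNorm (γ - γ') 2 (faceMeasure v i)) atTop (𝓝 0) := by
    refine h5.congr fun n => ?_
    congr 1
    funext x
    simp only [Pi.add_apply, Pi.sub_apply]
    ring
  have h7 := tendsto_nhds_unique tendsto_const_nhds h6
  rw [eLpNorm_eq_zero_iff (hγ.sub hγ').1 two_ne_zero] at h7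
  filter_upwards [h7] with x hx
  exact sub_eq_zero.1 hx

theorem isFaceTrace_of_contDiff (i : Fin 4) {φ : Pt → ℝ} (hφ : ContDiff ℝ ∞ φ) :
    IsFaceTrace v i φ φ :=
  ⟨memLp_face hφ.continuous i, fun _ => φ, fun j x => fderiv ℝ φ x (Pi.single j 1), fun _ => hφ,
    fun j => isWeakPartial_of_contDiff hφ j, by simp, by simp, by simp⟩

theorem IsFaceTrace.lincomb {i : Fin 4} {u u' γ γ' : Pt → ℝ}
    (hu : MemLp u 2 (volume.restrict (tet v))) (hu' : MemLp u' 2 (volume.restrict (tet v)))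
    (h : IsFaceTrace v i u γ) (h' : IsFaceTrace v i u' γ') (a b : ℝ) :
    IsFaceTrace v i (fun x => a * u x + b * u' x) fun x => a * γ x + b * γ' x := by
  obtain ⟨hγ, φ, g, hφ, hg, h0, h1, h2⟩ := h
  obtain ⟨hγ', ψ, g', hψ, hg', h0', h1', h2'⟩ := h'
  refine ⟨(hγ.const_mul a).add (hγ'.const_mul b), fun n x => a * φ n x + b * ψ n x,
    fun j x => a * g j x + b * g' j x, fun n => contDiff_lincomb (hφ n) (hψ n) a b,
    fun j => (hg j).lincomb hu hu' (hg' j) a b, ?_, fun j => ?_, ?_⟩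
  · refine (tendsto_eLpNorm_lincomb (fun n => (hφ n).continuous.aestronglyMeasurable.sub hu.1)
      (fun n => (hψ n).continuous.aestronglyMeasurable.sub hu'.1) h0 h0' a b).congr fun n => ?_
    congr 1
    funext x
    simp only [Pi.sub_apply]
    ring
  · refine (tendsto_eLpNorm_lincomb
      (fun n => (continuous_partial (hφ n) j).aestronglyMeasurable.sub (hg j).1.1)
      (fun n => (continuous_partial (hψ n) j).aestronglyMeasurable.sub (hg' j).1.1)
      (h1 j) (h1' j) a b).congr fun n => ?_
    congr 1
    funext x
    rw [fderiv_lincomb (hφ n) (hψ n)]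
    simp only [Pi.sub_apply]
    ring
  · refine (tendsto_eLpNorm_lincomb (fun n => (hφ n).continuous.aestronglyMeasurable.sub hγ.1)
      (fun n => (hψ n).continuous.aestronglyMeasurable.sub hγ'.1) h2 h2' a b).congr fun n => ?_
    congr 1
    funext x
    simp only [Pi.sub_apply]
    ring

/-! ### Weak divergences -/

theorem IsWeakDiv.lincomb {U U' : Pt → Mat} {D D' : Pt → Pt}
    (hU : ∀ i j, MemLp (fun x => U x i j) 2 (volume.restrict (tet v)))
    (hU' : ∀ i j, MemLp (fun x => U' x i j) 2 (volume.restrict (tet v)))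
    (h : IsWeakDiv v U D) (h' : IsWeakDiv v U' D') (a b : ℝ) :
    IsWeakDiv v (fun x => a • U x + b • U' x) fun x => a • D x + b • D' x := by
  intro i
  obtain ⟨h1, h2⟩ := h i
  obtain ⟨h1', h2'⟩ := h' i
  refine ⟨(h1.const_mul a).add (h1'.const_mul b), fun φ p1 p2 p3 => ?_⟩
  have I1 : Integrable (fun x => ∑ j, U x i j * fderiv ℝ φ x (Pi.single j 1))
      (volume.restrict (tet v)) := integrable_finsetSum _ fun j _ =>
    integrable_mul_of_memLp (hU i j) (continuous_partial p1 j)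
  have I2 : Integrable (fun x => ∑ j, U' x i j * fderiv ℝ φ x (Pi.single j 1))
      (volume.restrict (tet v)) := integrable_finsetSum _ fun j _ =>
    integrable_mul_of_memLp (hU' i j) (continuous_partial p1 j)
  have e : ∀ x, ∑ j, (a • U x + b • U' x) i j * fderiv ℝ φ x (Pi.single j 1) =
      a * (∑ j, U x i j * fderiv ℝ φ x (Pi.single j 1)) +
      b * ∑ j, U' x i j * fderiv ℝ φ x (Pi.single j 1) := by
    intro x
    rw [Finset.mul_sum, Finset.mul_sum, ← Finset.sum_add_distrib]
    refine Finset.sum_congr rfl fun j _ => ?_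
    simp only [Matrix.add_apply, Matrix.smul_apply, smul_eq_mul]
    ring
  simp only [e, Pi.add_apply, Pi.smul_apply, smul_eq_mul, add_mul, mul_assoc]
  rw [integral_add (I1.const_mul a) (I2.const_mul b),
    integral_add ((integrable_mul_of_memLp h1 p1.continuous).const_mul a)
      ((integrable_mul_of_memLp h1' p1.continuous).const_mul b)]
  simp only [integral_const_mul, h2 φ p1 p2 p3, h2' φ p1 p2 p3]
  ring

theorem IsWeakDiv.ae_eq {U : Pt → Mat} {D D' : Pt → Pt}
    (h : IsWeakDiv v U D) (h' : IsWeakDiv v U D') :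
    ∀ᵐ x ∂(volume.restrict (tet v)), D x = D' x := by
  have key : ∀ i, ∀ᵐ x ∂(volume.restrict (tet v)), D x i = D' x i := by
    intro i
    have h := eq_zero_ae_of_weak ((h i).1.sub (h' i).1) fun φ h1 h2 h3 => by
      have e1 := (h i).2 φ h1 h2 h3
      have e2 := (h' i).2 φ h1 h2 h3
      simp only [Pi.sub_apply, sub_mul]
      rw [integral_sub (integrable_mul_of_memLp (h i).1 h1.continuous)
        (integrable_mul_of_memLp (h' i).1 h1.continuous)]
      linarith
    filter_upwards [h] with x hx
    exact sub_eq_zero.1 hx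
  filter_upwards [ae_all_iff.2 key] with x hx
  exact funext hx

theorem isWeakDiv_of_partial {U : Pt → Mat} {G : Fin 3 → Fin 3 → Pt → ℝ}
    (hU : ∀ i j, MemLp (fun x => U x i j) 2 (volume.restrict (tet v)))
    (hG : ∀ i j, IsWeakPartial v j (fun x => U x i j) (G i j)) :
    IsWeakDiv v U fun x i => ∑ j, G i j x := by
  intro i
  refine ⟨memLp_finsetSum _ fun j _ => (hG i j).1, fun φ h1 h2 h3 => ?_⟩
  simp only [Finset.sum_mul]
  rw [integral_finsetSum _ fun j _ => integrable_mul_of_memLp (hU i j) (continuous_partial h1 j),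
    integral_finsetSum _ fun j _ => integrable_mul_of_memLp (hG i j).1 h1.continuous,
    ← Finset.sum_neg_distrib]
  exact Finset.sum_congr rfl fun j _ => (hG i j).2 φ h1 h2 h3

theorem exists_isWeakDiv {U : Pt → Mat} (hU : U ∈ H1Mat v) : ∃ D, IsWeakDiv v U D := by
  choose G hG using fun i j => (hU i j).2
  exact ⟨_, isWeakDiv_of_partial (fun i j => (hU i j).1) fun i j => hG i j j⟩

theorem evalMat_mem_H1Mat (P : MatPoly) : evalMat P ∈ H1Mat v := fun i j =>
  memH1_of_contDiff (contDiff_eval (P i j))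

/-- The row-wise divergence of a polynomial matrix field. -/
def divMat (P : MatPoly) : VecPoly := fun i => pdiv (P i)

theorem isWeakDiv_evalMat (P : MatPoly) : IsWeakDiv v (evalMat P) (evalVec (divMat P)) := by
  have h := isWeakDiv_of_partial (v := v) (U := evalMat P)
    (G := fun i j x => eval x (pderiv j (P i j)))
    (fun i j => memLp_tet (contDiff_eval (P i j)).continuous) fun i j => by
      have := isWeakPartial_of_contDiff (v := v) (contDiff_eval (P i j)) j
      simp only [fderiv_eval] at this
      exact this
  have e : (fun (x : Pt) (i : Fin 3) => ∑ j, eval x (pderiv j (P i j))) = evalVec (divMat P) := by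
    funext x i
    simp [evalVec, divMat, pdiv]
  rwa [e] at h

end MixedElasticity

end

/-! ### Moments of bubbles in the interior -/

noncomputable section

namespace MixedElasticity

open MvPolynomial (C X eval pderiv)

variable {v : Fin 4 → Pt} (hv : AffineIndependent ℝ v)

/-! ### Integrals of polynomials -/

/-- The integral over the tetrahedron, as a functional on polynomials. -/
def tetInt (v : Fin 4 → Pt) : Poly →ₗ[ℝ] ℝ where
  toFun p := ∫ x in tet v, eval x p
  map_add' p q := by
    simp only [map_add]
    exact integral_add (integrable_tet (continuous_eval p)) (integrable_tet (continuous_eval q))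
  map_smul' c p := by
    simp only [MvPolynomial.smul_eval, RingHom.id_apply, smul_eq_mul, integral_const_mul]

/-- The integral over a face, as a functional on polynomials. -/
def faceInt (v : Fin 4 → Pt) (i : Fin 4) : Poly →ₗ[ℝ] ℝ where
  toFun p := ∫ x, eval x p ∂faceMeasure v i
  map_add' p q := by
    simp only [map_add]
    exact integral_add (integrable_face (continuous_eval p) i)
      (integrable_face (continuous_eval q) i)
  map_smul' c p := by
    simp only [MvPolynomial.smul_eval, RingHom.id_apply, smul_eq_mul, integral_const_mul]

theorem frob_eq_sum (A B : Mat) : frob A B = ∑ i, A i ⬝ᵥ B i := by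
  simp [frob, Matrix.trace, Matrix.mul_apply, dotProduct]

/-- The `L²` product of polynomial matrix fields. -/
def frobInt (v : Fin 4 → Pt) : MatPoly →ₗ[ℝ] MatPoly →ₗ[ℝ] ℝ :=
  LinearMap.mk₂ ℝ (fun A B => tetInt v (∑ i, ∑ j, A i j * B i j))
    (fun A A' B => by simp only [Matrix.add_apply, add_mul, Finset.sum_add_distrib, map_add])
    (fun c A B => by
      simp only [Matrix.smul_apply, smul_mul_assoc, ← Finset.smul_sum, map_smul])
    (fun A B B' => by simp only [Matrix.add_apply, mul_add, Finset.sum_add_distrib, map_add])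
    (fun c A B => by
      simp only [Matrix.smul_apply, mul_smul_comm, ← Finset.smul_sum, map_smul])

theorem frobInt_eq (A B : MatPoly) :
    frobInt v A B = ∫ x in tet v, frob (evalMat A x) (evalMat B x) := by
  change ∫ x in tet v, eval x (∑ i, ∑ j, A i j * B i j) = _
  simp only [frob_eq_sum, evalMat, dotProduct, map_sum, map_mul]

theorem pdiv_add (u w : VecPoly) : pdiv (u + w) = pdiv u + pdiv w := by
  simp [pdiv, Finset.sum_add_distrib]

theorem pdiv_smul (c : ℝ) (u : VecPoly) : pdiv (c • u) = c • pdiv u := by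
  simp [pdiv, Finset.smul_sum]

theorem divMat_add (A B : MatPoly) : divMat (A + B) = divMat A + divMat B :=
  funext fun i => pdiv_add (A i) (B i)

theorem divMat_smul (c : ℝ) (A : MatPoly) : divMat (c • A) = c • divMat A :=
  funext fun i => pdiv_smul c (A i)

/-- The `L²` product of the divergence of a matrix field with a vector field. -/
def divInt (v : Fin 4 → Pt) : MatPoly →ₗ[ℝ] VecPoly →ₗ[ℝ] ℝ :=
  LinearMap.mk₂ ℝ (fun A η => tetInt v (∑ i, divMat A i * η i))
    (fun A A' B => by
      simp only [divMat_add, Pi.add_apply, add_mul, Finset.sum_add_distrib, map_add])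
    (fun c A B => by
      simp only [divMat_smul, Pi.smul_apply, smul_mul_assoc, ← Finset.smul_sum, map_smul])
    (fun A B B' => by simp only [Pi.add_apply, mul_add, Finset.sum_add_distrib, map_add])
    (fun c A B => by
      simp only [Pi.smul_apply, mul_smul_comm, ← Finset.smul_sum, map_smul])

theorem divInt_eq (A : MatPoly) (η : VecPoly) :
    divInt v A η = ∫ x in tet v, evalVec (divMat A) x ⬝ᵥ evalVec η x := by
  change ∫ x in tet v, eval x (∑ i, divMat A i * η i) = _
  simp only [evalVec, dotProduct, map_sum, map_mul]

/-- Integration by parts in every row. It makes the divergence condition one on moments against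
gradients. -/
theorem divInt_eq_neg {A : MatPoly}
    (h0 : ∀ k, ∀ i, ∀ x ∈ face v i, dlam hv i ⬝ᵥ evalVec (A k) x = 0) (η : VecPoly) :
    divInt v A η = - frobInt v A (grad η) := by
  have h : ∀ k, tetInt v (divMat A k * η k) = -tetInt v (∑ j, A k j * pderiv j (η k)) := by
    intro k
    change ∫ x in tet v, eval x (divMat A k * η k) =
      -∫ x in tet v, eval x (∑ j, A k j * pderiv j (η k))
    simp only [map_mul, map_sum]
    exact integral_pdiv_mul hv (h0 k) (η k)
  simp only [divInt, frobInt, LinearMap.mk₂_apply]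
  rw [map_sum, map_sum, ← Finset.sum_neg_distrib]
  exact Finset.sum_congr rfl fun k _ => h k

/-! ### Fields of mean value zero -/

/-- `meanZero` as a subspace. -/
def meanZeroSub (v : Fin 4 → Pt) (r : ℕ) : Submodule ℝ VecPoly where
  carrier := meanZero v r
  zero_mem' := ⟨Submodule.zero_mem _, fun i => by simp⟩
  add_mem' := by
    rintro a b ⟨ha, ha'⟩ ⟨hb, hb'⟩
    refine ⟨Submodule.add_mem _ ha hb, fun i => ?_⟩
    have := (tetInt v).map_add (a i) (b i)
    exact this.trans ((congrArg₂ _ (ha' i) (hb' i)).trans (add_zero 0))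
  smul_mem' := by
    rintro c a ⟨ha, ha'⟩
    refine ⟨Submodule.smul_mem _ c ha, fun i => ?_⟩
    have := (tetInt v).map_smul c (a i)
    exact this.trans ((congrArg _ (ha' i)).trans (smul_zero c))

theorem meanZeroSub_le (r : ℕ) : meanZeroSub v r ≤ vecDeg r := fun _ h => h.1

instance (r : ℕ) : FiniteDimensional ℝ (meanZeroSub v r) :=
  Submodule.finiteDimensional_of_le (meanZeroSub_le r)

include hv in
theorem tetInt_one_pos : 0 < tetInt v 1 := by
  have h0 : 0 ≤ tetInt v 1 := integral_nonneg fun x => by simp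
  refine lt_of_le_of_ne h0 fun h => ?_
  have := eq_zero_of_integral_tet hv (f := fun _ => 1) continuous_const (fun _ _ => zero_le_one)
    (by simpa [tetInt] using h.symm) (v 0) (subset_convexHull ℝ _ ⟨0, rfl⟩)
  exact one_ne_zero this

theorem tetInt_C (c : ℝ) : tetInt v (C c) = c * tetInt v 1 := by
  rw [← mul_one (C c), ← MvPolynomial.smul_eq_C_mul, map_smul, smul_eq_mul]

theorem eq_C_of_pderiv_eq_zero {p : Poly} (h : ∀ j, pderiv j p = 0) : p = C (eval 0 p) := by
  refine MvPolynomial.funext fun x => ?_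
  have h1 : ∀ x, fderiv ℝ (fun x : Pt => eval x p) x = 0 := fun x => by
    rw [(hasFDerivAt_eval p x).fderiv]
    simp [h]
  rw [MvPolynomial.eval_C]
  exact is_const_of_fderiv_eq_zero
    (fun x => (hasFDerivAt_eval p x).differentiableAt) h1 x 0

include hv in
theorem eq_zero_of_grad_eq_zero {r : ℕ} {η : VecPoly} (hη : η ∈ meanZeroSub v r)
    (h : grad η = 0) : η = 0 := by
  funext i
  have h1 := eq_C_of_pderiv_eq_zero (p := η i) fun j => congrFun (congrFun h i) j
  have h2 : tetInt v (η i) = 0 := hη.2 i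
  rw [h1, tetInt_C] at h2
  rcases mul_eq_zero.1 h2 with h2 | h2
  · rw [h1, h2, C.map_zero]; rfl
  · exact absurd h2 (tetInt_one_pos hv).ne'

include hv in
theorem exists_meanZero_grad_eq {r : ℕ} {η : VecPoly} (hη : η ∈ vecDeg r) :
    ∃ ξ ∈ meanZeroSub v r, grad ξ = grad η := by
  refine ⟨η - fun i => C (tetInt v (η i) / tetInt v 1), ⟨Submodule.sub_mem _ hη
    (mem_vecDeg.2 fun i => C_mem_polyDeg (by positivity) _), fun i => ?_⟩, ?_⟩
  · have : tetInt v (η i - C (tetInt v (η i) / tetInt v 1)) = 0 := by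
      rw [map_sub, tetInt_C, div_mul_cancel₀ _ (tetInt_one_pos hv).ne', sub_self]
    exact this
  · ext1 i j
    simp [grad]

/-! ### Unisolvence for bubbles -/

section Bubble

variable {k : ℕ}

/-- The fields `J q` with `q` of degree at most `r - 1` are uniquely determined by arbitrary
prescribed moments. -/
def BubbleUnisolvent (v : Fin 4 → Pt) (r : ℕ) (J : MatPoly →ₗ[ℝ] MatPoly) (h : Fin k → MatPoly) :
    Prop :=
  (∀ (a : Module.Dual ℝ VecPoly) (b : Fin k → ℝ), ∃ q ∈ matDeg ((r : ℤ) - 1),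
    (∀ η ∈ meanZero v r, divInt v (J q) η = a η) ∧ ∀ l, frobInt v (J q) (h l) = b l) ∧
  ∀ q ∈ matDeg ((r : ℤ) - 1), (∀ η ∈ meanZero v r, divInt v (J q) η = 0) →
    (∀ l, frobInt v (J q) (h l) = 0) → q = 0

/-- The moments of the fields `J q`. -/
def bubbleMoments (v : Fin 4 → Pt) (r : ℕ) (J : MatPoly →ₗ[ℝ] MatPoly) (h : Fin k → MatPoly) :
    matDeg ((r : ℤ) - 1) →ₗ[ℝ] Module.Dual ℝ (meanZeroSub v r) × (Fin k → ℝ) :=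
  LinearMap.prod
    ((meanZeroSub v r).subtype.dualMap ∘ₗ divInt v ∘ₗ J ∘ₗ (matDeg ((r : ℤ) - 1)).subtype)
    (LinearMap.pi fun l => (frobInt v).flip (h l) ∘ₗ J ∘ₗ (matDeg ((r : ℤ) - 1)).subtype)

theorem bubbleUnisolvent_of_bijective {r : ℕ} {J : MatPoly →ₗ[ℝ] MatPoly} {h : Fin k → MatPoly}
    (hb : Function.Bijective (bubbleMoments v r J h)) : BubbleUnisolvent v r J h := by
  refine ⟨fun a b => ?_, fun q hq h1 h2 => ?_⟩
  · obtain ⟨q, hq⟩ := hb.2 ((meanZeroSub v r).subtype.dualMap a, b)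
    refine ⟨q, q.2, fun η hη => ?_, fun l => ?_⟩
    · exact LinearMap.congr_fun (congrArg Prod.fst hq) ⟨η, hη⟩
    · exact congrFun (congrArg Prod.snd hq) l
  · have := hb.1 (a₁ := ⟨q, hq⟩) (a₂ := 0) (by
      rw [map_zero]
      refine Prod.ext (LinearMap.ext fun η => h1 η η.2) (funext fun l => h2 l))
    exact congrArg Subtype.val this

/-- The divergence component is the same for all test fields and the weights `1 - t` and `t` add up
to one, so the moment maps form an affine pencil. -/
theorem bubbleMoments_interp (r : ℕ) (J : MatPoly →ₗ[ℝ] MatPoly) (f g : Fin k → MatPoly) (t : ℝ) :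
    bubbleMoments v r J (interp f g t) =
      (1 - t) • bubbleMoments v r J f + t • bubbleMoments v r J g := by
  refine LinearMap.ext fun q => Prod.ext ?_ (funext fun l => ?_)
  · refine LinearMap.ext fun η => ?_
    change divInt v (J q) η = (1 - t) * divInt v (J q) η + t * divInt v (J q) η
    ring
  · simp [bubbleMoments, interp]

/-- Let `N = B⁻¹ A`. If the map at `t` is singular, then `t ≠ 1` and `-t / (1 - t)` is an eigenvalue
`μ` of `N`, so that `t = μ / (μ - 1)`. An endomorphism of a finite-dimensional space has finitely
many eigenvalues. -/
theorem finite_not_bijective {E F : Type*} [AddCommGroup E] [Module ℝ E] [FiniteDimensional ℝ E]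
    [AddCommGroup F] [Module ℝ F] (A B : E →ₗ[ℝ] F) (hB : Function.Bijective B) :
    {t : ℝ | ¬ Function.Bijective ((1 - t) • A + t • B : E →ₗ[ℝ] F)}.Finite := by
  let e : E ≃ₗ[ℝ] F := LinearEquiv.ofBijective B hB
  let N : Module.End ℝ E := e.symm.toLinearMap ∘ₗ A
  refine ((Module.End.finite_hasEigenvalue N).image fun μ => μ / (μ - 1)).subset fun t ht => ?_
  have hinj : ¬ Function.Injective ((1 - t) • N + t • LinearMap.id : E →ₗ[ℝ] E) := by
    intro hi
    refine ht ?_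
    have hb : Function.Bijective ((1 - t) • N + t • LinearMap.id : E →ₗ[ℝ] E) :=
      ⟨hi, LinearMap.injective_iff_surjective.1 hi⟩
    have e1 : ((1 - t) • A + t • B : E →ₗ[ℝ] F) =
        e.toLinearMap ∘ₗ ((1 - t) • N + t • LinearMap.id) := by
      ext x
      simp [N, e]
    rw [e1]
    exact e.bijective.comp hb
  rw [injective_iff_map_eq_zero] at hinj
  push Not at hinj
  obtain ⟨x, hx, hx0⟩ := hinj
  simp only [LinearMap.add_apply, LinearMap.smul_apply, LinearMap.id_apply] at hx
  have ht1 : 1 - t ≠ 0 := by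
    intro h
    have h1 : t = 1 := by linarith
    rw [h, h1, zero_smul, zero_add, one_smul] at hx
    exact hx0 hx
  refine ⟨-t / (1 - t), Module.End.hasEigenvalue_of_hasEigenvector
    (Module.End.hasEigenvector_iff.2 ⟨Module.End.mem_eigenspace_iff.2 ?_, hx0⟩), ?_⟩
  · have h2 : N x = (1 - t)⁻¹ • ((1 - t) • N x) := by rw [smul_smul, inv_mul_cancel₀ ht1, one_smul]
    rw [h2, eq_neg_of_add_eq_zero_left hx, smul_neg, smul_smul, ← neg_smul]
    congr 1
    field_simp
  · field_simp
    ring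

variable {r : ℕ} {J : MatPoly →ₗ[ℝ] MatPoly} {g : Fin k → MatPoly}

/-- If all moments of `J q` vanish, integration by parts shows that `J q` is orthogonal to the
gradients as well as to the `g l`. Together these span the fields of degree at most `r - 1`, and
`hd` gives `q = 0`. -/
theorem bubbleMoments_bijective
    (hn : ∀ q, ∀ k, ∀ i, ∀ x ∈ face v i, dlam hv i ⬝ᵥ evalVec (J q k) x = 0)
    (hd : ∀ q ∈ matDeg ((r : ℤ) - 1), (∀ p ∈ matDeg ((r : ℤ) - 1), frobInt v (J q) p = 0) → q = 0)
    (hg : LinearIndependent ℝ g)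
    (hdisj : Disjoint (Submodule.span ℝ (Set.range g)) (gradSpace r))
    (hsup : Submodule.span ℝ (Set.range g) ⊔ gradSpace r = matDeg ((r : ℤ) - 1)) :
    Function.Bijective (bubbleMoments v r J g) := by
  have hinj : Function.Injective (bubbleMoments v r J g) := by
    rw [injective_iff_map_eq_zero]
    intro q hq
    have h1 : ∀ η ∈ meanZeroSub v r, divInt v (J q) η = 0 := fun η hη =>
      LinearMap.congr_fun (congrArg Prod.fst hq) ⟨η, hη⟩
    have h2 : ∀ l, frobInt v (J q) (g l) = 0 := fun l => congrFun (congrArg Prod.snd hq) l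
    refine Subtype.ext (hd q q.2 fun p hp => ?_)
    have h3 : Submodule.span ℝ (Set.range g) ⊔ gradSpace r ≤ LinearMap.ker (frobInt v (J q)) := by
      refine sup_le (Submodule.span_le.2 ?_) ?_
      · rintro _ ⟨l, rfl⟩
        exact h2 l
      · rintro _ ⟨η, hη, rfl⟩
        obtain ⟨ξ, hξ, hξη⟩ := exists_meanZero_grad_eq hv hη
        have h4 := divInt_eq_neg hv (hn q) ξ
        rw [h1 ξ hξ, hξη] at h4
        exact neg_eq_zero.1 h4.symm
    exact h3 (hsup ▸ hp)
  -- There are no more conditions than unknowns: `(η, c) ↦ grad η + ∑ c_l g_l` embeds the space of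
  -- test data into the fields of degree at most `r - 1`. It is injective because the sum is direct,
  -- the `g l` are independent and a field with zero gradient and zero mean vanishes.
  have hle : Module.finrank ℝ (Module.Dual ℝ (meanZeroSub v r) × (Fin k → ℝ)) ≤
      Module.finrank ℝ (matDeg ((r : ℤ) - 1)) := by
    let S : (meanZeroSub v r) × (Fin k → ℝ) →ₗ[ℝ] MatPoly :=
      LinearMap.coprod (grad ∘ₗ (meanZeroSub v r).subtype) (Fintype.linearCombination ℝ g)
    have hS1 : ∀ η : meanZeroSub v r, grad η ∈ gradSpace r := fun η => ⟨η, η.2.1, rfl⟩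
    have hS2 : ∀ c, Fintype.linearCombination ℝ g c ∈ Submodule.span ℝ (Set.range g) := fun c => by
      rw [← Fintype.range_linearCombination ℝ g]
      exact ⟨c, rfl⟩
    have hSmem : ∀ y, S y ∈ matDeg ((r : ℤ) - 1) := fun y => hsup ▸
      Submodule.add_mem _ (Submodule.mem_sup_right (hS1 y.1)) (Submodule.mem_sup_left (hS2 y.2))
    have hSinj : Function.Injective (S.codRestrict _ hSmem) := by
      rw [injective_iff_map_eq_zero]
      rintro ⟨η, c⟩ h
      have h1 : grad η + Fintype.linearCombination ℝ g c = 0 := congrArg Subtype.val h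
      have h2 : grad (η : VecPoly) = 0 := by
        refine Submodule.disjoint_def.1 hdisj _ ?_ (hS1 η)
        rw [eq_neg_of_add_eq_zero_left h1]
        exact Submodule.neg_mem _ (hS2 c)
      rw [h2, zero_add] at h1
      refine Prod.ext (Subtype.ext (eq_zero_of_grad_eq_zero hv η.2 h2)) ?_
      exact funext (Fintype.linearIndependent_iff.1 hg c
        (by rwa [Fintype.linearCombination_apply] at h1))
    have := LinearMap.finrank_le_finrank_of_injective hSinj
    rwa [Module.finrank_prod, Subspace.dual_finrank_eq, ← Module.finrank_prod]
  refine ⟨hinj, ?_⟩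
  have heq := le_antisymm (LinearMap.finrank_le_finrank_of_injective hinj) hle
  exact (LinearMap.injective_iff_surjective_of_finrank_eq_finrank heq).1 hinj

end Bubble

/-! ### Matrix bubbles -/

/-- The operator that acts by `J` on the rows. -/
def rowwise (J : VecPoly →ₗ[ℝ] VecPoly) : MatPoly →ₗ[ℝ] MatPoly where
  toFun q := Matrix.of fun i => J (q i)
  map_add' p q := by
    refine funext fun i => ?_
    exact J.map_add (p i) (q i)
  map_smul' c q := by
    refine funext fun i => ?_
    exact J.map_smul c (q i)

include hv in
theorem eq_zero_of_frobInt_rowwise {J K : VecPoly →ₗ[ℝ] VecPoly}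
    (hnn : ∀ q, ∀ x ∈ tet v, 0 ≤ evalVec (J q) x ⬝ᵥ evalVec (K q) x)
    (h0 : ∀ q, (∀ x ∈ tet v, evalVec (J q) x ⬝ᵥ evalVec (K q) x = 0) → q = 0) {q : MatPoly}
    (h : frobInt v (rowwise J q) (rowwise K q) = 0) : q = 0 := by
  rw [frobInt_eq] at h
  have hf : ∀ x, frob (evalMat (rowwise J q) x) (evalMat (rowwise K q) x) =
      ∑ i, evalVec (J (q i)) x ⬝ᵥ evalVec (K (q i)) x := fun x => frob_eq_sum _ _
  simp only [hf] at h
  have hcont : ∀ w : VecPoly, Continuous fun x => evalVec w x := fun w =>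
    continuous_pi fun i => continuous_eval _
  have h1 := eq_zero_of_integral_tet hv (continuous_finsetSum _ fun i _ =>
    (hcont (J (q i))).dotProduct (hcont (K (q i))))
    (fun x hx => Finset.sum_nonneg fun i _ => hnn (q i) x hx) h
  refine funext fun i => h0 (q i) fun x hx => ?_
  exact (Finset.sum_eq_zero_iff_of_nonneg fun i _ => hnn (q i) x hx).1 (h1 x hx) i (Finset.mem_univ _)

/-- The operator `W ↦ Wᵀ - tr(W) I` on polynomial matrix fields. -/
def s1Poly : MatPoly →ₗ[ℝ] MatPoly where
  toFun W := W.transpose - W.trace • (1 : MatPoly)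
  map_add' A B := by
    rw [Matrix.transpose_add, Matrix.trace_add, add_smul]
    abel
  map_smul' c A := by
    rw [Matrix.transpose_smul, Matrix.trace_smul, smul_assoc, RingHom.id_apply, smul_sub]

theorem evalMat_s1Poly (W : MatPoly) (x : Pt) : evalMat (s1Poly W) x = S1 (evalMat W x) := by
  ext1 i j
  simp only [evalMat, s1Poly, S1, LinearMap.coe_mk, AddHom.coe_mk, Matrix.sub_apply,
    Matrix.transpose_apply, Matrix.smul_apply, Matrix.trace, Matrix.diag, map_sub, map_sum,
    smul_eq_mul, map_mul, Matrix.one_apply]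
  split_ifs <;> simp

/-- The inverse of `W ↦ Wᵀ - tr(W) I`. -/
def s1Inv (W : MatPoly) : MatPoly := W.transpose - (C (1 / 2) * W.trace) • (1 : MatPoly)

/-- The trace of `s1Inv W` is `-tr(W) / 2`, so the two multiples of the identity cancel. -/
theorem s1Poly_s1Inv (W : MatPoly) : s1Poly (s1Inv W) = W := by
  have h2 : (C (1 / 2) : Poly) * 2 = 1 := by
    rw [show (2 : Poly) = C 2 from (map_ofNat C 2).symm, ← C.map_mul]; norm_num
  ext1 i j
  simp only [s1Poly, s1Inv, LinearMap.coe_mk, AddHom.coe_mk, Matrix.sub_apply,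
    Matrix.transpose_apply, Matrix.smul_apply, Matrix.trace_sub, Matrix.trace_transpose,
    Matrix.trace_smul, Matrix.trace_one, Fintype.card_fin, smul_eq_mul, Matrix.one_apply]
  by_cases h : i = j
  · simp only [h, if_true]
    push_cast
    linear_combination W.trace * h2
  · simp [h, Ne.symm h]

theorem s1Inv_mem {m : ℤ} {W : MatPoly} (hW : W ∈ matDeg m) : s1Inv W ∈ matDeg m := by
  have h := mem_matDeg.1 hW
  refine mem_matDeg.2 fun i j => ?_
  refine Submodule.sub_mem _ (h j i) ?_
  simp only [Matrix.smul_apply, Matrix.one_apply, smul_eq_mul]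
  split_ifs
  · rw [mul_one]
    exact C_mul_mem_polyDeg _ (Submodule.sum_mem _ fun a _ => h a a)
  · rw [mul_zero]
    exact Submodule.zero_mem _

theorem frobInt_s1Poly (A B : MatPoly) : frobInt v (s1Poly A) B = frobInt v A (s1Poly B) := by
  simp only [frobInt, LinearMap.mk₂_apply]
  congr 1
  simp only [s1Poly, LinearMap.coe_mk, AddHom.coe_mk, Matrix.sub_apply, Matrix.transpose_apply,
    Matrix.smul_apply, smul_eq_mul, Matrix.one_apply, Fin.sum_univ_three, Matrix.trace,
    Matrix.diag]
  simp
  ring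

section Unisolvent

variable {k r : ℕ} {g : Fin k → MatPoly} (hg : LinearIndependent ℝ g)
    (hdisj : Disjoint (Submodule.span ℝ (Set.range g)) (gradSpace r))
    (hsup : Submodule.span ℝ (Set.range g) ⊔ gradSpace r = matDeg ((r : ℤ) - 1))

include hg hdisj hsup

theorem rtBubble_moments_bijective :
    Function.Bijective (bubbleMoments v r (rowwise (rtBubble hv)) g) := by
  refine bubbleMoments_bijective hv (fun q k i x hx => dlam_dot_rtBubble_face hv (q k) hx)
    (fun q hq h => ?_) hg hdisj hsup
  exact eq_zero_of_frobInt_rowwise hv (fun q x hx => rtBubble_dot_rtTest_nonneg hv q hx)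
    (fun q h => eq_zero_of_rtBubble_dot_rtTest hv h)
    (h (rowwise (rtTest hv) q) (mem_matDeg.2 fun i => mem_vecDeg.1 (rtTest_mem hv (mem_vecDeg.2 (mem_matDeg.1 hq i)))))

end Unisolvent

/-- Fields whose rows have no tangential component are mapped by `S1` to fields without normal
component. -/
theorem S1_dot_dlam {i : Fin 4} {A : Mat} (hA : ∀ k a b, a ≠ i → b ≠ i → A k ⬝ᵥ (v a - v b) = 0)
    (k : Fin 3) : dlam hv i ⬝ᵥ S1 A k = 0 := by
  -- With `ν = ∇λ_i` the matrix is `c ν^T`, and `S1` maps it to `ν c^T - (c · ν) I`, which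
  -- annihilates `ν`.
  have h1 : ∀ k, ∃ c, A k = c • dlam hv i := fun k => eq_smul_dlam_of_dot hv
    (hA k _ _ (Fin.succAbove_ne i 1) (Fin.succAbove_ne i 0))
    (hA k _ _ (Fin.succAbove_ne i 2) (Fin.succAbove_ne i 0))
  choose c hc using h1
  have h2 : ∀ k j, A k j = c k * dlam hv i j := fun k j => by rw [hc k]; rfl
  simp only [S1, dotProduct, Matrix.sub_apply, Matrix.transpose_apply, Matrix.smul_apply,
    Matrix.trace, Matrix.diag, h2, Fin.sum_univ_three, Matrix.one_apply, smul_eq_mul]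
  fin_cases k <;> simp <;> ring

section Unisolvent

variable {k r : ℕ} {g : Fin k → MatPoly} (hg : LinearIndependent ℝ g)
    (hdisj : Disjoint (Submodule.span ℝ (Set.range g)) (gradSpace r))
    (hsup : Submodule.span ℝ (Set.range g) ⊔ gradSpace r = matDeg ((r : ℤ) - 1))

include hg hdisj hsup

/-- `S1` is symmetric for the `L²` product, so testing `S1 (J q)` with the inverse image under `S1`
of the Nédélec test field gives the positive pairing of the bubble with that field. -/
theorem ndBubble_moments_bijective :
    Function.Bijective (bubbleMoments v r (s1Poly ∘ₗ rowwise (ndBubble hv)) g) := by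
  refine bubbleMoments_bijective hv (fun q k i x hx => ?_) (fun q hq h => ?_) hg hdisj hsup
  · have h := congrFun (evalMat_s1Poly (rowwise (ndBubble hv) q) x) k
    have h2 : evalVec ((s1Poly ∘ₗ rowwise (ndBubble hv)) q k) x =
      S1 (evalMat (rowwise (ndBubble hv) q) x) k := h
    rw [h2]
    exact S1_dot_dlam hv (fun k a b ha hb => ndBubble_dot_edge_face hv (q k) ha hb hx) k
  · refine eq_zero_of_frobInt_rowwise hv (fun q x hx => ndBubble_dot_ndTest_nonneg hv q hx)
      (fun q h => eq_zero_of_ndBubble_dot_ndTest hv h) ?_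
    have h3 : rowwise (ndTest v) q ∈ matDeg ((r : ℤ) - 1) :=
      mem_matDeg.2 fun i => mem_vecDeg.1 (ndTest_mem v (mem_vecDeg.2 (mem_matDeg.1 hq i)))
    have h4 := h _ (s1Inv_mem h3)
    rw [LinearMap.comp_apply, frobInt_s1Poly, s1Poly_s1Inv] at h4
    exact h4

end Unisolvent

end MixedElasticity

end

/-! ### Face moments in the variable order spaces -/

noncomputable section

namespace MixedElasticity

open MvPolynomial (C X eval pderiv)

variable {v : Fin 4 → Pt} (hv : AffineIndependent ℝ v)

/-! ### The variable order spaces are closed under linear combinations -/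

theorem evalVec_lincomb (a b : ℝ) (w u : VecPoly) (x : Pt) :
    evalVec (a • w + b • u) x = a • evalVec w x + b • evalVec u x := by
  rw [evalVec_add, evalVec_smul, evalVec_smul]

theorem IsPolyOn.lincomb {A : Set Pt} {m : ℤ} {f g : Pt → ℝ} (hf : IsPolyOn A m f)
    (hg : IsPolyOn A m g) (a b : ℝ) : IsPolyOn A m fun x => a * f x + b * g x := by
  obtain ⟨p, hp, hpf⟩ := hf
  obtain ⟨q, hq, hqg⟩ := hg
  refine ⟨a • p + b • q, Submodule.add_mem _ (Submodule.smul_mem _ _ hp)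
    (Submodule.smul_mem _ _ hq), fun x hx => ?_⟩
  simp only [hpf x hx, hqg x hx, map_add, MvPolynomial.smul_eval]

theorem IsFacePminus1.lincomb {i : Fin 4} {m : ℤ} {f g : Pt → Pt} (hf : IsFacePminus1 v i m f)
    (hg : IsFacePminus1 v i m g) (a b : ℝ) :
    IsFacePminus1 v i m fun x => a • f x + b • g x := by
  obtain ⟨p, hp, s, hs, h1, h2⟩ := hf
  obtain ⟨p', hp', s', hs', h1', h2'⟩ := hg
  refine ⟨a • p + b • p', Submodule.add_mem _ (Submodule.smul_mem _ _ hp)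
    (Submodule.smul_mem _ _ hp'), a • s + b • s', Submodule.add_mem _ (Submodule.smul_mem _ _ hs)
    (Submodule.smul_mem _ _ hs'), fun x hx => ?_, fun x hx => ?_⟩
  · rw [evalVec_lincomb, add_dotProduct, smul_dotProduct, smul_dotProduct, h1 x hx, h1' x hx]
    simp
  · simp only [h2 x hx, h2' x hx, evalVec_lincomb, map_add, MvPolynomial.smul_eval]
    module

theorem Pminus2_lincomb {m : ℤ} {w u : VecPoly} (hw : w ∈ Pminus2 m) (hu : u ∈ Pminus2 m)
    (a b : ℝ) : a • w + b • u ∈ Pminus2 m := by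
  obtain ⟨q, hq, s, hs, rfl⟩ := hw
  obtain ⟨q', hq', s', hs', rfl⟩ := hu
  refine ⟨a • q + b • q', Submodule.add_mem _ (Submodule.smul_mem _ _ hq)
    (Submodule.smul_mem _ _ hq'), a • s + b • s', Submodule.add_mem _ (Submodule.smul_mem _ _ hs)
    (Submodule.smul_mem _ _ hs'), ?_⟩
  funext c
  simp only [Pi.add_apply, Pi.smul_apply, smul_add, mul_add, mul_smul_comm]
  abel

theorem Pminus2Var_lincomb {ρ : Finset (Fin 4) → ℕ} {w u : VecPoly} (hw : w ∈ Pminus2Var v ρ)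
    (hu : u ∈ Pminus2Var v ρ) (a b : ℝ) : a • w + b • u ∈ Pminus2Var v ρ := by
  refine ⟨Pminus2_lincomb hw.1 hu.1 a b, fun i => ?_⟩
  have h := (hw.2 i).lincomb (hu.2 i) a b
  simpa only [evalVec_lincomb, add_dotProduct, smul_dotProduct, smul_eq_mul] using h

theorem tangPart_lincomb (n : Pt) (a b : ℝ) (w u : Pt) :
    tangPart n (a • w + b • u) = a • tangPart n w + b • tangPart n u := by
  simp only [tangPart, add_dotProduct, smul_dotProduct, smul_eq_mul]
  module

theorem Pminus1Var_lincomb {ρ : Finset (Fin 4) → ℕ} {w u : VecPoly} (hw : w ∈ Pminus1Var v ρ)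
    (hu : u ∈ Pminus1Var v ρ) (a b : ℝ) : a • w + b • u ∈ Pminus1Var v ρ := by
  refine ⟨Pminus1_add (Pminus1_smul a hw.1) (Pminus1_smul b hu.1), fun i => ?_, fun i j hij => ?_⟩
  · have h := (hw.2.1 i).lincomb (hu.2.1 i) a b
    simpa only [evalVec_lincomb, tangPart_lincomb] using h
  · have h := (hw.2.2 i j hij).lincomb (hu.2.2 i j hij) a b
    simpa only [evalVec_lincomb, add_dotProduct, smul_dotProduct, smul_eq_mul] using h

theorem zero_mem_Pminus1Var (ρ : Finset (Fin 4) → ℕ) : (0 : VecPoly) ∈ Pminus1Var v ρ := by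
  refine ⟨⟨0, Submodule.zero_mem _, 0, Submodule.zero_mem _, by simp⟩, fun i => ?_, fun i j _ => ?_⟩
  · exact ⟨0, Submodule.zero_mem _, 0, Submodule.zero_mem _, fun x _ => by simp [evalVec_zero],
      fun x _ => by simp [evalVec_zero, tangPart]⟩
  · exact ⟨0, Submodule.zero_mem _, fun x _ => by simp [evalVec_zero]⟩

theorem sum_mem_Pminus1Var {ι : Type*} (s : Finset ι) {ρ : Finset (Fin 4) → ℕ} {w : ι → VecPoly}
    (hw : ∀ i ∈ s, w i ∈ Pminus1Var v ρ) : ∑ i ∈ s, w i ∈ Pminus1Var v ρ := by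
  refine Finset.sum_induction w (· ∈ Pminus1Var v ρ) (fun a b ha hb => ?_)
    (zero_mem_Pminus1Var ρ) hw
  simpa using Pminus1Var_lincomb ha hb 1 1

/-! ### Prescribing face moments -/

/-- The range of a symmetric form on a finite-dimensional space is the annihilator of its kernel.
The form may degenerate: polynomials in three variables can vanish on a face without being zero, and
the moment functionals vanish on them too. -/
theorem exists_riesz {E : Type*} [AddCommGroup E] [Module ℝ E] [FiniteDimensional ℝ E]
    (B : E →ₗ[ℝ] E →ₗ[ℝ] ℝ) (hB : ∀ x y, B x y = B y x) (L : Module.Dual ℝ E)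
    (hL : ∀ x, B x x = 0 → L x = 0) : ∃ x, B x = L := by
  have h1 : L ∈ (LinearMap.ker B).dualAnnihilator := by
    rw [Submodule.mem_dualAnnihilator]
    intro x hx
    exact hL x (by rw [LinearMap.mem_ker.1 hx, LinearMap.zero_apply])
  rw [LinearMap.dualAnnihilator_ker_eq_range_flip] at h1
  obtain ⟨x, hx⟩ := h1
  exact ⟨x, by rw [← hx]; exact LinearMap.ext fun y => hB x y⟩

theorem integrable_mul_face {i : Fin 4} {G : Pt → ℝ} (hG : MemLp G 2 (faceMeasure v i)) (p : Poly) :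
    Integrable (fun x => G x * eval x p) (faceMeasure v i) :=
  hG.integrable_mul (q := 2) (memLp_face (continuous_eval p) i)

/-- The moments of a square-integrable function on a face. -/
def faceMoment {i : Fin 4} {G : Pt → ℝ} (hG : MemLp G 2 (faceMeasure v i)) :
    Module.Dual ℝ Poly where
  toFun p := ∫ x, G x * eval x p ∂faceMeasure v i
  map_add' p q := by
    simp only [map_add, mul_add]
    exact integral_add (integrable_mul_face hG p) (integrable_mul_face hG q)
  map_smul' c p := by
    simp only [MvPolynomial.smul_eval, RingHom.id_apply, smul_eq_mul, mul_left_comm _ c,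
      integral_const_mul]

theorem faceMoment_eq_zero {i : Fin 4} {G : Pt → ℝ} (hG : MemLp G 2 (faceMeasure v i)) {p : Poly}
    (hp : ∀ x ∈ face v i, eval x p = 0) : faceMoment hG p = 0 :=
  integral_eq_zero_of_ae ((ae_mem_face i).mono fun x hx => by simp [hp x hx])

include hv in
theorem exists_face_moments (i : Fin 4) (m : ℤ) {G : Pt → ℝ} (hG : MemLp G 2 (faceMeasure v i)) :
    ∃ p ∈ polyDeg m, ∀ μ ∈ polyDeg m,
      ∫ x, eval x p * eval x μ ∂faceMeasure v i = ∫ x, G x * eval x μ ∂faceMeasure v i := by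
  let B : polyDeg m →ₗ[ℝ] polyDeg m →ₗ[ℝ] ℝ :=
    LinearMap.mk₂ ℝ (fun p q => faceInt v i ((p : Poly) * q))
      (fun a b c => by simp [add_mul]) (fun a b c => by simp)
      (fun a b c => by simp [mul_add]) (fun a b c => by simp)
  obtain ⟨p, hp⟩ := exists_riesz B (fun p q => by simp [B, mul_comm])
    (faceMoment hG ∘ₗ (polyDeg m).subtype) fun p hp => by
      refine faceMoment_eq_zero hG fun x hx => ?_
      have h1 : ∫ x, eval x (p : Poly) * eval x (p : Poly) ∂faceMeasure v i = 0 := by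
        simpa [B, faceInt] using hp
      have := eq_zero_of_integral_face hv ((continuous_eval _).mul (continuous_eval _))
        (fun x _ => mul_self_nonneg _) h1 x hx
      exact mul_self_eq_zero.1 this
  refine ⟨p, p.2, fun μ hμ => ?_⟩
  have := LinearMap.congr_fun hp ⟨μ, hμ⟩
  simpa [B, faceInt, faceMoment] using this

/-- The product of a polynomial vector field with a vector, as a polynomial. -/
def dotPoly (w : VecPoly) (τ : Pt) : Poly := ∑ a, w a * C (τ a)

theorem eval_dotPoly (w : VecPoly) (τ x : Pt) : eval x (dotPoly w τ) = evalVec w x ⬝ᵥ τ := by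
  simp [dotPoly, evalVec, dotProduct]

theorem dotPoly_faceBubble_lincomb (i : Fin 4) (a b : ℝ) (p q p' q' : Poly) (τ : Pt) :
    dotPoly (faceBubble hv i (a • p + b • p') (a • q + b • q')) τ =
      a • dotPoly (faceBubble hv i p q) τ + b • dotPoly (faceBubble hv i p' q') τ := by
  simp only [dotPoly, faceBubble, Fin.sum_univ_three, MvPolynomial.smul_eq_C_mul]
  ring

/-- The form whose value at `((p, q), (p', q'))` is the integral of the products of the edge
components of a face bubble with `p'` and `q'`. -/
def faceBubbleForm (i : Fin 4) : (Poly × Poly) →ₗ[ℝ] (Poly × Poly) →ₗ[ℝ] ℝ :=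
  LinearMap.mk₂ ℝ (fun p q => faceInt v i (
      dotPoly (faceBubble hv i p.1 p.2) (faceVertex v i 1 - faceVertex v i 0) * q.1 +
      dotPoly (faceBubble hv i p.1 p.2) (faceVertex v i 2 - faceVertex v i 0) * q.2))
    (fun a b c => by
      have h := fun τ => dotPoly_faceBubble_lincomb hv i 1 1 a.1 a.2 b.1 b.2 τ
      simp only [one_smul] at h
      rw [← map_add]
      congr 1
      simp only [Prod.fst_add, Prod.snd_add, h]
      ring)
    (fun c a b => by
      have h := fun τ => dotPoly_faceBubble_lincomb hv i c 0 a.1 a.2 0 0 τ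
      simp only [smul_zero, add_zero, zero_smul] at h
      rw [← map_smul]
      congr 1
      simp only [Prod.smul_fst, Prod.smul_snd, h, smul_add, smul_mul_assoc])
    (fun a b c => by
      rw [← map_add]
      congr 1
      simp only [Prod.fst_add, Prod.snd_add]
      ring)
    (fun c a b => by
      rw [← map_smul]
      congr 1
      simp only [Prod.smul_fst, Prod.smul_snd, smul_add, mul_smul_comm])

theorem faceBubbleForm_apply (i : Fin 4) (p q p' q' : Poly) :
    faceBubbleForm hv i (p, q) (p', q') = ∫ x,
      (evalVec (faceBubble hv i p q) x ⬝ᵥ (faceVertex v i 1 - faceVertex v i 0) * eval x p' +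
      evalVec (faceBubble hv i p q) x ⬝ᵥ (faceVertex v i 2 - faceVertex v i 0) * eval x q')
        ∂faceMeasure v i := by
  change ∫ x, eval x (dotPoly (faceBubble hv i p q) (faceVertex v i 1 - faceVertex v i 0) * p' +
      dotPoly (faceBubble hv i p q) (faceVertex v i 2 - faceVertex v i 0) * q') ∂faceMeasure v i = _
  simp only [map_add, map_mul, eval_dotPoly]

theorem eq_zero_of_faceBubbleForm {i : Fin 4} {p q : Poly}
    (h : faceBubbleForm hv i (p, q) (p, q) = 0) : ∀ x ∈ face v i, eval x p = 0 ∧ eval x q = 0 := by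
  rw [faceBubbleForm_apply] at h
  have hc : ∀ (w : VecPoly) (τ : Pt), Continuous fun x => evalVec w x ⬝ᵥ τ := fun w τ => by
    simp only [← eval_dotPoly]
    exact continuous_eval _
  have h1 := eq_zero_of_integral_face hv
    (((hc _ _).mul (continuous_eval _)).add ((hc _ _).mul (continuous_eval _)))
    (fun x hx => faceBubble_form_nonneg hv i p q (face_subset_tet i hx)) h
  obtain ⟨h2, h3⟩ := faceBubble_form_eq_zero hv h1
  exact fun x hx => ⟨h2 x hx, h3 x hx⟩

/-- The form of the face bubbles is symmetric, and where it vanishes on the diagonal both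
coefficients vanish on the face, so `exists_riesz` applies to the pair of moment functionals. -/
theorem exists_faceBubble_moments (i : Fin 4) (m : ℤ) {G H : Pt → ℝ}
    (hG : MemLp G 2 (faceMeasure v i)) (hH : MemLp H 2 (faceMeasure v i)) :
    ∃ p ∈ polyDeg m, ∃ q ∈ polyDeg m, ∀ μ ∈ polyDeg m,
      ∫ x, evalVec (faceBubble hv i p q) x ⬝ᵥ (faceVertex v i 1 - faceVertex v i 0) * eval x μ
        ∂faceMeasure v i = ∫ x, G x * eval x μ ∂faceMeasure v i ∧
      ∫ x, evalVec (faceBubble hv i p q) x ⬝ᵥ (faceVertex v i 2 - faceVertex v i 0) * eval x μ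
        ∂faceMeasure v i = ∫ x, H x * eval x μ ∂faceMeasure v i := by
  let ι : (polyDeg m × polyDeg m) →ₗ[ℝ] Poly × Poly :=
    LinearMap.prodMap (polyDeg m).subtype (polyDeg m).subtype
  obtain ⟨p, hp⟩ := exists_riesz ((faceBubbleForm hv i).compl₁₂ ι ι)
    (fun p q => by
      change faceBubbleForm hv i ((p.1 : Poly), (p.2 : Poly)) ((q.1 : Poly), (q.2 : Poly)) =
        faceBubbleForm hv i ((q.1 : Poly), (q.2 : Poly)) ((p.1 : Poly), (p.2 : Poly))
      simp only [faceBubbleForm_apply, faceBubble_form]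
      congr 1
      funext x
      ring)
    ((LinearMap.coprod (faceMoment hG) (faceMoment hH)) ∘ₗ ι) fun p hp => by
      have h := eq_zero_of_faceBubbleForm hv (p := p.1) (q := p.2) hp
      change faceMoment hG p.1 + faceMoment hH p.2 = 0
      rw [faceMoment_eq_zero hG fun x hx => (h x hx).1,
        faceMoment_eq_zero hH fun x hx => (h x hx).2, add_zero]
  have key : ∀ q : polyDeg m × polyDeg m,
      faceBubbleForm hv i ((p.1 : Poly), (p.2 : Poly)) ((q.1 : Poly), (q.2 : Poly)) =
      faceMoment hG q.1 + faceMoment hH q.2 := fun q => LinearMap.congr_fun hp q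
  refine ⟨p.1, p.1.2, p.2, p.2.2, fun μ hμ => ⟨?_, ?_⟩⟩
  · have := key (⟨μ, hμ⟩, 0)
    simpa [faceBubbleForm_apply, faceMoment] using this
  · have := key (0, ⟨μ, hμ⟩)
    simpa [faceBubbleForm_apply, faceMoment] using this

/-! ### Fields with prescribed face moments -/

include hv in
-- The field `x - v_i` is tangential on every face that contains `v_i`, and on face `i` it satisfies
-- `∇λ_i · (x - v_i) = -1`. With `n = c_i ∇λ_i` the combination of the `-(c_i)⁻¹ p_i (x - v_i)` has
-- the required normal components. Monotonicity of the order function bounds its degree.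
theorem exists_normal_lift {ρ : Finset (Fin 4) → ℕ} (hρ : IsOrder ρ) {p : Fin 4 → Poly}
    (hp : ∀ i, p i ∈ polyDeg (faceOrder ρ i)) :
    ∃ w ∈ Pminus2Var v (fun s => ρ s + 1), ∀ i, ∀ x ∈ face v i,
      evalVec w x ⬝ᵥ unitNormal v i = eval x (p i) := by
  choose c hc hcn using exists_unitNormal_eq hv
  have hle : ∀ i, faceOrder ρ i ≤ cellOrder ρ := fun i => hρ _ _
    ⟨i.succAbove 0, by simp⟩ (Finset.subset_univ _)
  have hp' : ∀ i, p i ∈ polyDeg (cellOrder ρ) := fun i =>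
    polyDeg_mono (by exact_mod_cast hle i) (hp i)
  let w : VecPoly := fun a => ∑ i, C (-(c i)⁻¹) * p i * (X a - C (v i a))
  have hw : ∀ x, evalVec w x = ∑ i, (-(c i)⁻¹ * eval x (p i)) • (x - v i) := fun x => by
    funext a
    simp [w, evalVec, Finset.sum_apply]
  have hn : ∀ i, ∀ x ∈ face v i, evalVec w x ⬝ᵥ unitNormal v i = eval x (p i) := by
    intro i x hx
    have h0 := ((mem_face hv).1 hx).2
    rw [hw, hcn, dotProduct_smul, dotProduct_comm, dotProduct_sum]
    simp only [dotProduct_smul, ← eval_lam_sub, h0, eval_lam_vertex, smul_eq_mul]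
    rw [Finset.sum_eq_single i]
    · have := hc i
      simp only [if_true]
      field_simp
      ring
    · intro j _ hj
      rw [if_neg hj.symm]
      ring
    · simp
  refine ⟨w, ⟨⟨fun a => -∑ i, C (v i a) * (C (-(c i)⁻¹) * p i), ?_,
    ∑ i, C (-(c i)⁻¹) * p i, ?_, ?_⟩, fun i => ⟨p i, ?_, hn i⟩⟩, hn⟩
  · have e : ((cellOrder (fun s => ρ s + 1) : ℕ) : ℤ) - 1 = cellOrder ρ := by
      simp [cellOrder]
    rw [e]
    exact mem_vecDeg.2 fun a => Submodule.neg_mem _ (Submodule.sum_mem _ fun i _ =>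
      C_mul_mem_polyDeg _ (C_mul_mem_polyDeg _ (hp' i)))
  · have e : ((cellOrder (fun s => ρ s + 1) : ℕ) : ℤ) - 1 = cellOrder ρ := by
      simp [cellOrder]
    rw [e]
    exact Submodule.sum_mem _ fun i _ => C_mul_mem_polyDeg _ (hp' i)
  · funext a
    simp only [w, Pi.add_apply, Finset.mul_sum, ← Finset.sum_neg_distrib, ← Finset.sum_add_distrib]
    exact Finset.sum_congr rfl fun i _ => by ring
  · have e : ((faceOrder (fun s => ρ s + 1) i : ℕ) : ℤ) - 1 = faceOrder ρ i := by
      simp [faceOrder]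
    rw [e]
    exact hp i

include hv in
theorem exists_mem_Pminus2Var_moments {ρ : Finset (Fin 4) → ℕ} (hρ : IsOrder ρ)
    {G : Fin 4 → Pt → ℝ} (hG : ∀ i, MemLp (G i) 2 (faceMeasure v i)) :
    ∃ w ∈ Pminus2Var v (fun s => ρ s + 1), ∀ i, ∀ μ ∈ polyDeg (faceOrder ρ i),
      ∫ x, (evalVec w x ⬝ᵥ unitNormal v i) * eval x μ ∂faceMeasure v i =
        ∫ x, G i x * eval x μ ∂faceMeasure v i := by
  choose p hp hpm using fun i => exists_face_moments hv i (faceOrder ρ i) (hG i)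
  obtain ⟨w, hw, hwp⟩ := exists_normal_lift hv hρ hp
  refine ⟨w, hw, fun i μ hμ => ?_⟩
  rw [← hpm i μ hμ]
  refine integral_congr_ae ((ae_mem_face i).mono fun x hx => ?_)
  simp only [hwp i x hx]

include hv in
-- The normal component has degree at most `(ρ + 1) - 1 = ρ` on the face, so it is itself an
-- admissible test function.
theorem dot_normal_eq_zero_of_moments {ρ : Finset (Fin 4) → ℕ} {w : VecPoly}
    (hw : w ∈ Pminus2Var v (fun s => ρ s + 1)) {i : Fin 4}
    (h : ∀ μ ∈ polyDeg (faceOrder ρ i),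
      ∫ x, (evalVec w x ⬝ᵥ unitNormal v i) * eval x μ ∂faceMeasure v i = 0) :
    ∀ x ∈ face v i, evalVec w x ⬝ᵥ unitNormal v i = 0 := by
  obtain ⟨p, hp, hwp⟩ := hw.2 i
  have e : ((faceOrder (fun s => ρ s + 1) i : ℕ) : ℤ) - 1 = faceOrder ρ i := by
    simp [faceOrder]
  rw [e] at hp
  have h1 : ∫ x, eval x p * eval x p ∂faceMeasure v i = 0 := by
    rw [← h p hp]
    refine integral_congr_ae ((ae_mem_face i).mono fun x hx => ?_)
    simp only [hwp x hx]
  intro x hx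
  refine (hwp x hx).trans ?_
  exact mul_self_eq_zero.1 (eq_zero_of_integral_face hv ((continuous_eval _).mul
    (continuous_eval _)) (fun x _ => mul_self_nonneg _) h1 x hx)

/-- Every edge lies on two faces, and at least one of them is not face `i`; there the bubble has no
tangential component. -/
theorem faceBubble_dot_edge (i : Fin 4) (p q : Poly) {a b : Fin 4} (hab : a ≠ b) {x : Pt}
    (hx : x ∈ segment ℝ (v a) (v b)) : evalVec (faceBubble hv i p q) x ⬝ᵥ (v b - v a) = 0 := by
  rw [mem_segment_vertex hv hab] at hx
  by_cases h : ∃ k, k ≠ a ∧ k ≠ b ∧ i ≠ k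
  · obtain ⟨k, hka, hkb, hki⟩ := h
    exact faceBubble_dot_of_ne hv hki p q ((mem_face hv).2 ⟨hx.1, hx.2 k hka hkb⟩) hkb.symm hka.symm
  · exfalso
    apply h
    clear h hx
    revert hab
    revert i a b
    decide

theorem faceBubble_mem_Pminus1Var {ρ : Finset (Fin 4) → ℕ} (hρ : IsOrder ρ) {i : Fin 4}
    {p q : Poly} (hp : p ∈ polyDeg (faceOrder ρ i)) (hq : q ∈ polyDeg (faceOrder ρ i)) :
    faceBubble hv i p q ∈ Pminus1Var v (fun s => ρ s + 2) := by
  have hle : faceOrder ρ i ≤ cellOrder ρ := hρ _ _ ⟨i.succAbove 0, by simp⟩ (Finset.subset_univ _)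
  have e : ((cellOrder (fun s => ρ s + 2) : ℕ) : ℤ) - 2 = cellOrder ρ := by simp [cellOrder]
  have e' : ((faceOrder (fun s => ρ s + 2) i : ℕ) : ℤ) - 2 = faceOrder ρ i := by simp [faceOrder]
  have hmono : polyDeg (faceOrder ρ i) ≤ polyDeg (cellOrder ρ) :=
    polyDeg_mono (by exact_mod_cast hle)
  refine ⟨faceBubble_mem_Pminus1 hv i (e ▸ hmono hp) (e ▸ hmono hq), fun j => ?_,
    fun a b hab => ⟨0, Submodule.zero_mem _, fun x hx => ?_⟩⟩
  · by_cases hij : i = j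
    · subst hij
      exact faceBubble_isFacePminus1 hv i (e' ▸ hp) (e' ▸ hq)
    · refine ⟨0, Submodule.zero_mem _, 0, Submodule.zero_mem _, fun x _ => by simp [evalVec_zero],
        fun x hx => ?_⟩
      rw [evalVec_zero, map_zero, zero_smul, add_zero]
      exact (tangPart_eq_zero_iff hv j _).2
        ⟨faceBubble_dot_of_ne hv hij p q hx (Fin.succAbove_ne j 1) (Fin.succAbove_ne j 0),
          faceBubble_dot_of_ne hv hij p q hx (Fin.succAbove_ne j 2) (Fin.succAbove_ne j 0)⟩
  · rw [map_zero]
    exact faceBubble_dot_edge hv i p q hab hx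

include hv in
-- Face bubbles do not see each other: on face `i` the sum over all faces has the tangential
-- components of the `i`-th bubble alone, so the faces can be treated separately.
theorem exists_mem_Pminus1Var_moments {ρ : Finset (Fin 4) → ℕ} (hρ : IsOrder ρ)
    {G H : Fin 4 → Pt → ℝ} (hG : ∀ i, MemLp (G i) 2 (faceMeasure v i))
    (hH : ∀ i, MemLp (H i) 2 (faceMeasure v i)) :
    ∃ w ∈ Pminus1Var v (fun s => ρ s + 2), (∀ i, ∀ μ ∈ polyDeg (faceOrder ρ i),
      ∫ x, evalVec w x ⬝ᵥ (faceVertex v i 1 - faceVertex v i 0) * eval x μ ∂faceMeasure v i =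
        ∫ x, G i x * eval x μ ∂faceMeasure v i ∧
      ∫ x, evalVec w x ⬝ᵥ (faceVertex v i 2 - faceVertex v i 0) * eval x μ ∂faceMeasure v i =
        ∫ x, H i x * eval x μ ∂faceMeasure v i) ∧
    ∀ a b, a ≠ b → ∀ x ∈ segment ℝ (v a) (v b), evalVec w x ⬝ᵥ (v b - v a) = 0 := by
  choose p hp q hq hpq using fun i => exists_faceBubble_moments hv i (faceOrder ρ i) (hG i) (hH i)
  have hsum : ∀ x, evalVec (∑ i, faceBubble hv i (p i) (q i)) x =
      ∑ i, evalVec (faceBubble hv i (p i) (q i)) x := fun x => evalVec_sum _ _ _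
  have hface : ∀ i, ∀ x ∈ face v i, ∀ a b, a ≠ i → b ≠ i →
      evalVec (∑ i, faceBubble hv i (p i) (q i)) x ⬝ᵥ (v a - v b) =
        evalVec (faceBubble hv i (p i) (q i)) x ⬝ᵥ (v a - v b) := by
    intro i x hx a b ha hb
    rw [hsum, sum_dotProduct, Finset.sum_eq_single i]
    · exact fun j _ hj => faceBubble_dot_of_ne hv hj _ _ hx ha hb
    · simp
  refine ⟨∑ i, faceBubble hv i (p i) (q i), sum_mem_Pminus1Var _ fun i _ =>
    faceBubble_mem_Pminus1Var hv hρ (hp i) (hq i), fun i μ hμ => ?_, fun a b hab x hx => ?_⟩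
  · obtain ⟨h1, h2⟩ := hpq i μ hμ
    rw [← h1, ← h2]
    constructor <;> refine integral_congr_ae ((ae_mem_face i).mono fun x hx => ?_)
    · simp only [faceVertex, hface i x hx _ _ (Fin.succAbove_ne i 1) (Fin.succAbove_ne i 0)]
    · simp only [faceVertex, hface i x hx _ _ (Fin.succAbove_ne i 2) (Fin.succAbove_ne i 0)]
  · rw [hsum, sum_dotProduct]
    exact Finset.sum_eq_zero fun i _ => faceBubble_dot_edge hv i _ _ hab hx

include hv in
-- Without edge components the trace is that of a face bubble whose coefficients have degree at most
-- `(ρ + 2) - 2 = ρ`. Testing with these coefficients shows that the semidefinite form vanishes on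
-- them.
theorem dot_edges_eq_zero_of_moments {ρ : Finset (Fin 4) → ℕ} {w : VecPoly}
    (hw : w ∈ Pminus1Var v (fun s => ρ s + 2))
    (hedge : ∀ a b, a ≠ b → ∀ x ∈ segment ℝ (v a) (v b), evalVec w x ⬝ᵥ (v b - v a) = 0)
    {i : Fin 4} (h : ∀ μ ∈ polyDeg (faceOrder ρ i),
      ∫ x, evalVec w x ⬝ᵥ (faceVertex v i 1 - faceVertex v i 0) * eval x μ ∂faceMeasure v i = 0 ∧
      ∫ x, evalVec w x ⬝ᵥ (faceVertex v i 2 - faceVertex v i 0) * eval x μ ∂faceMeasure v i = 0) :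
    ∀ x ∈ face v i, ∀ a b, a ≠ i → b ≠ i → evalVec w x ⬝ᵥ (v a - v b) = 0 := by
  have hw2 := hw.2.1 i
  have e : ((faceOrder (fun s => ρ s + 2) i : ℕ) : ℤ) = faceOrder ρ i + 2 := by simp [faceOrder]
  rw [e] at hw2
  obtain ⟨p, hp, q, hq, hpq⟩ := exists_faceBubble hv hw2 fun a b hab x hx => by
    rw [tangPart_dot_faceEdge]
    exact hedge _ _ (fun h => hab (Fin.succAbove_right_injective h)) x hx
  simp only [tangPart_dot_faceEdge] at hpq
  have hc : ∀ (w : VecPoly) (τ : Pt), Continuous fun x => evalVec w x ⬝ᵥ τ := fun w τ => by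
    simp only [← eval_dotPoly]
    exact continuous_eval _
  have hform : faceBubbleForm hv i (p, q) (p, q) = 0 := by
    rw [faceBubbleForm_apply, integral_add]
    · rw [← add_zero (0 : ℝ)]
      refine congrArg₂ _ (Eq.trans ?_ (h p hp).1) (Eq.trans ?_ (h q hq).2)
      · exact integral_congr_ae ((ae_mem_face i).mono fun x hx => by simp only [(hpq x hx).1])
      · exact integral_congr_ae ((ae_mem_face i).mono fun x hx => by simp only [(hpq x hx).2])
    · exact integrable_face ((hc _ _).mul (continuous_eval _)) i
    · exact integrable_face ((hc _ _).mul (continuous_eval _)) i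
  have hzero := eq_zero_of_faceBubbleForm hv hform
  intro x hx
  obtain ⟨h1, h2⟩ := hpq x hx
  obtain ⟨h3, h4⟩ := dot_edges_eq_zero_of_form hv hzero hx
  obtain ⟨c, hc⟩ := eq_smul_dlam_of_dot hv (h1.trans h3) (h2.trans h4)
  intro a b ha hb
  rw [hc, smul_dotProduct, dlam_dot_edge, if_neg ha.symm, if_neg hb.symm]
  simp

end MixedElasticity

end

/-! ### Existence, uniqueness and the projection property -/

noncomputable section

namespace MixedElasticity

open MvPolynomial (C X eval pderiv)

variable {v : Fin 4 → Pt} (hv : AffineIndependent ℝ v)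

/-! ### Interior conditions -/

theorem evalMat_lincomb (a b : ℝ) (P Q : MatPoly) (x : Pt) :
    evalMat (a • P + b • Q) x = a • evalMat P x + b • evalMat Q x := by
  ext1 i j
  simp [evalMat, MvPolynomial.smul_eval]

theorem MemH1.lincomb {u w : Pt → ℝ} (hu : MemH1 v u) (hw : MemH1 v w) (a b : ℝ) :
    MemH1 v fun x => a * u x + b * w x := by
  refine ⟨(hu.1.const_mul a).add (hw.1.const_mul b), fun j => ?_⟩
  obtain ⟨g, hg⟩ := hu.2 j
  obtain ⟨g', hg'⟩ := hw.2 j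
  exact ⟨_, hg.lincomb hu.1 hw.1 hg' a b⟩

theorem S1_lincomb (a b : ℝ) (A B : Mat) : S1 (a • A + b • B) = a • S1 A + b • S1 B := by
  simp only [S1, Matrix.transpose_add, Matrix.transpose_smul, Matrix.trace_add, Matrix.trace_smul,
    smul_eq_mul]
  module

theorem S1_mem_H1Mat {U : Pt → Mat} (hU : U ∈ H1Mat v) : (fun x => S1 (U x)) ∈ H1Mat v := by
  intro i j
  have h := (hU j i).lincomb (((hU 0 0).lincomb (hU 1 1) 1 1).lincomb (hU 2 2) 1 1) 1
    (-(1 : Mat) i j)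
  refine (congrArg (MemH1 v) (funext fun x => ?_)).mp h
  simp only [S1, Matrix.trace, Matrix.diag, Fin.sum_univ_three, Matrix.sub_apply,
    Matrix.transpose_apply, Matrix.smul_apply, smul_eq_mul]
  ring

theorem integrable_frob {U : Pt → Mat} (hU : U ∈ H1Mat v) (P : MatPoly) :
    Integrable (fun x => frob (U x) (evalMat P x)) (volume.restrict (tet v)) := by
  simp only [frob_eq_sum]
  exact integrable_finsetSum _ fun i _ => integrable_finsetSum _ fun j _ =>
    integrable_mul_of_memLp (hU i j).1 (continuous_eval (P i j))

theorem integrable_dot {D : Pt → Pt} (hD : ∀ i, MemLp (fun x => D x i) 2 (volume.restrict (tet v)))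
    (η : VecPoly) :
    Integrable (fun x => D x ⬝ᵥ evalVec η x) (volume.restrict (tet v)) :=
  integrable_finsetSum _ fun i _ => integrable_mul_of_memLp (hD i) (continuous_eval (η i))

/-- The conditions in the interior of the tetrahedron that define the two operators. -/
def InteriorCond (v : Fin 4 → Pt) (r : ℕ) {k : ℕ} (h : Fin k → MatPoly) (V : Pt → Mat) : Prop :=
  (∃ D, IsWeakDiv v V D ∧ ∀ η ∈ meanZero v r, ∫ x in tet v, D x ⬝ᵥ evalVec η x = 0) ∧
  ∀ l, ∫ x in tet v, frob (V x) (evalMat (h l) x) = 0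

theorem integral_lincomb_eq_zero {α : Type*} [MeasurableSpace α] {μ : Measure α} {f g : α → ℝ}
    (hf : Integrable f μ) (hg : Integrable g μ) (hf0 : ∫ x, f x ∂μ = 0) (hg0 : ∫ x, g x ∂μ = 0)
    (a b : ℝ) : ∫ x, (a * f x + b * g x) ∂μ = 0 := by
  rw [integral_add (hf.const_mul a) (hg.const_mul b), integral_const_mul, integral_const_mul, hf0,
    hg0]
  ring

theorem InteriorCond.lincomb {r k : ℕ} {h : Fin k → MatPoly} {V W : Pt → Mat} (hV : V ∈ H1Mat v)
    (hW : W ∈ H1Mat v) (h1 : InteriorCond v r h V) (h2 : InteriorCond v r h W) (a b : ℝ) :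
    InteriorCond v r h fun x => a • V x + b • W x := by
  obtain ⟨⟨D, hD, hD0⟩, hl⟩ := h1
  obtain ⟨⟨E, hE, hE0⟩, hl'⟩ := h2
  refine ⟨⟨_, hD.lincomb (fun i j => (hV i j).1) (fun i j => (hW i j).1) hE a b, fun η hη => ?_⟩,
    fun l => ?_⟩
  · simp only [add_dotProduct, smul_dotProduct, smul_eq_mul]
    exact integral_lincomb_eq_zero (integrable_dot (fun i => (hD i).1) η)
      (integrable_dot (fun i => (hE i).1) η) (hD0 η hη) (hE0 η hη) a b
  · have e : ∀ x, frob (a • V x + b • W x) (evalMat (h l) x) =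
        a * frob (V x) (evalMat (h l) x) + b * frob (W x) (evalMat (h l) x) := fun x => by
      simp [frob, add_mul]
    simp only [e]
    exact integral_lincomb_eq_zero (integrable_frob hV _) (integrable_frob hW _) (hl l) (hl' l) a b

theorem interiorCond_zero (r : ℕ) {k : ℕ} (h : Fin k → MatPoly) :
    InteriorCond v r h fun _ => 0 := by
  refine ⟨⟨fun _ => 0, fun i => ⟨MemLp.zero, fun φ _ _ _ => by simp⟩, fun η _ => by simp⟩,
    fun l => by simp [frob]⟩

theorem BubbleUnisolvent.eq_zero {r k : ℕ} {J : MatPoly →ₗ[ℝ] MatPoly} {h : Fin k → MatPoly}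
    (hJ : BubbleUnisolvent v r J h) {q : MatPoly} (hq : q ∈ matDeg ((r : ℤ) - 1))
    (hc : InteriorCond v r h (evalMat (J q))) : q = 0 := by
  obtain ⟨⟨D, hD, hD0⟩, hl⟩ := hc
  refine hJ.2 q hq (fun η hη => ?_) fun l => ?_
  · rw [divInt_eq, ← hD0 η hη]
    exact integral_congr_ae (((isWeakDiv_evalMat (J q)).ae_eq hD).mono fun x hx => by
      simp only [hx])
  · rw [frobInt_eq, hl l]

theorem BubbleUnisolvent.exists_interiorCond {r k : ℕ} {J : MatPoly →ₗ[ℝ] MatPoly}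
    {h : Fin k → MatPoly} (hJ : BubbleUnisolvent v r J h) {V : Pt → Mat} (hV : V ∈ H1Mat v) :
    ∃ q ∈ matDeg ((r : ℤ) - 1), InteriorCond v r h fun x => evalMat (J q) x + V x := by
  obtain ⟨D, hD⟩ := exists_isWeakDiv hV
  let a : Module.Dual ℝ VecPoly :=
    { toFun := fun η => ∫ x in tet v, D x ⬝ᵥ evalVec η x
      map_add' := fun η ξ => by
        simp only [evalVec_add, dotProduct_add]
        exact integral_add (integrable_dot (fun i => (hD i).1) η)
          (integrable_dot (fun i => (hD i).1) ξ)
      map_smul' := fun c η => by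
        simp only [evalVec_smul, dotProduct_smul, smul_eq_mul, integral_const_mul,
          RingHom.id_apply] }
  obtain ⟨q, hq, hq1, hq2⟩ := hJ.1 (-a) fun l => -∫ x in tet v, frob (V x) (evalMat (h l) x)
  have hJq := evalMat_mem_H1Mat (v := v) (J q)
  refine ⟨q, hq, ⟨fun x => evalVec (divMat (J q)) x + D x, ?_, fun η hη => ?_⟩, fun l => ?_⟩
  · have := (isWeakDiv_evalMat (v := v) (J q)).lincomb (fun i j => (hJq i j).1)
      (fun i j => (hV i j).1) hD 1 1
    simpa only [one_smul] using this
  · simp only [add_dotProduct]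
    rw [integral_add (integrable_dot (fun i => ((isWeakDiv_evalMat (J q)) i).1) η)
      (integrable_dot (fun i => (hD i).1) η), ← divInt_eq, hq1 η hη]
    exact neg_add_cancel (a η)
  · have e : ∀ x, frob (evalMat (J q) x + V x) (evalMat (h l) x) =
        frob (evalMat (J q) x) (evalMat (h l) x) + frob (V x) (evalMat (h l) x) := fun x => by
      simp [frob, add_mul]
    simp only [e]
    rw [integral_add (integrable_frob hJq _) (integrable_frob hV _), ← frobInt_eq, hq2 l,
      neg_add_cancel]

/-! ### Face conditions -/

/-- The conditions on the faces that define the two operators: the moments of the products of the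
trace with the vectors in `S` vanish. -/
def FaceCond (v : Fin 4 → Pt) (ρ : Finset (Fin 4) → ℕ) (S : Fin 4 → Set Pt) (V : Pt → Mat) :
    Prop :=
  ∀ i, ∃ γ : Pt → Mat, (∀ a b, IsFaceTrace v i (fun x => V x a b) fun x => γ x a b) ∧
    ∀ τ ∈ S i, ∀ μ ∈ vecDeg (faceOrder ρ i : ℤ),
      ∫ x, (γ x *ᵥ τ) ⬝ᵥ evalVec μ x ∂faceMeasure v i = 0

theorem memLp_dot_face {i : Fin 4} {γ : Pt → Mat}
    (hγ : ∀ a b, MemLp (fun x => γ x a b) 2 (faceMeasure v i)) (k : Fin 3) (τ : Pt) :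
    MemLp (fun x => γ x k ⬝ᵥ τ) 2 (faceMeasure v i) :=
  memLp_finsetSum _ fun j _ => (hγ k j).mul_const (τ j)

theorem integrable_face_dot {i : Fin 4} {γ : Pt → Mat}
    (hγ : ∀ a b, MemLp (fun x => γ x a b) 2 (faceMeasure v i)) (τ : Pt) (μ : VecPoly) :
    Integrable (fun x => (γ x *ᵥ τ) ⬝ᵥ evalVec μ x) (faceMeasure v i) :=
  integrable_finsetSum _ fun k _ => integrable_mul_face (memLp_dot_face hγ k τ) (μ k)

theorem FaceCond.lincomb {ρ : Finset (Fin 4) → ℕ} {S : Fin 4 → Set Pt} {V W : Pt → Mat}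
    (hV : V ∈ H1Mat v) (hW : W ∈ H1Mat v) (h1 : FaceCond v ρ S V) (h2 : FaceCond v ρ S W)
    (a b : ℝ) : FaceCond v ρ S fun x => a • V x + b • W x := by
  intro i
  obtain ⟨γ, hγ, hm⟩ := h1 i
  obtain ⟨δ, hδ, hm'⟩ := h2 i
  refine ⟨fun x => a • γ x + b • δ x,
    fun c d => (hγ c d).lincomb (hV c d).1 (hW c d).1 (hδ c d) a b, fun τ hτ μ hμ => ?_⟩
  simp only [Matrix.add_mulVec, Matrix.smul_mulVec, add_dotProduct, smul_dotProduct, smul_eq_mul]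
  exact integral_lincomb_eq_zero (integrable_face_dot (fun a b => (hγ a b).1) τ μ)
    (integrable_face_dot (fun a b => (hδ a b).1) τ μ) (hm τ hτ μ hμ) (hm' τ hτ μ hμ) a b

theorem faceCond_zero (ρ : Finset (Fin 4) → ℕ) (S : Fin 4 → Set Pt) :
    FaceCond v ρ S fun _ => 0 := fun i =>
  ⟨fun _ => 0, fun _ _ => isFaceTrace_of_contDiff i contDiff_const, fun _ _ _ _ => by simp⟩

theorem FaceCond.moments (hv : AffineIndependent ℝ v) {ρ : Finset (Fin 4) → ℕ}
    {S : Fin 4 → Set Pt} {P : MatPoly} (h : FaceCond v ρ S (evalMat P)) {i : Fin 4} {τ : Pt}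
    (hτ : τ ∈ S i) (k : Fin 3) {μ : Poly} (hμ : μ ∈ polyDeg (faceOrder ρ i)) :
    ∫ x, (evalVec (P k) x ⬝ᵥ τ) * eval x μ ∂faceMeasure v i = 0 := by
  obtain ⟨γ, hγ, hm⟩ := h i
  have h1 := hm τ hτ (Pi.single k μ) (mem_vecDeg.2 fun j => by
    by_cases hj : j = k
    · subst hj
      simpa using hμ
    · simp [Pi.single_eq_of_ne hj])
  -- The given `γ` is only some trace of the polynomial field; by uniqueness of traces it agrees
  -- with the restriction almost everywhere on the face.
  have hae : ∀ᵐ x ∂(faceMeasure v i), ∀ j, evalMat P x k j = γ x k j := by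
    refine ae_all_iff.2 fun j => ?_
    exact IsFaceTrace.ae_eq hv (memLp_tet (continuous_eval (P k j)))
      (isFaceTrace_of_contDiff i (contDiff_eval (P k j))) (hγ k j)
  rw [← h1]
  refine integral_congr_ae (hae.mono fun x hx => ?_)
  have e : evalVec (Pi.single k μ) x = Pi.single k (eval x μ) := by
    funext j
    by_cases hj : j = k
    · subst hj
      simp [evalVec]
    · simp [evalVec, Pi.single_eq_of_ne hj]
  have e2 : evalVec (P k) x = γ x k := funext hx
  simp only [e, dotProduct_single, e2, Matrix.mulVec]

theorem faceCond_sub {ρ : Finset (Fin 4) → ℕ} {S : Fin 4 → Set Pt} {P : MatPoly} {V : Pt → Mat}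
    (hV : V ∈ H1Mat v) {γ : Fin 4 → Pt → Mat}
    (hγ : ∀ i a b, IsFaceTrace v i (fun x => V x a b) fun x => γ i x a b)
    (hm : ∀ i, ∀ τ ∈ S i, ∀ k, ∀ μ ∈ polyDeg (faceOrder ρ i),
      ∫ x, (evalVec (P k) x ⬝ᵥ τ) * eval x μ ∂faceMeasure v i =
        ∫ x, (γ i x k ⬝ᵥ τ) * eval x μ ∂faceMeasure v i) :
    FaceCond v ρ S fun x => evalMat P x - V x := by
  intro i
  have hP : ∀ a b, IsFaceTrace v i (fun x => evalMat P x a b) fun x => evalMat P x a b :=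
    fun a b => isFaceTrace_of_contDiff i (contDiff_eval (P a b))
  refine ⟨fun x => evalMat P x - γ i x, fun a b => ?_, fun τ hτ μ hμ => ?_⟩
  · have h := (hP a b).lincomb (memLp_tet (continuous_eval (P a b))) (hV a b).1 (hγ i a b) 1 (-1)
    simp only [one_mul, neg_one_mul, ← sub_eq_add_neg] at h
    exact h
  · have hP' : ∀ a b, MemLp (fun x => evalMat P x a b) 2 (faceMeasure v i) := fun a b => (hP a b).1
    have hγ' : ∀ a b, MemLp (fun x => γ i x a b) 2 (faceMeasure v i) := fun a b => (hγ i a b).1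
    simp only [Matrix.sub_mulVec, sub_dotProduct]
    rw [integral_sub (integrable_face_dot hP' τ μ) (integrable_face_dot hγ' τ μ), sub_eq_zero]
    have e1 := integral_finsetSum Finset.univ fun k _ =>
      integrable_mul_face (memLp_dot_face hP' k τ) (μ k)
    have e2 := integral_finsetSum Finset.univ fun k _ =>
      integrable_mul_face (memLp_dot_face hγ' k τ) (μ k)
    exact e1.trans ((Finset.sum_congr rfl fun k _ =>
      hm i τ hτ k (μ k) (mem_vecDeg.1 hμ k)).trans e2.symm)

/-! ### Projections from unisolvence -/

/-- A linear relation that is solvable for every argument and has only the zero value at zero is the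
graph of a linear map; `hself` makes every value a fixed point. -/
theorem exists_isProjectionFor {R : (Pt → Mat) → MatPoly → Prop}
    (hex : ∀ U ∈ H1Mat v, ∃ P, R U P)
    (hlin : ∀ U ∈ H1Mat v, ∀ U' ∈ H1Mat v, ∀ P P', R U P → R U' P' → ∀ a b : ℝ,
      R (a • U + b • U') (a • P + b • P'))
    (h0 : ∀ P, R 0 P → P = 0) (hself : ∀ U P, R U P → R (evalMat P) P) :
    ∃ proj : H1Mat v →ₗ[ℝ] MatPoly, IsProjectionFor v R proj := by
  have huniq : ∀ U ∈ H1Mat v, ∀ P P', R U P → R U P' → P = P' := by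
    intro U hU P P' h1 h2
    have h := hlin U hU U hU P P' h1 h2 1 (-1)
    simp only [one_smul, neg_smul, ← sub_eq_add_neg, sub_self] at h
    exact sub_eq_zero.1 (h0 _ h)
  choose p hp using fun U : H1Mat v => hex U U.2
  let proj : H1Mat v →ₗ[ℝ] MatPoly :=
    { toFun := p
      map_add' := fun U U' => by
        have h := hlin U U.2 U' U'.2 _ _ (hp U) (hp U') 1 1
        simp only [one_smul] at h
        exact huniq _ (U + U').2 _ _ (hp _) h
      map_smul' := fun c U => by
        have h := hlin U U.2 U U.2 _ _ (hp U) (hp U) c 0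
        simp only [zero_smul, add_zero] at h
        exact huniq _ (c • U).2 _ _ (hp _) h }
  refine ⟨proj, fun U P => ⟨fun h => huniq U U.2 _ _ h (hp U), fun h => h ▸ hp U⟩, fun U => ?_⟩
  have hmem := evalMat_mem_H1Mat (v := v) (proj U)
  exact ⟨hmem, huniq _ hmem _ _ (hp ⟨_, hmem⟩) (hself _ _ (hp U))⟩

theorem evalMat_lincomb_sub (a b : ℝ) (P P' : MatPoly) (U U' : Pt → Mat) (x : Pt) :
    evalMat (a • P + b • P') x - (a • U + b • U') x =
      a • (evalMat P x - U x) + b • (evalMat P' x - U' x) := by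
  rw [evalMat_lincomb, Pi.add_apply, Pi.smul_apply, Pi.smul_apply]
  module

theorem evalMat_sub_mem_H1Mat (P : MatPoly) {U : Pt → Mat} (hU : U ∈ H1Mat v) :
    (fun x => evalMat P x - U x) ∈ H1Mat v :=
  Submodule.sub_mem _ (evalMat_mem_H1Mat P) hU

/-! ### The operator with normal traces -/

theorem isPi2_iff {ρ : Finset (Fin 4) → ℕ} {k : ℕ} {h : Fin k → MatPoly} {U : Pt → Mat}
    {P : MatPoly} : IsPi2 v ρ h U P ↔ P ∈ Pminus2VarMat v (fun s => ρ s + 1) ∧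
      InteriorCond v (cellOrder ρ) h (fun x => evalMat P x - U x) ∧
      FaceCond v ρ (fun i => {unitNormal v i}) fun x => evalMat P x - U x := by
  simp only [IsPi2, InteriorCond, FaceCond, Set.mem_singleton_iff, forall_eq, and_assoc]

theorem rtBubble_mem_Pminus2Var {ρ : Finset (Fin 4) → ℕ} {q : VecPoly}
    (hq : q ∈ vecDeg ((cellOrder ρ : ℤ) - 1)) :
    rtBubble hv q ∈ Pminus2Var v (fun s => ρ s + 1) := by
  have e : ((cellOrder (fun s => ρ s + 1) : ℕ) : ℤ) = (cellOrder ρ : ℤ) - 1 + 2 := by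
    simp only [cellOrder]; push_cast; ring
  refine ⟨e ▸ rtBubble_mem_Pminus2 hv hq, fun i => ⟨0, Submodule.zero_mem _, fun x hx => ?_⟩⟩
  rw [map_zero]
  exact (dot_unitNormal_eq_zero hv i _).2 (dlam_dot_rtBubble_face hv q hx)

/-- A field with the right face moments is corrected by an interior bubble. The bubble has no normal
trace, so it settles the interior conditions without disturbing the faces. -/
theorem exists_isPi2 {ρ : Finset (Fin 4) → ℕ} (hρ : IsOrder ρ) {k : ℕ} {h : Fin k → MatPoly}
    (hJ : BubbleUnisolvent v (cellOrder ρ) (rowwise (rtBubble hv)) h) {U : Pt → Mat}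
    (hU : U ∈ H1Mat v) : ∃ P, IsPi2 v ρ h U P := by
  choose γ hγ using fun i a b => exists_isFaceTrace hv i (hU a b)
  choose P₀ hP₀ hm using fun k => exists_mem_Pminus2Var_moments hv hρ
    (G := fun i x => (fun b => γ i k b x) ⬝ᵥ unitNormal v i) fun i =>
      memLp_dot_face (γ := fun x a b => γ i a b x) (fun a b => (hγ i a b).1) k (unitNormal v i)
  obtain ⟨q, hq, hint⟩ := hJ.exists_interiorCond
    (evalMat_sub_mem_H1Mat (Matrix.of P₀) hU)
  have e : ∀ x, evalMat (Matrix.of P₀ + rowwise (rtBubble hv) q) x - U x =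
      evalMat (rowwise (rtBubble hv) q) x + (evalMat (Matrix.of P₀) x - U x) := fun x => by
    have := evalMat_lincomb 1 1 (Matrix.of P₀) (rowwise (rtBubble hv) q) x
    simp only [one_smul] at this
    rw [this]
    abel
  have hqr : ∀ k, q k ∈ vecDeg ((cellOrder ρ : ℤ) - 1) := fun k => mem_vecDeg.2 (mem_matDeg.1 hq k)
  refine ⟨Matrix.of P₀ + rowwise (rtBubble hv) q, isPi2_iff.2 ⟨fun k => ?_, ?_, ?_⟩⟩
  · have := Pminus2Var_lincomb (hP₀ k) (rtBubble_mem_Pminus2Var hv (hqr k)) 1 1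
    simp only [one_smul] at this
    exact this
  · simpa only [e] using hint
  · refine faceCond_sub hU (γ := fun i x a b => γ i a b x) hγ fun i τ hτ k μ hμ => ?_
    rw [Set.mem_singleton_iff.1 hτ]
    refine Eq.trans (integral_congr_ae ((ae_mem_face i).mono fun x hx => ?_)) (hm k i μ hμ)
    have e1 : evalVec ((Matrix.of P₀ + rowwise (rtBubble hv) q) k) x =
        evalVec (P₀ k) x + evalVec (rtBubble hv (q k)) x := evalVec_add _ _ _
    simp only [e1, add_dotProduct,
      (dot_unitNormal_eq_zero hv i _).2 (dlam_dot_rtBubble_face hv (q k) hx), add_zero]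

/-- Vanishing face moments leave a bubble, and vanishing interior moments leave nothing. -/
theorem eq_zero_of_isPi2 {ρ : Finset (Fin 4) → ℕ} {k : ℕ} {h : Fin k → MatPoly}
    (hJ : BubbleUnisolvent v (cellOrder ρ) (rowwise (rtBubble hv)) h) {P : MatPoly}
    (hP : IsPi2 v ρ h 0 P) : P = 0 := by
  obtain ⟨hPV, hint, hface⟩ := isPi2_iff.1 hP
  simp only [Pi.zero_apply, sub_zero] at hint hface
  have hn : ∀ k, ∀ i, ∀ x ∈ face v i, dlam hv i ⬝ᵥ evalVec (P k) x = 0 := fun k i x hx =>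
    (dot_unitNormal_eq_zero hv i _).1 (dot_normal_eq_zero_of_moments hv (hPV k)
      (fun μ hμ => hface.moments hv rfl k hμ) x hx)
  have e : ((cellOrder (fun s => ρ s + 1) : ℕ) : ℤ) = (cellOrder ρ : ℤ) - 1 + 2 := by
    simp only [cellOrder]; push_cast; ring
  choose q hq hPq using fun k => exists_rtBubble hv (e ▸ (hPV k).1) (hn k)
  have hPJ : P = rowwise (rtBubble hv) (Matrix.of q) := funext fun k => hPq k
  have hq0 := hJ.eq_zero (q := Matrix.of q) (mem_matDeg.2 fun k => mem_vecDeg.1 (hq k))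
    (hPJ ▸ hint)
  rw [hPJ, hq0, map_zero]

theorem isPi2_evalMat {ρ : Finset (Fin 4) → ℕ} {k : ℕ} (h : Fin k → MatPoly) {P : MatPoly}
    (hP : P ∈ Pminus2VarMat v (fun s => ρ s + 1)) : IsPi2 v ρ h (evalMat P) P := by
  refine isPi2_iff.2 ⟨hP, ?_, ?_⟩ <;> simp only [sub_self]
  · exact interiorCond_zero _ _
  · exact faceCond_zero _ _

theorem pi2WellDefined {ρ : Finset (Fin 4) → ℕ} (hρ : IsOrder ρ) {k : ℕ} {h : Fin k → MatPoly}
    (hJ : BubbleUnisolvent v (cellOrder ρ) (rowwise (rtBubble hv)) h) :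
    Pi2WellDefined v ρ h := by
  obtain ⟨proj, hproj⟩ := exists_isProjectionFor (v := v) (R := IsPi2 v ρ h)
    (fun U hU => exists_isPi2 hv hρ hJ hU)
    (fun U hU U' hU' P P' hP hP' a b => by
      obtain ⟨h1, h2, h3⟩ := isPi2_iff.1 hP
      obtain ⟨h1', h2', h3'⟩ := isPi2_iff.1 hP'
      have m := evalMat_sub_mem_H1Mat P hU
      have m' := evalMat_sub_mem_H1Mat P' hU'
      refine isPi2_iff.2 ⟨fun k => Pminus2Var_lincomb (h1 k) (h1' k) a b, ?_, ?_⟩ <;>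
        simp only [evalMat_lincomb_sub]
      · exact h2.lincomb m m' h2' a b
      · exact h3.lincomb m m' h3' a b)
    (fun P hP => eq_zero_of_isPi2 hv hJ hP) (fun U P hP => isPi2_evalMat h hP.1)
  refine ⟨proj, hproj, Set.Subset.antisymm ?_ fun P hP => ?_⟩
  · rintro _ ⟨U, rfl⟩
    exact ((hproj.1 U _).2 rfl).1
  · exact ⟨⟨evalMat P, evalMat_mem_H1Mat P⟩, ((hproj.1 _ P).1 (isPi2_evalMat h hP)).symm⟩

/-! ### The operator with tangential traces -/

theorem isPi1_iff {ρ : Finset (Fin 4) → ℕ} {k : ℕ} {h : Fin k → MatPoly} {W : Pt → Mat}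
    {P : MatPoly} : IsPi1 v ρ h W P ↔ P ∈ Pminus1VarMat v (fun s => ρ s + 2) ∧
      InteriorCond v (cellOrder ρ) h (fun x => S1 (evalMat P x - W x)) ∧
      FaceCond v ρ (fun i => {τ | τ ⬝ᵥ unitNormal v i = 0}) (fun x => evalMat P x - W x) ∧
      ∀ k, ∀ i j, i ≠ j → ∀ x ∈ segment ℝ (v i) (v j), evalVec (P k) x ⬝ᵥ (v j - v i) = 0 := by
  have e : (∀ i j, i ≠ j → ∀ x ∈ segment ℝ (v i) (v j), evalMat P x *ᵥ (v j - v i) = 0) ↔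
      ∀ k, ∀ i j, i ≠ j → ∀ x ∈ segment ℝ (v i) (v j), evalVec (P k) x ⬝ᵥ (v j - v i) = 0 :=
    ⟨fun h k i j hij x hx => congrFun (h i j hij x hx) k,
      fun h i j hij x hx => funext fun k => h k i j hij x hx⟩
  rw [← e]
  simp only [IsPi1, InteriorCond, FaceCond, and_assoc]
  rfl

theorem ndBubble_dot_edge (q : VecPoly) {a b : Fin 4} (hab : a ≠ b) {x : Pt}
    (hx : x ∈ segment ℝ (v a) (v b)) : evalVec (ndBubble hv q) x ⬝ᵥ (v b - v a) = 0 := by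
  rw [mem_segment_vertex hv hab] at hx
  obtain ⟨k, hka, hkb⟩ : ∃ k, k ≠ a ∧ k ≠ b := by
    clear hx hab
    revert a b
    decide
  exact ndBubble_dot_edge_face hv q hkb.symm hka.symm ((mem_face hv).2 ⟨hx.1, hx.2 k hka hkb⟩)

theorem ndBubble_mem_Pminus1Var {ρ : Finset (Fin 4) → ℕ} {q : VecPoly}
    (hq : q ∈ vecDeg ((cellOrder ρ : ℤ) - 1)) :
    ndBubble hv q ∈ Pminus1Var v (fun s => ρ s + 2) := by
  have e : ((cellOrder (fun s => ρ s + 2) : ℕ) : ℤ) = (cellOrder ρ : ℤ) - 1 + 3 := by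
    simp only [cellOrder]; push_cast; ring
  refine ⟨e ▸ ndBubble_mem_Pminus1 hv hq, fun i => ⟨0, Submodule.zero_mem _, 0,
    Submodule.zero_mem _, fun x _ => by simp [evalVec_zero], fun x hx => ?_⟩,
    fun a b hab => ⟨0, Submodule.zero_mem _, fun x hx => ?_⟩⟩
  · rw [evalVec_zero, map_zero, zero_smul, add_zero]
    exact (tangPart_eq_zero_iff hv i _).2
      ⟨ndBubble_dot_edge_face hv q (Fin.succAbove_ne i 1) (Fin.succAbove_ne i 0) hx,
        ndBubble_dot_edge_face hv q (Fin.succAbove_ne i 2) (Fin.succAbove_ne i 0) hx⟩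
  · rw [map_zero]
    exact ndBubble_dot_edge hv q hab hx

/-- The same correction as for the normal traces, with the interior moments taken of `S1` of the
bubble. Since the bubble has no tangential trace, it affects neither the face nor the edge
conditions. -/
theorem exists_isPi1 {ρ : Finset (Fin 4) → ℕ} (hρ : IsOrder ρ) {k : ℕ} {h : Fin k → MatPoly}
    (hJ : BubbleUnisolvent v (cellOrder ρ) (s1Poly ∘ₗ rowwise (ndBubble hv)) h) {W : Pt → Mat}
    (hW : W ∈ H1Mat v) : ∃ P, IsPi1 v ρ h W P := by
  choose γ hγ using fun i a b => exists_isFaceTrace hv i (hW a b)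
  have hL := fun (k : Fin 3) (τ : Fin 4 → Pt) (i : Fin 4) =>
    memLp_dot_face (γ := fun x a b => γ i a b x) (fun a b => (hγ i a b).1) k (τ i)
  choose P₀ hP₀ hm hedge using fun k => exists_mem_Pminus1Var_moments hv hρ
    (hL k fun i => faceVertex v i 1 - faceVertex v i 0)
    (hL k fun i => faceVertex v i 2 - faceVertex v i 0)
  have hV := evalMat_sub_mem_H1Mat (Matrix.of P₀) hW
  obtain ⟨q, hq, hint⟩ := hJ.exists_interiorCond (S1_mem_H1Mat hV)
  have e : ∀ x, S1 (evalMat (Matrix.of P₀ + rowwise (ndBubble hv) q) x - W x) =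
      evalMat ((s1Poly ∘ₗ rowwise (ndBubble hv)) q) x + S1 (evalMat (Matrix.of P₀) x - W x) := by
    intro x
    have h1 := evalMat_lincomb 1 1 (Matrix.of P₀) (rowwise (ndBubble hv) q) x
    have h2 := S1_lincomb 1 1 (evalMat (rowwise (ndBubble hv) q) x)
      (evalMat (Matrix.of P₀) x - W x)
    simp only [one_smul] at h1 h2
    rw [h1, LinearMap.comp_apply, evalMat_s1Poly, ← h2]
    congr 1
    abel
  have hqr : ∀ k, q k ∈ vecDeg ((cellOrder ρ : ℤ) - 1) := fun k => mem_vecDeg.2 (mem_matDeg.1 hq k)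
  have e1 : ∀ k x, evalVec ((Matrix.of P₀ + rowwise (ndBubble hv) q) k) x =
      evalVec (P₀ k) x + evalVec (ndBubble hv (q k)) x := fun k x => evalVec_add _ _ _
  refine ⟨Matrix.of P₀ + rowwise (ndBubble hv) q,
    isPi1_iff.2 ⟨fun k => ?_, ?_, ?_, fun k i j hij x hx => ?_⟩⟩
  · have := Pminus1Var_lincomb (hP₀ k) (ndBubble_mem_Pminus1Var hv (hqr k)) 1 1
    simp only [one_smul] at this
    exact this
  · simpa only [e] using hint
  · refine faceCond_sub hW (γ := fun i x a b => γ i a b x) hγ fun i τ hτ k μ hμ => ?_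
    obtain ⟨h1, h2⟩ := hm k i μ hμ
    -- The moments were matched for the two edge directions of the face; a general tangent vector is
    -- their combination with these coefficients.
    set c := dlam hv (i.succAbove 1) ⬝ᵥ τ
    set d := dlam hv (i.succAbove 2) ⬝ᵥ τ
    have hτe : τ = c • (faceVertex v i 1 - faceVertex v i 0)
      + d • (faceVertex v i 2 - faceVertex v i 0) := eq_of_dot_unitNormal hv hτ
    have hsplit : ∀ w : Pt, w ⬝ᵥ τ = c * (w ⬝ᵥ (faceVertex v i 1 - faceVertex v i 0)) +
        d * (w ⬝ᵥ (faceVertex v i 2 - faceVertex v i 0)) := fun w => by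
      rw [hτe, dotProduct_add, dotProduct_smul, dotProduct_smul, smul_eq_mul, smul_eq_mul]
    have hPi : ∀ τ : Pt, Integrable (fun x => evalVec (P₀ k) x ⬝ᵥ τ * eval x μ)
        (faceMeasure v i) := fun τ => by
      simp only [← eval_dotPoly]
      exact integrable_face ((continuous_eval _).mul (continuous_eval _)) i
    have hγi := fun τ : Pt => integrable_mul_face (hL k (fun _ => τ) i) μ
    have hlhs : ∫ x, evalVec ((Matrix.of P₀ + rowwise (ndBubble hv) q) k) x ⬝ᵥ τ * eval x μ
        ∂faceMeasure v i =
        ∫ x, (c * (evalVec (P₀ k) x ⬝ᵥ (faceVertex v i 1 - faceVertex v i 0) * eval x μ) +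
          d * (evalVec (P₀ k) x ⬝ᵥ (faceVertex v i 2 - faceVertex v i 0) * eval x μ))
          ∂faceMeasure v i := by
      refine integral_congr_ae ((ae_mem_face i).mono fun x hx => ?_)
      have z1 := ndBubble_dot_edge_face hv (q k) (Fin.succAbove_ne i 1) (Fin.succAbove_ne i 0) hx
      have z2 := ndBubble_dot_edge_face hv (q k) (Fin.succAbove_ne i 2) (Fin.succAbove_ne i 0) hx
      simp only [hsplit, e1, add_dotProduct, faceVertex, z1, z2]
      ring
    have hrhs : ∫ x, (fun b => γ i k b x) ⬝ᵥ τ * eval x μ ∂faceMeasure v i =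
        ∫ x, (c * ((fun b => γ i k b x) ⬝ᵥ (faceVertex v i 1 - faceVertex v i 0) * eval x μ) +
          d * ((fun b => γ i k b x) ⬝ᵥ (faceVertex v i 2 - faceVertex v i 0) * eval x μ))
          ∂faceMeasure v i := by
      congr 1
      funext x
      rw [hsplit]
      ring
    rw [hlhs]
    refine Eq.trans ?_ hrhs.symm
    rw [integral_add ((hPi _).const_mul c) ((hPi _).const_mul d),
      integral_add ((hγi _).const_mul c) ((hγi _).const_mul d)]
    simp only [integral_const_mul, h1, h2]
  · rw [e1, add_dotProduct, hedge k i j hij x hx, ndBubble_dot_edge hv _ hij hx, add_zero]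

theorem eq_zero_of_isPi1 {ρ : Finset (Fin 4) → ℕ} {k : ℕ} {h : Fin k → MatPoly}
    (hJ : BubbleUnisolvent v (cellOrder ρ) (s1Poly ∘ₗ rowwise (ndBubble hv)) h) {P : MatPoly}
    (hP : IsPi1 v ρ h 0 P) : P = 0 := by
  obtain ⟨hPV, hint, hface, hedge⟩ := isPi1_iff.1 hP
  simp only [Pi.zero_apply, sub_zero] at hint hface
  have ht : ∀ k, ∀ i a b, a ≠ i → b ≠ i → ∀ x ∈ face v i,
      evalVec (P k) x ⬝ᵥ (v a - v b) = 0 := fun k i a b ha hb x hx =>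
    dot_edges_eq_zero_of_moments hv (hPV k) (hedge k) (fun μ hμ => by
      have hτ : ∀ a b, faceVertex v i a - faceVertex v i b ∈ {τ | τ ⬝ᵥ unitNormal v i = 0} :=
        fun a b => (dotProduct_comm _ _).trans (unitNormal_dot_faceEdge i a b)
      exact ⟨hface.moments hv (hτ 1 0) k hμ, hface.moments hv (hτ 2 0) k hμ⟩) x hx a b ha hb
  have e : ((cellOrder (fun s => ρ s + 2) : ℕ) : ℤ) = (cellOrder ρ : ℤ) - 1 + 3 := by
    simp only [cellOrder]; push_cast; ring
  choose q hq hPq using fun k => exists_ndBubble hv (e ▸ (hPV k).1) (ht k)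
  have hPJ : P = rowwise (ndBubble hv) (Matrix.of q) := funext fun k => hPq k
  have hS : evalMat ((s1Poly ∘ₗ rowwise (ndBubble hv)) (Matrix.of q)) =
      fun x => S1 (evalMat P x) := by
    funext x
    rw [LinearMap.comp_apply, ← hPJ, evalMat_s1Poly]
  have hq0 := hJ.eq_zero (q := Matrix.of q) (mem_matDeg.2 fun k => mem_vecDeg.1 (hq k))
    (hS ▸ hint)
  rw [hPJ, hq0, map_zero]

/-- The edge conditions concern `P` alone and not a difference. They are inherited from `IsPi1 v ρ h
W P`, which is why only values of the operator, and not all fields of the space, are reproduced. -/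
theorem isPi1_evalMat {ρ : Finset (Fin 4) → ℕ} {k : ℕ} (h : Fin k → MatPoly) {W : Pt → Mat}
    {P : MatPoly} (hP : IsPi1 v ρ h W P) : IsPi1 v ρ h (evalMat P) P := by
  obtain ⟨h1, -, -, h4⟩ := isPi1_iff.1 hP
  refine isPi1_iff.2 ⟨h1, ?_, ?_, h4⟩ <;> simp only [sub_self]
  · have e : S1 0 = 0 := by simp [S1]
    rw [e]
    exact interiorCond_zero _ _
  · exact faceCond_zero _ _

theorem pi1WellDefined {ρ : Finset (Fin 4) → ℕ} (hρ : IsOrder ρ) {k : ℕ} {h : Fin k → MatPoly}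
    (hJ : BubbleUnisolvent v (cellOrder ρ) (s1Poly ∘ₗ rowwise (ndBubble hv)) h) :
    Pi1WellDefined v ρ h := by
  obtain ⟨proj, hproj⟩ := exists_isProjectionFor (v := v) (R := IsPi1 v ρ h)
    (fun W hW => exists_isPi1 hv hρ hJ hW)
    (fun U hU U' hU' P P' hP hP' a b => by
      obtain ⟨h1, h2, h3, h4⟩ := isPi1_iff.1 hP
      obtain ⟨h1', h2', h3', h4'⟩ := isPi1_iff.1 hP'
      have m := evalMat_sub_mem_H1Mat P hU
      have m' := evalMat_sub_mem_H1Mat P' hU'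
      refine isPi1_iff.2 ⟨fun k => Pminus1Var_lincomb (h1 k) (h1' k) a b, ?_, ?_,
        fun k i j hij x hx => ?_⟩
      · simp only [evalMat_lincomb_sub, S1_lincomb]
        exact h2.lincomb (S1_mem_H1Mat m) (S1_mem_H1Mat m') h2' a b
      · simp only [evalMat_lincomb_sub]
        exact h3.lincomb m m' h3' a b
      · have e1 : evalVec ((a • P + b • P') k) x = a • evalVec (P k) x + b • evalVec (P' k) x :=
          evalVec_lincomb a b (P k) (P' k) x
        rw [e1, add_dotProduct, smul_dotProduct, smul_dotProduct, h4 k i j hij x hx,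
          h4' k i j hij x hx]
        simp)
    (fun P hP => eq_zero_of_isPi1 hv hJ hP) (fun W P hP => isPi1_evalMat h hP)
  exact ⟨proj, hproj⟩

end MixedElasticity

end


/-! ### The exceptional parameters and the common choice -/

open MixedElasticity in
theorem lemma5p4 (v : Fin 4 → Pt) (hv : AffineIndependent ℝ v) (r k : ℕ)
    (f : Module.Basis (Fin k) ℝ (curlBubble v r))
    (g : Fin k → MatPoly) (hg : LinearIndependent ℝ g)
    (hdisj : Disjoint (Submodule.span ℝ (Set.range g)) (gradSpace r))
    (hsup : Submodule.span ℝ (Set.range g) ⊔ gradSpace r = matDeg ((r : ℤ) - 1)) :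
    (∀ ρ : Finset (Fin 4) → ℕ, IsOrder ρ → cellOrder ρ = r →
      {t ∈ Set.Icc (0 : ℝ) 1 |
        ¬ Pi2WellDefined v ρ (interp (fun i => (f i : MatPoly)) g t)}.Finite) ∧
    (∀ ρ : Finset (Fin 4) → ℕ, IsOrder ρ → cellOrder ρ = r →
      {t ∈ Set.Icc (0 : ℝ) 1 |
        ¬ Pi1WellDefined v ρ (interp (fun i => (f i : MatPoly)) g t)}.Finite) ∧
    ∃ t ∈ Set.Icc (0 : ℝ) 1, ∀ ρ : Finset (Fin 4) → ℕ, IsOrder ρ → cellOrder ρ = r →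
      Pi2WellDefined v ρ (interp (fun i => (f i : MatPoly)) g t) ∧
      Pi1WellDefined v ρ (interp (fun i => (f i : MatPoly)) g t) := by
  have h2 := rtBubble_moments_bijective hv hg hdisj hsup
  have h1 := ndBubble_moments_bijective hv hg hdisj hsup
  -- Bijectivity at `t = 1` confines the failure of unisolvence to finitely many parameters, a set
  -- that does not depend on the order function.
  have key : ∀ J : MatPoly →ₗ[ℝ] MatPoly, Function.Bijective (bubbleMoments v r J g) →
      {t : ℝ | ¬ BubbleUnisolvent v r J (interp (fun i => (f i : MatPoly)) g t)}.Finite := by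
    intro J hJ
    refine (finite_not_bijective (bubbleMoments v r J fun i => (f i : MatPoly)) _ hJ).subset
      fun t ht hb => ht (bubbleUnisolvent_of_bijective ?_)
    rwa [bubbleMoments_interp]
  have hone : interp (fun i => (f i : MatPoly)) g 1 = g := by
    funext i
    simp [interp]
  -- The common parameter is `t = 1`, where the test fields are the `g i` and both moment maps are
  -- bijective.
  refine ⟨fun ρ hρ hr => ?_, fun ρ hρ hr => ?_, 1, by simp, fun ρ hρ hr => ?_⟩
  · subst hr
    exact (key _ h2).subset fun t ht hb => ht.2 (pi2WellDefined hv hρ hb)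
  · subst hr
    exact (key _ h1).subset fun t ht hb => ht.2 (pi1WellDefined hv hρ hb)
  · subst hr
    rw [hone]
    exact ⟨pi2WellDefined hv hρ (bubbleUnisolvent_of_bijective h2),
      pi1WellDefined hv hρ (bubbleUnisolvent_of_bijective h1)⟩
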